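/- **Theorem 1.4 (Whispering-gallery waves).** Let $0\le R_0<R_1<R_2$, and let $\mathcal M=\{x\in\mathbb R^2: R_0\le |x|\le R_2\}$ (an annulus if $R_0>0$, a closed disk if $R_0=0$), $S=\{|x|=R_1\}$, $\Omega_-=\operatorname{Int}(\mathcal M)\cap\{|x|<R_1\}$, $\Omega_+=\operatorname{Int}(\mathcal M)\cap\{|x|>R_1\}$, and let $\nu$ be the unit normal to $S$ pointing into $\Omega_+$. Let $c=c_-$ on $\Omega_-$ and $c=c_+$ on $\Omega_+$, with constants $c_\pm>0$ such that $c_- /R_1^2<c_+/R_2^2$. For $T>0$ consider the system $$\begin{cases}\partial_t^2w-\operatorname{div}(c\nabla w)=0&\text{in }(0,T)\times(\Omega_-\cup\Omega_+),\\ w|_{S_-}=w|_{S_+},\quad c_-\,\partial_\nu w|_{S_-}=c_+\,\partial_\nu w|_{S_+}&\text{in }(0,T)\times S,\\ w=0&\text{in }(0,T)\times\partial\mathcal M,\\ (w,\partial_tw)|_{t=0}=(w_0,w_1)&\text{in }\mathcal M,\end{cases}\tag{1}$$ where $|_{S_\pm}$ denotes the trace on $S$ from $\Omega_\pm$. "Solution"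 means a complex-valued classical solution that is smooth up to the boundary on $[0,T]\times\overline{\Omega_-}$ and on $[0,T]\times\overline{\Omega_+}$. Put $$\Lambda(w)=\frac{\|(w_0,w_1)\|_{H^1\times L^2}}{\|(w_0,w_1)\|_{L^2\times H^{-1}}}.$$ (i) There are $\lambda_n>0$ with $\lambda_n\to+\infty$ and functions $u_n$ on $\mathcal M$ such that $w_n(t,x)=\cos(\sqrt{\lambda_n}\,t)\,u_n(x)$, $n\in\mathbb N$, solves (1) with data $(u_n,0)$ for every $T>0$, $\|w_n(0)\|_{L^2(\mathcal M)}=1$, $\Lambda(w_n)<\infty$, $\Lambda(w_n)\to+\infty$, and such that for every $T>0$ and every $\omega\subset\mathcal M$ with $\operatorname{dist}(\overline\omega,S)>0$ there exist $C,d>0$ with $$\|w_n\|_{L^2((0,T)\times\omega)}\le Ce^{-d\Lambda(w_n)}\qquad\text{for all }n.$$ (ii) Hence the quantitative unique continuation estimate $\|(w_0,w_1)\|_{H^1\times L^2}\le Ce^{C\Lambda(w)}\|w\|_{L^2((0,T)\times\omega)}$ is optimal in the following sense. Let $T>0$, let $\omega\subset\mathcal M$ with $\operatorname{dist}(\overline\omega,S)>0$,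 and let $G:\mathbb R\to\mathbb R$ satisfy $G(s)=O(e^{\varepsilon s})$ as $s\to+\infty$ for every $\varepsilon>0$. Then the estimate $$\|(w_0,w_1)\|_{H^1\times L^2}\le G(\Lambda(w))\,\|w\|_{L^2((0,T)\times\omega)}$$ does not hold for all solutions $w$ of (1) with $0<\|(w_0,w_1)\|_{H^1\times L^2}<\infty$. -/

import Mathlib

open MeasureTheory Filter Topology Asymptotics
open scoped ENNReal

noncomputable section

namespace WhisperingGallery

/-- The Euclidean plane. -/
abbrev Plane := EuclideanSpace ℝ (Fin 2)

/-! ### Geometry: annuli and disks with a circular interface -/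

/-- A planar annulus (`0 < R₀`) or disk (`R₀ = 0`) of outer radius `R₂`, cut along the circle of
radius `R₁`, with a coefficient equal to `cm` inside that circle and to `cp` outside. -/
structure RoundSetting where
  R₀ : ℝ
  R₁ : ℝ
  R₂ : ℝ
  cm : ℝ
  cp : ℝ
  R₀_nonneg : 0 ≤ R₀
  R₀_lt_R₁ : R₀ < R₁
  R₁_lt_R₂ : R₁ < R₂
  cm_pos : 0 < cm
  cp_pos : 0 < cp

namespace RoundSetting

variable (D : RoundSetting)

/-- The compact set `𝓜`; for `R₀ = 0` the removed ball is empty and `𝓜` is the closed disk. -/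
def M : Set Plane := Metric.closedBall 0 D.R₂ \ Metric.ball 0 D.R₀

/-- The interface `S`. -/
def S : Set Plane := Metric.sphere 0 D.R₁

/-- `Ω₋`, the part of the interior of `𝓜` enclosed by the interface. -/
def Ωm : Set Plane := interior D.M ∩ Metric.ball 0 D.R₁

/-- `Ω₊`, the part of the interior of `𝓜` outside the interface. -/
def Ωp : Set Plane := interior D.M \ Metric.closedBall 0 D.R₁

/-- The coefficient `c`, equal to `cm` on `Ω₋` and to `cp` on `Ω₊`. -/
def c (x : Plane) : ℝ := if ‖x‖ < D.R₁ then D.cm else D.cp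

/-- The unit normal on `S` that points into `Ω₊`. -/
def ν (x : Plane) : Plane := ‖x‖⁻¹ • x

/-- `dist(closure ω, S) > 0`. -/
def AwayFromInterface (ω : Set Plane) : Prop :=
  ∃ δ : ℝ, 0 < δ ∧ ∀ x ∈ closure ω, ∀ y ∈ D.S, δ ≤ dist x y

end RoundSetting

/-! ### Sobolev norms -/

/-- The `i`-th standard basis vector of the plane. -/
def e (i : Fin 2) : Plane := EuclideanSpace.single i 1

/-- `‖f‖_{L²(A)}`. -/
def l2Norm {F : Type*} [NormedAddCommGroup F] (A : Set Plane) (f : Plane → F) : ℝ≥0∞ :=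
  eLpNorm f 2 (volume.restrict A)

/-- Smooth functions with compact support in `Ω`. -/
def IsTestFunction {F : Type*} [NormedAddCommGroup F] [NormedSpace ℝ F]
    (Ω : Set Plane) (φ : Plane → F) : Prop :=
  ContDiff ℝ (⊤ : ℕ∞) φ ∧ HasCompactSupport φ ∧ tsupport φ ⊆ Ω

/-- `g` is the gradient of `u` in the sense of distributions on the open set `Ω`. -/
def HasWeakGradient (Ω : Set Plane) (u : Plane → ℂ) (g : Plane → EuclideanSpace ℂ (Fin 2)) :
    Prop :=
  LocallyIntegrableOn u Ω ∧ LocallyIntegrableOn g Ω ∧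
    ∀ φ : Plane → ℝ, IsTestFunction Ω φ → ∀ i : Fin 2,
      ∫ x in Ω, (fderiv ℝ φ x (e i)) • u x = -∫ x in Ω, φ x • (g x i)

/-- `‖∇u‖_{L²(Ω)}` (weak gradients are a.e. unique), infinite if `u` has no weak gradient. -/
def gradNorm (Ω : Set Plane) (u : Plane → ℂ) : ℝ≥0∞ :=
  ⨅ (g : Plane → EuclideanSpace ℂ (Fin 2)) (_ : HasWeakGradient Ω u g), l2Norm Ω g

/-- Norm of a pair, `(a² + b²)^{1/2}`. -/
def pairNorm (a b : ℝ≥0∞) : ℝ≥0∞ := (a ^ 2 + b ^ 2) ^ (1 / 2 : ℝ)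

/-- `‖u‖_{H¹(Ω)}`. -/
def h1Norm (Ω : Set Plane) (u : Plane → ℂ) : ℝ≥0∞ :=
  pairNorm (l2Norm Ω u) (gradNorm Ω u)

/-- `‖f‖_{H⁻¹(Ω)}` of a function `f ∈ L²(Ω)`: its norm as a functional on `H¹₀(Ω)`, in which the
test functions are dense. -/
def hMinusOneNorm (Ω : Set Plane) (f : Plane → ℂ) : ℝ≥0∞ :=
  ⨆ (φ : Plane → ℂ) (_ : IsTestFunction Ω φ) (_ : h1Norm Ω φ ≤ 1), ‖∫ x in Ω, f x * φ x‖ₑ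

/-- `‖w‖_{L²((0,T) × ω)}`. -/
def spaceTimeNorm (T : ℝ) (ω : Set Plane) (w : ℝ → Plane → ℂ) : ℝ≥0∞ :=
  eLpNorm (fun p : ℝ × Plane => w p.1 p.2) 2 (volume.restrict (Set.Ioo 0 T ×ˢ ω))

/-! ### The wave transmission system -/

/-- `div (c ∇ f)` at the point `x`. -/
def divGrad (c : Plane → ℝ) (f : Plane → ℂ) (x : Plane) : ℂ :=
  ∑ i : Fin 2, fderiv ℝ (fun y => (c y : ℂ) * fderiv ℝ f y (e i)) x (e i)

namespace RoundSetting

variable (D : RoundSetting)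

/-- `‖(w₀, w₁)‖_{H¹ × L²}`. -/
def energyNorm (w₀ w₁ : Plane → ℂ) : ℝ≥0∞ :=
  pairNorm (h1Norm (interior D.M) w₀) (l2Norm (interior D.M) w₁)

/-- `‖(w₀, w₁)‖_{L² × H⁻¹}`. -/
def weakNorm (w₀ w₁ : Plane → ℂ) : ℝ≥0∞ :=
  pairNorm (l2Norm (interior D.M) w₀) (hMinusOneNorm (interior D.M) w₁)

/-- The typical frequency `Λ = ‖(w₀, w₁)‖_{H¹ × L²} / ‖(w₀, w₁)‖_{L² × H⁻¹}` of a wave with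
Cauchy data `(w₀, w₁)`. -/
def freq (w₀ w₁ : Plane → ℂ) : ℝ≥0∞ := D.energyNorm w₀ w₁ / D.weakNorm w₀ w₁

/-- `w` is a classical solution on `[0, T]` of the wave transmission system with Dirichlet boundary
condition and Cauchy data `(w₀, w₁)`. Here `wm`, `wp` are the restrictions of `w` to `Ω₋`, `Ω₊`,
smooth up to the boundary, so that the traces on `S` and on `∂𝓜` are their values there. -/
def IsWaveSolution (T : ℝ) (w : ℝ → Plane → ℂ) (w₀ w₁ : Plane → ℂ) : Prop :=
  ∃ wm wp : ℝ → Plane → ℂ,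
    -- regularity up to the boundary on both sides of the interface
    (∃ U : Set (ℝ × Plane), IsOpen U ∧ Set.Icc 0 T ×ˢ closure D.Ωm ⊆ U ∧
      ContDiffOn ℝ (⊤ : ℕ∞) (fun p : ℝ × Plane => wm p.1 p.2) U) ∧
    (∃ U : Set (ℝ × Plane), IsOpen U ∧ Set.Icc 0 T ×ˢ closure D.Ωp ⊆ U ∧
      ContDiffOn ℝ (⊤ : ℕ∞) (fun p : ℝ × Plane => wp p.1 p.2) U) ∧
    (∀ t ∈ Set.Icc 0 T, ∀ x ∈ D.Ωm, w t x = wm t x) ∧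
    (∀ t ∈ Set.Icc 0 T, ∀ x ∈ D.Ωp, w t x = wp t x) ∧
    -- the wave equation `∂ₜ² w - div (c ∇ w) = 0`
    (∀ t ∈ Set.Ioo 0 T, ∀ x ∈ D.Ωm ∪ D.Ωp,
      iteratedDeriv 2 (fun s => w s x) t - divGrad D.c (w t) x = 0) ∧
    -- the transmission conditions
    (∀ t ∈ Set.Ioo 0 T, ∀ x ∈ D.S, wm t x = wp t x) ∧
    (∀ t ∈ Set.Ioo 0 T, ∀ x ∈ D.S,
      (D.cm : ℂ) * fderiv ℝ (wm t) x (ν x) = (D.cp : ℂ) * fderiv ℝ (wp t) x (ν x)) ∧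
    -- the Dirichlet condition
    (∀ t ∈ Set.Ioo 0 T, ∀ x ∈ frontier D.M ∩ closure D.Ωm, wm t x = 0) ∧
    (∀ t ∈ Set.Ioo 0 T, ∀ x ∈ frontier D.M ∩ closure D.Ωp, wp t x = 0) ∧
    -- the Cauchy data
    (∀ x ∈ D.Ωm ∪ D.Ωp, w 0 x = w₀ x) ∧
    (∀ x ∈ D.Ωm ∪ D.Ωp, HasDerivWithinAt (fun t => w t x) (w₁ x) (Set.Icc 0 T) 0)

end RoundSetting

end WhisperingGallery

end

/-!
The waves are separated modes `cos (√λ t) u`, where `u` is a transmission eigenfunction of the form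
`zⁿ h(|z|²)`, with angular momentum `n` and a positive radial factor.

In the variable `s = log r`, the radial factor `g(s) = rⁿ h(r²)` solves `g'' = (n² - κ e^{2s}) g`
with `κ = λ / c₋` below the interface and `κ = λ / c₊` above it, and the transmission conditions say
that `g` and `c g'` are continuous. Glue the inner solution that satisfies the condition at `R₀`
(for a disk, the Bessel series that is regular at the origin) to the outer solution, and raise `λ`
from `c₋ n² / R₁²`. There the glued solution is still positive, and the first `λ` at which it
acquires a zero makes the zero sit at `R₂`: this is the eigenvalue, and `g` is positive below `R₂`
(`exists_eigenvalue`, `exists_groundMode`). For `λ` larger than `c₋ n² / R₁²` by a fixed factor, the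
potential is at most `-μ²` with `μ` of order `n` on a fixed interval ending at the interface, which
forces a sign change (`not_pos_of_oscillating`); hence `λ_n / n² → c₋ / R₁²`.

Since `c₋ / R₁² < c₊ / R₂²`, the potential is then at least a multiple of `n²` on each compact
part of `𝓜` away from the interface, on either side. The condition at the far end of each side
makes the positive factor `g` increase towards the interface, and there it grows at least like
`e^{μs} / 2` with `μ` of order `n` (`exp_growth`), so the `L²`-normalized modes are `O(e^{-dn})` away
from the interface (`inner_decay`, `outer_decay`, `GroundMode.exists_uniform_decay`). Multiplying the radial
equation by its solution and integrating gives the energy identity, so that the frequency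
`Λ = √(1 + ‖∇u‖²)` lies between `n / R₂` and a constant times `n`. Thus decay in `n` is decay in
`Λ`, and a subexponential `G` in the observability estimate is contradicted by the modes.

The norms in the statement involve distributional gradients. The modes are only Lipschitz across
the interface; that their classical gradient is the weak one follows from integration by parts for
Lipschitz functions, applied to the radial factor (`IsMode.hasWeakGradient`).
-/

noncomputable section

namespace WhisperingGallery

/-! ### Linear ordinary differential equations with a parameter -/

section LinearODE

variable {X E : Type*} [NormedAddCommGroup E] [NormedSpace ℝ E]

/-- The terms of the Picard series of `y' = A y`, `y(t₀) = y₀`, where both `A` and `y₀` depend on a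
parameter `x`. -/
def picardTerm (A : X → ℝ → E →L[ℝ] E) (y₀ : X → E) (t₀ : ℝ) : ℕ → X → ℝ → E
  | 0 => fun x _ => y₀ x
  | m + 1 => fun x t => ∫ τ in t₀..t, A x τ (picardTerm A y₀ t₀ m x τ)

variable {A : X → ℝ → E →L[ℝ] E} {y₀ : X → E} {t₀ : ℝ}

lemma continuous_picardTerm [TopologicalSpace X] (hA : Continuous ↿A) (hy : Continuous y₀) (m : ℕ) :
    Continuous ↿(picardTerm A y₀ t₀ m) := by
  induction m with
  | zero => exact hy.comp continuous_fst
  | succ m ih =>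
    have h : Continuous (Function.uncurry fun (x : X) τ => A x τ (picardTerm A y₀ t₀ m x τ)) :=
      hA.clm_apply ih
    exact intervalIntegral.continuous_parametric_primitive_of_continuous h

lemma norm_picardTerm_le {K : Set X} {R C M : ℝ} (hM : ∀ x ∈ K, ∀ t, |t - t₀| ≤ R → ‖A x t‖ ≤ M)
    (hC : ∀ x ∈ K, ‖y₀ x‖ ≤ C) (hM0 : 0 ≤ M) (m : ℕ) {x : X} (hx : x ∈ K) {t : ℝ}
    (ht : |t - t₀| ≤ R) :
    ‖picardTerm A y₀ t₀ m x t‖ ≤ C * (M ^ m * |t - t₀| ^ m / (m.factorial : ℝ)) := by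
  induction m generalizing t with
  | zero => simpa [picardTerm] using hC x hx
  | succ m ih =>
    calc ‖∫ τ in t₀..t, A x τ (picardTerm A y₀ t₀ m x τ)‖
        ≤ ∫ τ in Set.uIoc t₀ t, C * (M ^ (m + 1) / (m.factorial : ℝ)) * |τ - t₀| ^ m := by
          rw [intervalIntegral.norm_intervalIntegral_eq]
          refine norm_integral_le_of_norm_le ?_ ?_
          · exact (Continuous.integrableOn_uIoc (by fun_prop))
          · refine (ae_restrict_iff' measurableSet_uIoc).2 (ae_of_all _ fun τ hτ => ?_)
            have hτ' : |τ - t₀| ≤ |t - t₀| :=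
              Set.abs_sub_left_of_mem_uIcc (Set.uIoc_subset_uIcc hτ)
            refine ((A x τ).le_opNorm _).trans ?_
            calc _ ≤ M * (C * (M ^ m * |τ - t₀| ^ m / (m.factorial : ℝ))) :=
                  mul_le_mul (hM x hx τ (hτ'.trans ht)) (ih (hτ'.trans ht)) (norm_nonneg _) hM0
              _ = _ := by ring
      _ = _ := by
          rw [integral_const_mul, integral_pow_abs_sub_uIoc, Nat.factorial_succ]
          push_cast
          field_simp

/-- A linear equation `y' = A y` whose coefficients and initial value depend continuously on a
parameter has a solution on the whole line, continuous in the parameter and time together. -/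
theorem exists_linear_ode_solution [TopologicalSpace X] [CompleteSpace E] [LocallyCompactSpace X] (hA : Continuous ↿A)
    (hy : Continuous y₀) (t₀ : ℝ) :
    ∃ y : X → ℝ → E, Continuous ↿y ∧ (∀ x, y x t₀ = y₀ x) ∧
      ∀ x t, HasDerivAt (y x) (A x t (y x t)) t := by
  have key : ∀ K : Set X, IsCompact K → ∀ R : ℝ, ∃ u v : ℕ → ℝ, Summable u ∧ Summable v ∧
      (∀ m, ∀ x ∈ K, ∀ t, |t - t₀| ≤ R → ‖picardTerm A y₀ t₀ m x t‖ ≤ u m) ∧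
      (∀ m, ∀ x ∈ K, ∀ t, |t - t₀| ≤ R → ‖A x t (picardTerm A y₀ t₀ m x t)‖ ≤ v m) := by
    intro K hK R
    obtain ⟨M, hM⟩ := (hK.prod (isCompact_closedBall t₀ R)).exists_bound_of_continuousOn
      hA.continuousOn
    obtain ⟨C, hC⟩ := hK.exists_bound_of_continuousOn hy.continuousOn
    have hM' : ∀ x ∈ K, ∀ t, |t - t₀| ≤ R → ‖A x t‖ ≤ |M| := fun x hx t ht =>
      (hM (x, t) ⟨hx, by simpa [Real.dist_eq] using ht⟩).trans (le_abs_self M)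
    have hC' : ∀ x ∈ K, ‖y₀ x‖ ≤ |C| := fun x hx => (hC x hx).trans (le_abs_self C)
    have hb : ∀ m, ∀ x ∈ K, ∀ t, |t - t₀| ≤ R → ‖picardTerm A y₀ t₀ m x t‖ ≤
        |C| * ((|M| * |R|) ^ m / (m.factorial : ℝ)) := by
      intro m x hx t ht
      refine (norm_picardTerm_le hM' hC' (abs_nonneg M) m hx ht).trans ?_
      rw [← mul_pow]
      have : |t - t₀| ≤ |R| := ht.trans (le_abs_self R)
      gcongr
    refine ⟨_, fun m => |M| * (|C| * ((|M| * |R|) ^ m / (m.factorial : ℝ))),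
      (Real.summable_pow_div_factorial (|M| * |R|)).mul_left |C|,
      ((Real.summable_pow_div_factorial (|M| * |R|)).mul_left |C|).mul_left |M|, hb, ?_⟩
    intro m x hx t ht
    exact ((A x t).le_opNorm _).trans
      (mul_le_mul (hM' x hx t ht) (hb m x hx t ht) (norm_nonneg _) (abs_nonneg M))
  have hsum : ∀ x t, Summable fun m => picardTerm A y₀ t₀ m x t := by
    intro x t
    obtain ⟨u, v, hu, -, h, -⟩ := key {x} isCompact_singleton |t - t₀|
    exact Summable.of_norm_bounded hu fun m => h m x rfl t le_rfl
  refine ⟨fun x t => ∑' m, picardTerm A y₀ t₀ m x t, ?_, ?_, ?_⟩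
  · rw [continuous_iff_continuousAt]
    rintro ⟨x, t⟩
    obtain ⟨K, hK, hxK⟩ := exists_compact_mem_nhds x
    obtain ⟨u, -, hu, -, h, -⟩ := key K hK (|t - t₀| + 1)
    have hc : ContinuousOn (fun p : X × ℝ => ∑' m, picardTerm A y₀ t₀ m p.1 p.2)
        (K ×ˢ Metric.closedBall t₀ (|t - t₀| + 1)) := by
      refine continuousOn_tsum (fun m => (continuous_picardTerm hA hy m).continuousOn) hu ?_
      rintro m ⟨x', t'⟩ ⟨hx', ht'⟩
      exact h m x' hx' t' (by simpa [Real.dist_eq] using ht')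
    refine hc.continuousAt (prod_mem_nhds hxK ?_)
    exact Filter.mem_of_superset (Metric.isOpen_ball.mem_nhds
      (show t ∈ Metric.ball t₀ (|t - t₀| + 1) by simp [Real.dist_eq])) Metric.ball_subset_closedBall
  · intro x
    simp only
    rw [(hsum x t₀).tsum_eq_zero_add]
    simp [picardTerm]
  · intro x t
    obtain ⟨u, v, hu, hv, h, h'⟩ := key {x} isCompact_singleton (|t - t₀| + 1)
    have hd : ∀ m s, HasDerivAt (picardTerm A y₀ t₀ (m + 1) x)
        (A x s (picardTerm A y₀ t₀ m x s)) s := by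
      intro m s
      have hc : Continuous fun τ => A x τ (picardTerm A y₀ t₀ m x τ) :=
        (hA.comp (by fun_prop : Continuous fun τ : ℝ => (x, τ))).clm_apply
          ((continuous_picardTerm hA hy m).comp (by fun_prop : Continuous fun τ : ℝ => (x, τ)))
      exact (hc.integral_hasStrictDerivAt t₀ s).hasDerivAt
    have hD := hasDerivAt_tsum_of_isPreconnected (y := t) hv
      (Metric.isOpen_ball (x := t₀) (ε := |t - t₀| + 1))
      (convex_ball t₀ _).isPreconnected (fun m s _ => hd m s)
      (fun m s hs => h' m x rfl s (by
        have := Metric.mem_ball.1 hs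
        rw [Real.dist_eq] at this
        exact this.le)) (Metric.mem_ball_self (by positivity))
      ((summable_nat_add_iff 1).2 (hsum x t₀)) (by simp [Real.dist_eq])
    have he : (fun s => ∑' m, picardTerm A y₀ t₀ m x s) =
        fun s => y₀ x + ∑' m, picardTerm A y₀ t₀ (m + 1) x s := by
      funext s
      rw [(hsum x s).tsum_eq_zero_add]
      simp [picardTerm]
    have hy' : A x t (∑' m, picardTerm A y₀ t₀ m x t) =
        ∑' m, A x t (picardTerm A y₀ t₀ m x t) := (A x t).map_tsum (hsum x t)
    change HasDerivAt (fun s => ∑' m, picardTerm A y₀ t₀ m x s)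
      (A x t (∑' m, picardTerm A y₀ t₀ m x t)) t
    rw [he, hy']
    exact hD.const_add _

end LinearODE

/-- `g` solves `g'' = q g` on the whole line, and `g₁` is its derivative. -/
def IsSol (q g g₁ : ℝ → ℝ) : Prop :=
  ∀ s, HasDerivAt g (g₁ s) s ∧ HasDerivAt g₁ (q s * g s) s

theorem exists_isSol {q : ℝ → ℝ → ℝ} (hq : Continuous ↿q) {A B : ℝ → ℝ} (hA : Continuous A)
    (hB : Continuous B) (t₀ : ℝ) :
    ∃ g g₁ : ℝ → ℝ → ℝ, Continuous ↿g ∧ Continuous ↿g₁ ∧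
      ∀ l, g l t₀ = A l ∧ g₁ l t₀ = B l ∧ IsSol (q l) (g l) (g₁ l) := by
  obtain ⟨y, hy, hy0, hd⟩ := exists_linear_ode_solution
    (A := fun l s => (ContinuousLinearMap.inl ℝ ℝ ℝ).comp (ContinuousLinearMap.snd ℝ ℝ ℝ) +
      q l s • (ContinuousLinearMap.inr ℝ ℝ ℝ).comp (ContinuousLinearMap.fst ℝ ℝ ℝ))
    (y₀ := fun l => (A l, B l)) (continuous_const.add (hq.smul continuous_const))
    (hA.prodMk hB) t₀
  refine ⟨fun l s => (y l s).1, fun l s => (y l s).2, continuous_fst.comp hy,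
    continuous_snd.comp hy, fun l => ⟨by simp [hy0], by simp [hy0], fun s => ⟨?_, ?_⟩⟩⟩
  · simpa using! (ContinuousLinearMap.fst ℝ ℝ ℝ).hasFDerivAt.comp_hasDerivAt s (hd l s)
  · simpa using! (ContinuousLinearMap.snd ℝ ℝ ℝ).hasFDerivAt.comp_hasDerivAt s (hd l s)

namespace IsSol

variable {q g g₁ : ℝ → ℝ}

lemma continuous (h : IsSol q g g₁) : Continuous g :=
  continuous_iff_continuousAt.2 fun s => (h s).1.continuousAt

lemma continuous_deriv (h : IsSol q g g₁) : Continuous g₁ :=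
  continuous_iff_continuousAt.2 fun s => (h s).2.continuousAt

lemma comp_neg (h : IsSol q g g₁) :
    IsSol (fun s => q (-s)) (fun s => g (-s)) (fun s => -g₁ (-s)) := fun s => by
  refine ⟨?_, ?_⟩
  · simpa using! (h (-s)).1.scomp s (hasDerivAt_neg s)
  · simpa using! ((h (-s)).2.scomp s (hasDerivAt_neg s)).neg

/-- A solution with vanishing Cauchy data at one point vanishes. -/
lemma eq_zero (h : IsSol q g g₁) (hq : Continuous q) {t₀ : ℝ} (h0 : g t₀ = 0) (h1 : g₁ t₀ = 0)
    (s : ℝ) : g s = 0 := by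
  set R := |s - t₀| + 1 with hR
  obtain ⟨M, hM⟩ := (isCompact_Icc (a := t₀ - R) (b := t₀ + R)).exists_bound_of_continuousOn
    hq.continuousOn
  have hR0 : |s - t₀| < R := by simp [hR]
  have hRp : 0 < R := (abs_nonneg _).trans_lt hR0
  have hs : s ∈ Set.Ioo (t₀ - R) (t₀ + R) := by
    rw [abs_lt] at hR0
    exact ⟨by linarith, by linarith⟩
  have := ODE_solution_unique_of_mem_Ioo (E := ℝ × ℝ) (v := fun t y => (y.2, q t * y.1))
    (s := fun _ => Set.univ) (K := (|M| + 1).toNNReal) (f := fun t => (g t, g₁ t))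
    (g := fun _ => 0) (a := t₀ - R) (b := t₀ + R) (t₀ := t₀) ?_ ⟨by linarith, by linarith⟩
    (fun t _ => ⟨(h t).1.prodMk (h t).2, trivial⟩)
    (fun t _ => ⟨by simpa using! hasDerivAt_const t (0 : ℝ × ℝ), trivial⟩) (by simp [h0, h1]) hs
  · simpa using congrArg Prod.fst this
  · intro t ht
    refine LipschitzWith.lipschitzOnWith (LipschitzWith.of_dist_le_mul fun x y => ?_)
    have hqM : |q t| ≤ |M| := (hM t ⟨ht.1.le, ht.2.le⟩).trans (le_abs_self M)
    rw [Real.coe_toNNReal _ (by positivity), Prod.dist_eq, Prod.dist_eq]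
    have hx1 : dist x.1 y.1 ≤ max (dist x.1 y.1) (dist x.2 y.2) := le_max_left _ _
    have hx2 : dist x.2 y.2 ≤ max (dist x.1 y.1) (dist x.2 y.2) := le_max_right _ _
    have h0 : 0 ≤ max (dist x.1 y.1) (dist x.2 y.2) := dist_nonneg.trans hx1
    have hMn := abs_nonneg M
    refine max_le (by nlinarith) ?_
    rw [Real.dist_eq, ← mul_sub, abs_mul, ← Real.dist_eq]
    calc |q t| * dist x.1 y.1 ≤ |M| * max (dist x.1 y.1) (dist x.2 y.2) :=
          mul_le_mul hqM hx1 dist_nonneg hMn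
      _ ≤ _ := by nlinarith

lemma contDiff (h : IsSol q g g₁) (hq : ContDiff ℝ (⊤ : ℕ∞) q) : ContDiff ℝ (⊤ : ℕ∞) g := by
  have hd : deriv g = g₁ := funext fun s => (h s).1.deriv
  have hd1 : deriv g₁ = fun s => q s * g s := funext fun s => (h s).2.deriv
  have key : ∀ m : ℕ, ContDiff ℝ m g ∧ ContDiff ℝ m g₁ := by
    intro m
    induction m with
    | zero => exact ⟨contDiff_zero.2 h.continuous, contDiff_zero.2 h.continuous_deriv⟩
    | succ m ih =>
      refine ⟨(contDiff_succ_iff_deriv (n := (m : WithTop ℕ∞))).2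
          ⟨fun s => (h s).1.differentiableAt, by simp, ?_⟩,
        (contDiff_succ_iff_deriv (n := (m : WithTop ℕ∞))).2
          ⟨fun s => (h s).2.differentiableAt, by simp, ?_⟩⟩
      · rw [hd]; exact ih.2
      · rw [hd1]; exact (hq.of_le (mod_cast le_top)).mul ih.1
  exact contDiff_infty.2 fun m => (key m).1

end IsSol

/-! ### Positivity, growth and oscillation of solutions of `g'' = q g` -/

lemma monotoneOn_Icc_of_hasDerivAt_nonneg {f f' : ℝ → ℝ} {a b : ℝ}
    (hf : ∀ s ∈ Set.Icc a b, HasDerivAt f (f' s) s) (h : ∀ s ∈ Set.Icc a b, 0 ≤ f' s) :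
    MonotoneOn f (Set.Icc a b) := by
  refine monotoneOn_of_deriv_nonneg (convex_Icc a b)
    (fun s hs => (hf s hs).continuousAt.continuousWithinAt)
    (fun s hs => (hf s (interior_subset hs)).differentiableAt.differentiableWithinAt)
    fun s hs => ?_
  rw [(hf s (interior_subset hs)).deriv]
  exact h s (interior_subset hs)

lemma eventually_lt_right_of_hasDerivAt_pos {f : ℝ → ℝ} {f' a : ℝ} (hf : HasDerivAt f f' a)
    (h : 0 < f') : ∀ᶠ s in 𝓝[>] a, f a < f s := by
  have h1 : Tendsto (slope f a) (𝓝[>] a) (𝓝 f') :=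
    (hasDerivAt_iff_tendsto_slope.1 hf).mono_left (nhdsWithin_mono _ fun x hx => ne_of_gt hx)
  filter_upwards [h1.eventually (lt_mem_nhds h), self_mem_nhdsWithin] with s hs hs'
  rw [slope_def_field] at hs
  have hs' : a < s := hs'
  have := (div_pos_iff_of_pos_right (sub_pos.2 hs')).1 hs
  linarith

namespace IsSol

variable {q g g₁ : ℝ → ℝ}

/-- If `q ≥ 0`, a solution that starts upwards from a nonnegative value is positive and increasing:
`g g'` is nondecreasing, hence so is `g²`. -/
lemma pos_of_nonneg (h : IsSol q g g₁) {a b : ℝ} (hq : ∀ s ∈ Set.Icc a b, 0 ≤ q s)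
    (h0 : 0 ≤ g a) (h1 : 0 < g₁ a) {s : ℝ} (hs : s ∈ Set.Ioc a b) : 0 < g s ∧ 0 < g₁ s := by
  have hm1 : MonotoneOn (fun s => g s * g₁ s) (Set.Icc a b) := by
    refine monotoneOn_Icc_of_hasDerivAt_nonneg (fun s _ => (h s).1.mul (h s).2) fun s hs => ?_
    nlinarith [hq s hs, sq_nonneg (g s), sq_nonneg (g₁ s), mul_nonneg (hq s hs) (sq_nonneg (g s))]
  have hgg : ∀ s ∈ Set.Icc a b, 0 ≤ g s * g₁ s := fun s hs =>
    (mul_nonneg h0 h1.le).trans (hm1 ⟨le_rfl, hs.1.trans hs.2⟩ hs hs.1)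
  have hm2 : MonotoneOn (fun s => g s ^ 2) (Set.Icc a b) := by
    refine monotoneOn_Icc_of_hasDerivAt_nonneg (fun s _ => (h s).1.pow 2) fun s hs => ?_
    have := hgg s hs
    simp only [Nat.cast_ofNat, Nat.add_one_sub_one, pow_one]
    nlinarith
  have hpos : ∀ s ∈ Set.Ioc a b, 0 < g s := by
    intro s hs
    obtain ⟨a', ha', haa, hsa⟩ := ((eventually_lt_right_of_hasDerivAt_pos (h a).1 h1).and
      (Ioo_mem_nhdsGT hs.1)).exists
    have hne : ∀ t ∈ Set.Icc a' s, g t ≠ 0 := by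
      intro t ht h0t
      have := hm2 ⟨haa.le, hsa.le.trans hs.2⟩ ⟨haa.le.trans ht.1, ht.2.trans hs.2⟩ ht.1
      simp only [h0t] at this
      nlinarith
    by_contra hneg
    obtain ⟨t, ht, h0t⟩ := intermediate_value_Icc' hsa.le h.continuous.continuousOn
      (show (0 : ℝ) ∈ Set.Icc (g s) (g a') from ⟨not_lt.1 hneg, by linarith⟩)
    exact hne t ht h0t
  have hm3 : MonotoneOn g₁ (Set.Icc a b) := by
    refine monotoneOn_Icc_of_hasDerivAt_nonneg (fun s _ => (h s).2) fun s hs => ?_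
    refine mul_nonneg (hq s hs) ?_
    rcases hs.1.eq_or_lt with rfl | hlt
    · exact h0
    · exact (hpos s ⟨hlt, hs.2⟩).le
  exact ⟨hpos s hs, h1.trans_le (hm3 ⟨le_rfl, hs.1.le.trans hs.2⟩ ⟨hs.1.le, hs.2⟩ hs.1.le)⟩

/-- In a classically forbidden region, `q ≥ μ²`, a nonnegative solution that is not decreasing at
the left end grows exponentially. -/
lemma exp_growth (h : IsSol q g g₁) {a b μ : ℝ} (hq : ∀ s ∈ Set.Icc a b, μ ^ 2 ≤ q s)
    (hg : ∀ s ∈ Set.Icc a b, 0 ≤ g s) (h1 : 0 ≤ g₁ a) {s : ℝ} (hs : s ∈ Set.Icc a b) :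
    g a * Real.exp (μ * (s - a)) / 2 ≤ g s := by
  have ha : a ∈ Set.Icc a b := ⟨le_rfl, hs.1.trans hs.2⟩
  have hexp : ∀ c s : ℝ, HasDerivAt (fun t => Real.exp (c * (t - a)))
      (Real.exp (c * (s - a)) * c) s := by
    intro c s
    simpa using (((hasDerivAt_id s).sub_const a).const_mul c).exp
  -- the first-order factorisation `(D + μ) (D - μ)` turns the claim into two monotonicity statements
  have hm1 : MonotoneOn (fun t => (g₁ t + μ * g t) * Real.exp (-μ * (t - a))) (Set.Icc a b) := by
    refine monotoneOn_Icc_of_hasDerivAt_nonneg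
      (fun t _ => ((h t).2.add ((h t).1.const_mul μ)).mul (hexp (-μ) t)) fun t ht => ?_
    have : 0 ≤ (q t - μ ^ 2) * g t * Real.exp (-μ * (t - a)) :=
      mul_nonneg (mul_nonneg (sub_nonneg.2 (hq t ht)) (hg t ht)) (Real.exp_pos _).le
    refine this.trans_eq ?_
    simp only [Pi.add_apply]
    ring
  have hlow : ∀ t ∈ Set.Icc a b, μ * g a * Real.exp (μ * (t - a)) ≤ g₁ t + μ * g t := by
    intro t ht
    have := hm1 ha ht ht.1
    simp only [sub_self, mul_zero, Real.exp_zero, mul_one] at this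
    have h2 : μ * g a ≤ (g₁ t + μ * g t) * Real.exp (-μ * (t - a)) := by linarith
    calc μ * g a * Real.exp (μ * (t - a))
        ≤ (g₁ t + μ * g t) * Real.exp (-μ * (t - a)) * Real.exp (μ * (t - a)) := by gcongr
      _ = _ := by
        rw [mul_assoc, ← Real.exp_add]
        simp
  have hm2 : MonotoneOn (fun t => Real.exp (μ * (t - a)) * g t -
      g a / 2 * Real.exp (2 * μ * (t - a))) (Set.Icc a b) := by
    refine monotoneOn_Icc_of_hasDerivAt_nonneg
      (fun t _ => ((hexp μ t).mul (h t).1).sub ((hexp (2 * μ) t).const_mul (g a / 2)))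
      fun t ht => ?_
    have he : Real.exp (2 * μ * (t - a)) = Real.exp (μ * (t - a)) * Real.exp (μ * (t - a)) := by
      rw [← Real.exp_add]; ring_nf
    have := mul_le_mul_of_nonneg_left (hlow t ht) (Real.exp_pos (μ * (t - a))).le
    rw [he]
    nlinarith
  have := hm2 ha hs hs.1
  simp only [sub_self, mul_zero, Real.exp_zero, one_mul, mul_one] at this
  have he : Real.exp (2 * μ * (s - a)) = Real.exp (μ * (s - a)) * Real.exp (μ * (s - a)) := by
    rw [← Real.exp_add]; ring_nf
  rw [he] at this
  have hga := hg a ha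
  have hep := Real.exp_pos (μ * (s - a))
  have h3 : 0 ≤ Real.exp (μ * (s - a)) * (g s - g a * Real.exp (μ * (s - a)) / 2) := by linarith
  have := nonneg_of_mul_nonneg_right h3 hep
  linarith

/-- Sturm comparison with `sin`: where `q ≤ -μ²`, no solution stays positive over a length
`π / μ`. -/
lemma not_pos_of_oscillating (h : IsSol q g g₁) {a μ : ℝ} (hμ : 0 < μ)
    (hq : ∀ s ∈ Set.Icc a (a + Real.pi / μ), q s ≤ -μ ^ 2)
    (hg : ∀ s ∈ Set.Icc a (a + Real.pi / μ), 0 < g s) : False := by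
  have hpi : 0 < Real.pi / μ := div_pos Real.pi_pos hμ
  have ha : a ∈ Set.Icc a (a + Real.pi / μ) := ⟨le_rfl, by linarith⟩
  have hb : a + Real.pi / μ ∈ Set.Icc a (a + Real.pi / μ) := ⟨by linarith, le_rfl⟩
  have hin : ∀ s : ℝ, HasDerivAt (fun t => μ * (t - a)) μ s := fun s => by
    simpa using ((hasDerivAt_id s).sub_const a).const_mul μ
  have hm : MonotoneOn (fun s => g s * (μ * Real.cos (μ * (s - a))) -
      g₁ s * Real.sin (μ * (s - a))) (Set.Icc a (a + Real.pi / μ)) := by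
    refine monotoneOn_Icc_of_hasDerivAt_nonneg
      (fun s _ => ((h s).1.mul ((hin s).cos.const_mul μ)).sub ((h s).2.mul (hin s).sin))
      fun s hs => ?_
    have hsin : 0 ≤ Real.sin (μ * (s - a)) := by
      refine Real.sin_nonneg_of_nonneg_of_le_pi (mul_nonneg hμ.le (sub_nonneg.2 hs.1)) ?_
      have : s - a ≤ Real.pi / μ := by linarith [hs.2]
      rw [le_div_iff₀ hμ] at this
      linarith
    have : 0 ≤ (-μ ^ 2 - q s) * (g s * Real.sin (μ * (s - a))) :=
      mul_nonneg (sub_nonneg.2 (hq s hs)) (mul_nonneg (hg s hs).le hsin)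
    refine this.trans_eq ?_
    ring
  have := hm ha hb ha.2
  have e : μ * (a + Real.pi / μ - a) = Real.pi := by field_simp; ring
  simp only [sub_self, mul_zero, Real.cos_zero, Real.sin_zero, e, Real.cos_pi, Real.sin_pi] at this
  nlinarith [hg a ha, hg _ hb, mul_pos hμ (hg a ha), mul_pos hμ (hg _ hb)]

end IsSol

/-- The first parameter for which a solution of the transmission problem `g'' = qm g` on
`[sc, s₁]`, `k'' = qp k` on `[s₁, s₂]`, `k(s₁) = g(s₁)`, `k'(s₁) = γ g'(s₁)`, ceases to be positive
is an eigenvalue: by uniqueness for the Cauchy problem, the solution first touches zero at the right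
end. -/
theorem exists_eigenvalue {qm qp g g₁ k k₁ : ℝ → ℝ → ℝ} {sc s₁ s₂ la lb γ : ℝ}
    (hqm : ∀ l, Continuous (qm l)) (hqp : ∀ l, Continuous (qp l))
    (hgc : Continuous ↿g) (hkc : Continuous ↿k)
    (hg : ∀ l, IsSol (qm l) (g l) (g₁ l)) (hk : ∀ l, IsSol (qp l) (k l) (k₁ l))
    (hc1 : sc < s₁) (h12 : s₁ < s₂) (hγ : 0 < γ)
    (hm0 : ∀ l, k l s₁ = g l s₁) (hm1 : ∀ l, k₁ l s₁ = γ * g₁ l s₁) (hab : la ≤ lb)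
    (hsc : ∀ l ∈ Set.Icc la lb, 0 < g l sc)
    (hla : (∀ s ∈ Set.Icc sc s₁, 0 < g la s) ∧ ∀ s ∈ Set.Icc s₁ s₂, 0 < k la s)
    (hlb : ∃ s ∈ Set.Icc sc s₁, g lb s ≤ 0) :
    ∃ l ∈ Set.Icc la lb, (∀ s ∈ Set.Icc sc s₁, 0 < g l s) ∧ (∀ s ∈ Set.Ico s₁ s₂, 0 < k l s) ∧
      k l s₂ = 0 := by
  set Z : Set ℝ := Prod.fst '' ((Set.Icc la lb ×ˢ Set.Icc sc s₁) ∩ {p : ℝ × ℝ | g p.1 p.2 ≤ 0}) ∪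
    Prod.fst '' ((Set.Icc la lb ×ˢ Set.Icc s₁ s₂) ∩ {p : ℝ × ℝ | k p.1 p.2 ≤ 0}) with hZ
  have hZc : IsCompact Z :=
    (((isCompact_Icc.prod isCompact_Icc).inter_right (isClosed_le hgc continuous_const)).image
      continuous_fst).union
    (((isCompact_Icc.prod isCompact_Icc).inter_right (isClosed_le hkc continuous_const)).image
      continuous_fst)
  have hmem : ∀ l, l ∈ Z ↔ l ∈ Set.Icc la lb ∧
      ((∃ s ∈ Set.Icc sc s₁, g l s ≤ 0) ∨ ∃ s ∈ Set.Icc s₁ s₂, k l s ≤ 0) := by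
    intro l
    constructor
    · rintro (⟨⟨l', s⟩, ⟨⟨hl, hs⟩, h⟩, rfl⟩ | ⟨⟨l', s⟩, ⟨⟨hl, hs⟩, h⟩, rfl⟩)
      · exact ⟨hl, Or.inl ⟨s, hs, h⟩⟩
      · exact ⟨hl, Or.inr ⟨s, hs, h⟩⟩
    · rintro ⟨hl, ⟨s, hs, h⟩ | ⟨s, hs, h⟩⟩
      · exact Or.inl ⟨(l, s), ⟨⟨hl, hs⟩, h⟩, rfl⟩
      · exact Or.inr ⟨(l, s), ⟨⟨hl, hs⟩, h⟩, rfl⟩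
  have hne : Z.Nonempty := ⟨lb, (hmem lb).2 ⟨⟨hab, le_rfl⟩, Or.inl hlb⟩⟩
  set l := sInf Z with hl
  obtain ⟨hlI, hlz⟩ := (hmem l).1 (hZc.sInf_mem hne)
  have hlt : la < l := by
    refine lt_of_le_of_ne hlI.1 fun he => ?_
    rw [← he] at hlz
    rcases hlz with ⟨s, hs, h⟩ | ⟨s, hs, h⟩
    · exact absurd (hla.1 s hs) (not_lt.2 h)
    · exact absurd (hla.2 s hs) (not_lt.2 h)
  have hbefore : ∀ᶠ l' in 𝓝[<] l, l' ∈ Set.Icc la lb ∧ l' ∉ Z := by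
    filter_upwards [Ioo_mem_nhdsLT hlt] with l' hl'
    exact ⟨⟨hl'.1.le, hl'.2.le.trans hlI.2⟩, fun hz =>
      absurd (csInf_le hZc.bddBelow hz) (not_le.2 hl'.2)⟩
  have hg0 : ∀ s ∈ Set.Icc sc s₁, 0 ≤ g l s := by
    intro s hs
    have ht : Tendsto (fun l' => g l' s) (𝓝[<] l) (𝓝 (g l s)) :=
      ((hgc.comp (by fun_prop : Continuous fun l' : ℝ => (l', s))).tendsto l).mono_left
        nhdsWithin_le_nhds
    refine ge_of_tendsto ht ?_
    filter_upwards [hbefore] with l' hl'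
    by_contra hneg
    exact hl'.2 ((hmem l').2 ⟨hl'.1, Or.inl ⟨s, hs, (not_le.1 hneg).le⟩⟩)
  have hk0 : ∀ s ∈ Set.Icc s₁ s₂, 0 ≤ k l s := by
    intro s hs
    have ht : Tendsto (fun l' => k l' s) (𝓝[<] l) (𝓝 (k l s)) :=
      ((hkc.comp (by fun_prop : Continuous fun l' : ℝ => (l', s))).tendsto l).mono_left
        nhdsWithin_le_nhds
    refine ge_of_tendsto ht ?_
    filter_upwards [hbefore] with l' hl'
    by_contra hneg
    exact hl'.2 ((hmem l').2 ⟨hl'.1, Or.inr ⟨s, hs, (not_le.1 hneg).le⟩⟩)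
  have hscl := hsc l hlI
  have hg1 : 0 < g l s₁ := by
    refine lt_of_le_of_ne (hg0 s₁ ⟨hc1.le, le_rfl⟩) fun he => ?_
    have hg1n : g₁ l s₁ = 0 := by
      refine le_antisymm ?_ ?_
      · -- coming from nonnegative values on the left, the slope is not positive
        by_contra hpos
        have h' := eventually_lt_right_of_hasDerivAt_pos ((hg l).comp_neg (-s₁)).1.neg
          (by simpa using not_le.1 hpos)
        obtain ⟨t, ht, ht1, ht2⟩ := (h'.and (Ioo_mem_nhdsGT (neg_lt_neg hc1))).exists
        have := hg0 (-t) ⟨by linarith, by linarith⟩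
        simp only [Pi.neg_apply, neg_neg, ← he] at ht
        linarith
      · -- otherwise the solution would become negative to the right of the interface
        by_contra hneg
        have h' := eventually_lt_right_of_hasDerivAt_pos (hk l s₁).1.neg
          (by rw [hm1]; nlinarith [not_le.1 hneg])
        obtain ⟨t, ht, ht1, ht2⟩ := (h'.and (Ioo_mem_nhdsGT h12)).exists
        have := hk0 t ⟨ht1.le, ht2.le⟩
        simp only [Pi.neg_apply, hm0, ← he] at ht
        linarith
    exact hscl.ne' ((hg l).eq_zero (hqm l) he.symm hg1n sc)
  have hgpos : ∀ s ∈ Set.Icc sc s₁, 0 < g l s := by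
    intro s hs
    rcases hs.1.eq_or_lt with rfl | h1
    · exact hscl
    rcases hs.2.eq_or_lt with rfl | h2
    · exact hg1
    refine lt_of_le_of_ne (hg0 s hs) fun he => ?_
    have hmin : IsLocalMin (g l) s := by
      filter_upwards [Icc_mem_nhds h1 h2] with t ht
      rw [← he]
      exact hg0 t ht
    exact hscl.ne' ((hg l).eq_zero (hqm l) he.symm (hmin.hasDerivAt_eq_zero (hg l s).1) sc)
  have hkpos : ∀ s ∈ Set.Ico s₁ s₂, 0 < k l s := by
    intro s hs
    rcases hs.1.eq_or_lt with rfl | h1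
    · rw [hm0]; exact hg1
    refine lt_of_le_of_ne (hk0 s ⟨hs.1, hs.2.le⟩) fun he => ?_
    have hmin : IsLocalMin (k l) s := by
      filter_upwards [Icc_mem_nhds h1 hs.2] with t ht
      rw [← he]
      exact hk0 t ht
    have := (hk l).eq_zero (hqp l) he.symm (hmin.hasDerivAt_eq_zero (hk l s).1) s₁
    rw [hm0] at this
    exact hg1.ne' this
  refine ⟨l, hlI, hgpos, hkpos, ?_⟩
  rcases hlz with ⟨s, hs, h⟩ | ⟨s, hs, h⟩
  · exact absurd (hgpos s hs) (not_lt.2 h)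
  · rcases hs.2.eq_or_lt with rfl | h2
    · exact le_antisymm h (hk0 s hs)
    · exact absurd (hkpos s ⟨hs.1, h2⟩) (not_lt.2 h)

/-! ### Radial profiles and Bessel functions -/

/-- The potential of the radial equation in the variable `s = log r`. -/
def potential (n : ℕ) (κ s : ℝ) : ℝ := n ^ 2 - κ * Real.exp (2 * s)

/-- `h` is a smooth solution on `O` of the equation which says that `zⁿ h(|z|²)` satisfies
`-Δ u = κ u`. Written in the variable `ρ = |z|²`, the equation is regular enough at `ρ = 0` to treat
disks and annuli together. -/
def IsProfile (n : ℕ) (κ : ℝ) (O : Set ℝ) (h : ℝ → ℝ) : Prop :=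
  IsOpen O ∧ ContDiffOn ℝ (⊤ : ℕ∞) h O ∧
    ∀ ρ ∈ O, ρ * deriv (deriv h) ρ + (n + 1) * deriv h ρ + κ / 4 * h ρ = 0

/-- The logarithmic radial derivative: `r ∂ᵣ (rⁿ h(r²)) = rⁿ flux n h (r²)`. -/
def flux (n : ℕ) (h : ℝ → ℝ) (ρ : ℝ) : ℝ := n * h ρ + 2 * ρ * deriv h ρ

lemma continuous_potential (n : ℕ) (κ : ℝ) : Continuous (potential n κ) := by
  unfold potential
  fun_prop

lemma contDiff_potential (n : ℕ) (κ : ℝ) : ContDiff ℝ (⊤ : ℕ∞) (potential n κ) := by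
  unfold potential
  fun_prop

lemma exp_two_mul_log_div_two {ρ : ℝ} (hρ : 0 < ρ) : Real.exp (2 * (Real.log ρ / 2)) = ρ := by
  rw [mul_div_cancel₀ _ (two_ne_zero), Real.exp_log hρ]

lemma hasDerivAt_exp_mul_comp {n : ℕ} {h : ℝ → ℝ} {s : ℝ}
    (hd : DifferentiableAt ℝ h (Real.exp (2 * s))) :
    HasDerivAt (fun t => Real.exp (n * t) * h (Real.exp (2 * t)))
      (Real.exp (n * s) * flux n h (Real.exp (2 * s))) s := by
  have h1 : HasDerivAt (fun t : ℝ => Real.exp (n * t)) (Real.exp (n * s) * n) s := by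
    simpa using ((hasDerivAt_id s).const_mul (n : ℝ)).exp
  have h2 : HasDerivAt (fun t : ℝ => Real.exp (2 * t)) (Real.exp (2 * s) * 2) s := by
    simpa using ((hasDerivAt_id s).const_mul (2 : ℝ)).exp
  refine HasDerivAt.congr_deriv (h1.mul (hd.hasDerivAt.comp s h2)) ?_
  simp only [flux]
  ring

/-- The profile `h` with `rⁿ h(r²) = g(log r)`. -/
def toProfile (n : ℕ) (g : ℝ → ℝ) (ρ : ℝ) : ℝ :=
  Real.exp (-n * (Real.log ρ / 2)) * g (Real.log ρ / 2)

lemma exp_mul_toProfile (n : ℕ) (g : ℝ → ℝ) (s : ℝ) :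
    Real.exp (n * s) * toProfile n g (Real.exp (2 * s)) = g s := by
  simp only [toProfile, Real.log_exp]
  rw [mul_div_cancel_left₀ _ two_ne_zero, ← mul_assoc, ← Real.exp_add]
  simp

lemma hasDerivAt_toProfile {n : ℕ} {g g₁ : ℝ → ℝ} (h : ∀ s, HasDerivAt g (g₁ s) s) {ρ : ℝ}
    (hρ : 0 < ρ) :
    HasDerivAt (toProfile n g) (toProfile n (fun s => g₁ s - n * g s) ρ / (2 * ρ)) ρ := by
  have h1 : HasDerivAt (fun x => Real.log x / 2) (1 / (2 * ρ)) ρ := by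
    refine HasDerivAt.congr_deriv ((Real.hasDerivAt_log hρ.ne').div_const 2) ?_
    field_simp
  refine HasDerivAt.congr_deriv ((h1.const_mul (-n : ℝ)).exp.mul ((h _).comp ρ h1)) ?_
  simp only [toProfile]
  field_simp
  ring

lemma isProfile_toProfile {n : ℕ} {κ : ℝ} {g g₁ : ℝ → ℝ} (h : IsSol (potential n κ) g g₁) :
    IsProfile n κ (Set.Ioi 0) (toProfile n g) := by
  refine ⟨isOpen_Ioi, ?_, fun ρ hρ => ?_⟩
  · have hg := h.contDiff (contDiff_potential n κ)
    have hl : ContDiffOn ℝ (⊤ : ℕ∞) (fun ρ : ℝ => Real.log ρ / 2) (Set.Ioi 0) :=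
      (Real.contDiffOn_log.mono fun x hx => ne_of_gt hx).div_const 2
    exact ((contDiffOn_const.mul hl).exp).mul (hg.comp_contDiffOn hl)
  · have hρ' : 0 < ρ := hρ
    have hd : ∀ x ∈ Set.Ioi (0 : ℝ), deriv (toProfile n g) x =
        toProfile n (fun s => g₁ s - n * g s) x / (2 * x) := fun x hx =>
      (hasDerivAt_toProfile (fun s => (h s).1) hx).deriv
    have he : deriv (toProfile n g) =ᶠ[𝓝 ρ]
        fun x => toProfile n (fun s => g₁ s - n * g s) x / (2 * x) := by
      filter_upwards [isOpen_Ioi.mem_nhds hρ] with x hx using hd x hx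
    have h2 : HasDerivAt (fun x => toProfile n (fun s => g₁ s - n * g s) x / (2 * x)) _ ρ :=
      (hasDerivAt_toProfile (n := n) (fun s => (h s).2.sub ((h s).1.const_mul (n : ℝ))) hρ').div
        ((hasDerivAt_id ρ).const_mul 2) (by simpa using hρ'.ne')
    rw [he.deriv_eq, h2.deriv, hd ρ hρ]
    simp only [toProfile, potential, exp_two_mul_log_div_two hρ', Pi.sub_apply]
    field_simp
    ring

lemma IsProfile.hasDerivAt {n : ℕ} {κ : ℝ} {O : Set ℝ} {h : ℝ → ℝ} (hp : IsProfile n κ O h)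
    {ρ : ℝ} (hρ : ρ ∈ O) :
    HasDerivAt h (deriv h ρ) ρ ∧ HasDerivAt (deriv h) (deriv (deriv h) ρ) ρ := by
  have h1 := (contDiffOn_infty_iff_deriv_of_isOpen hp.1).1 hp.2.1
  have h2 := (contDiffOn_infty_iff_deriv_of_isOpen hp.1).1 h1.2
  exact ⟨(h1.1.differentiableAt (hp.1.mem_nhds hρ)).hasDerivAt,
    (h2.1.differentiableAt (hp.1.mem_nhds hρ)).hasDerivAt⟩

lemma IsProfile.contDiffOn_deriv {n : ℕ} {κ : ℝ} {O : Set ℝ} {h : ℝ → ℝ} (hp : IsProfile n κ O h) :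
    ContDiffOn ℝ (⊤ : ℕ∞) (deriv h) O :=
  ((contDiffOn_infty_iff_deriv_of_isOpen hp.1).1 hp.2.1).2

lemma flux_toProfile {n : ℕ} {κ : ℝ} {g g₁ : ℝ → ℝ} (h : IsSol (potential n κ) g g₁) (s : ℝ) :
    Real.exp (n * s) * flux n (toProfile n g) (Real.exp (2 * s)) = g₁ s := by
  have h1 := hasDerivAt_exp_mul_comp (n := n) (s := s)
    ((isProfile_toProfile h).hasDerivAt (Set.mem_Ioi.2 (Real.exp_pos _))).1.differentiableAt
  simp only [exp_mul_toProfile] at h1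
  exact h1.unique (h s).1

/-- The entire function `∑ (-x)ᵐ / (m! (m + n)!)`, which is `(r/2)⁻ⁿ Jₙ(r)` at `x = r²/4`. -/
def bessel (n : ℕ) (x : ℝ) : ℝ :=
  ∑' m : ℕ, (-1) ^ m * x ^ m / ((m.factorial : ℝ) * ((m + n).factorial : ℝ))

lemma norm_bessel_term_le (n m : ℕ) (x : ℝ) :
    ‖(-1) ^ m * x ^ m / ((m.factorial : ℝ) * ((m + n).factorial : ℝ))‖ ≤
      |x| ^ m / (m.factorial : ℝ) := by
  have h1 : (1 : ℝ) ≤ ((m + n).factorial : ℝ) := by exact_mod_cast Nat.one_le_iff_ne_zero.2 (Nat.factorial_ne_zero _)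
  have h2 : (0 : ℝ) < (m.factorial : ℝ) := by exact_mod_cast Nat.factorial_pos m
  rw [norm_div, norm_mul, norm_pow, norm_pow, norm_neg, norm_one, one_pow, one_mul, Real.norm_eq_abs,
    Real.norm_of_nonneg (by positivity)]
  gcongr
  nlinarith

lemma summable_bessel_term (n : ℕ) (x : ℝ) :
    Summable fun m : ℕ => (-1) ^ m * x ^ m / ((m.factorial : ℝ) * ((m + n).factorial : ℝ)) :=
  Summable.of_norm_bounded (Real.summable_pow_div_factorial |x|)
    fun m => norm_bessel_term_le n m x

lemma hasDerivAt_bessel (n : ℕ) (x : ℝ) : HasDerivAt (bessel n) (-bessel (n + 1) x) x := by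
  have hterm : ∀ (m : ℕ) (y : ℝ), HasDerivAt
      (fun x : ℝ => (-1) ^ m * x ^ m / ((m.factorial : ℝ) * ((m + n).factorial : ℝ)))
      ((-1) ^ m * (m * y ^ (m - 1)) / ((m.factorial : ℝ) * ((m + n).factorial : ℝ))) y := fun m y =>
    ((hasDerivAt_pow m y).const_mul _).div_const _
  have hshift : ∀ (m : ℕ) (y : ℝ),
      (-1) ^ (m + 1) * (((m + 1 : ℕ) : ℝ) * y ^ (m + 1 - 1)) /
        (((m + 1).factorial : ℝ) * ((m + 1 + n).factorial : ℝ)) =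
      -((-1) ^ m * y ^ m / ((m.factorial : ℝ) * ((m + (n + 1)).factorial : ℝ))) := by
    intro m y
    have h1 : (((m + (n + 1)).factorial : ℕ) : ℝ) ≠ 0 := by exact_mod_cast Nat.factorial_ne_zero _
    rw [show m + 1 + n = m + (n + 1) by ring, Nat.factorial_succ m, pow_succ, Nat.add_sub_cancel]
    push_cast
    field_simp
  set u : ℕ → ℝ := fun m => if m = 0 then 0 else (|x| + 1) ^ (m - 1) / ((m - 1).factorial : ℝ) with hu
  have hus : Summable u := by
    rw [← summable_nat_add_iff 1]
    simpa [hu] using Real.summable_pow_div_factorial (|x| + 1)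
  have hD := hasDerivAt_tsum_of_isPreconnected (y := x) (y₀ := x) hus
    (Metric.isOpen_ball (x := (0 : ℝ)) (ε := |x| + 1)) (convex_ball _ _).isPreconnected
    (fun m y _ => hterm m y) ?_ (by simp) (summable_bessel_term n x) (by simp)
  · have hs : Summable fun m : ℕ =>
        ((-1) ^ m * (m * x ^ (m - 1)) / ((m.factorial : ℝ) * ((m + n).factorial : ℝ))) := by
      rw [← summable_nat_add_iff 1]
      simp_rw [hshift]
      exact (summable_bessel_term (n + 1) x).neg
    rw [hs.tsum_eq_zero_add] at hD
    simp_rw [hshift] at hD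
    rw [tsum_neg] at hD
    simpa using! hD
  · intro m y hy
    have hy' : |y| ≤ |x| + 1 := by simpa using (Metric.mem_ball.1 hy).le
    rcases m with _ | m
    · simp [hu]
    · rw [hshift, norm_neg]
      refine (norm_bessel_term_le (n + 1) m y).trans ?_
      simp only [hu, Nat.succ_ne_zero, if_false, Nat.add_sub_cancel]
      gcongr

lemma continuous_bessel (n : ℕ) : Continuous (bessel n) :=
  continuous_iff_continuousAt.2 fun x => (hasDerivAt_bessel n x).continuousAt

lemma contDiff_bessel (n : ℕ) : ContDiff ℝ (⊤ : ℕ∞) (bessel n) := by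
  have key : ∀ m : ℕ, ∀ n, ContDiff ℝ m (bessel n) := by
    intro m
    induction m with
    | zero => exact fun n => contDiff_zero.2 (continuous_bessel n)
    | succ m ih =>
      intro n
      refine (contDiff_succ_iff_deriv (n := (m : WithTop ℕ∞))).2
        ⟨fun s => (hasDerivAt_bessel n s).differentiableAt, by simp, ?_⟩
      rw [funext fun s => (hasDerivAt_bessel n s).deriv]
      exact (ih (n + 1)).neg
  exact contDiff_infty.2 fun m => key m n

lemma bessel_zero (n : ℕ) : bessel n 0 = 1 / (n.factorial : ℝ) := by
  rw [bessel, tsum_eq_single 0 (fun m hm => by simp [hm])]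
  simp

lemma bessel_recurrence (n : ℕ) (x : ℝ) :
    bessel n x = (n + 1) * bessel (n + 1) x - x * bessel (n + 2) x := by
  have h1 := summable_bessel_term n x
  have h2 := (summable_bessel_term (n + 1) x).mul_left ((n : ℝ) + 1)
  have h3 := (summable_bessel_term (n + 2) x).mul_left x
  rw [bessel, bessel, bessel, ← tsum_mul_left, ← tsum_mul_left, h1.tsum_eq_zero_add,
    h2.tsum_eq_zero_add, add_sub_assoc,
    ← ((summable_nat_add_iff 1).2 h2).tsum_sub h3]
  congr 1
  · have : ((n.factorial : ℕ) : ℝ) ≠ 0 := by exact_mod_cast Nat.factorial_ne_zero _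
    simp only [pow_zero, zero_add, Nat.factorial_zero, Nat.factorial_succ n]
    push_cast
    field_simp
  · refine tsum_congr fun m => ?_
    have h4 : (((m + n).factorial : ℕ) : ℝ) ≠ 0 := by exact_mod_cast Nat.factorial_ne_zero _
    have h5 : ((m.factorial : ℕ) : ℝ) ≠ 0 := by exact_mod_cast Nat.factorial_ne_zero _
    rw [show m + 1 + (n + 1) = m + n + 1 + 1 by ring, show m + (n + 2) = m + n + 1 + 1 by ring,
      show m + 1 + n = m + n + 1 by ring]
    simp only [Nat.factorial_succ]
    push_cast
    field_simp
    ring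

lemma isProfile_bessel (n : ℕ) (κ : ℝ) :
    IsProfile n κ Set.univ (fun ρ => bessel n (κ / 4 * ρ)) ∧
      ∀ ρ, flux n (fun ρ => bessel n (κ / 4 * ρ)) ρ =
        n * bessel n (κ / 4 * ρ) - 2 * (κ / 4 * ρ) * bessel (n + 1) (κ / 4 * ρ) := by
  have hd : ∀ n ρ, HasDerivAt (fun ρ => bessel n (κ / 4 * ρ))
      (-(κ / 4) * bessel (n + 1) (κ / 4 * ρ)) ρ := by
    intro n ρ
    refine HasDerivAt.congr_deriv ((hasDerivAt_bessel n (κ / 4 * ρ)).comp ρ ((hasDerivAt_id ρ).const_mul (κ / 4))) ?_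
    ring
  have h1 : deriv (fun ρ => bessel n (κ / 4 * ρ)) =
      fun ρ => -(κ / 4) * bessel (n + 1) (κ / 4 * ρ) := funext fun ρ => (hd n ρ).deriv
  have h2 : deriv (fun ρ => -(κ / 4) * bessel (n + 1) (κ / 4 * ρ)) =
      fun ρ => -(κ / 4) * (-(κ / 4) * bessel (n + 2) (κ / 4 * ρ)) :=
    funext fun ρ => ((hd (n + 1) ρ).const_mul _).deriv
  refine ⟨⟨isOpen_univ, ?_, fun ρ _ => ?_⟩, fun ρ => ?_⟩
  · exact ((contDiff_bessel n).comp (by fun_prop)).contDiffOn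
  · rw [h1, h2]
    linear_combination κ / 4 * bessel_recurrence n (κ / 4 * ρ)
  · rw [flux, h1]
    ring

lemma isSol_of_isProfile {n : ℕ} {κ : ℝ} {h : ℝ → ℝ} (hp : IsProfile n κ Set.univ h) :
    IsSol (potential n κ) (fun s => Real.exp (n * s) * h (Real.exp (2 * s)))
      (fun s => Real.exp (n * s) * flux n h (Real.exp (2 * s))) := by
  intro s
  refine ⟨hasDerivAt_exp_mul_comp (hp.hasDerivAt trivial).1.differentiableAt, ?_⟩
  have h1 : HasDerivAt (fun t : ℝ => Real.exp (n * t)) (Real.exp (n * s) * n) s := by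
    simpa using ((hasDerivAt_id s).const_mul (n : ℝ)).exp
  have h2 : HasDerivAt (fun t : ℝ => Real.exp (2 * t)) (Real.exp (2 * s) * 2) s := by
    simpa using ((hasDerivAt_id s).const_mul (2 : ℝ)).exp
  have hh := hp.hasDerivAt (ρ := Real.exp (2 * s)) trivial
  have hf : HasDerivAt (flux n h) _ (Real.exp (2 * s)) :=
    (hh.1.const_mul (n : ℝ)).add (((hasDerivAt_id _).const_mul 2).mul hh.2)
  have hf2 : HasDerivAt (fun t => flux n h (Real.exp (2 * t))) _ s :=
    HasDerivAt.comp (h₂ := flux n h) s hf h2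
  refine HasDerivAt.congr_deriv (h1.mul hf2) ?_
  have e := hp.2.2 (Real.exp (2 * s)) trivial
  simp only [flux, potential]
  linear_combination 4 * Real.exp (2 * s) * Real.exp (n * s) * e

/-- The solutions of the radial equation inside the interface that are regular at the centre of a
disk, or vanish on the inner circle of an annulus. They depend continuously on the spectral
parameter, and are positive and increasing in the region where the potential is nonnegative. -/
theorem exists_inner_family {n : ℕ} (hn : 1 ≤ n) {c R₀ : ℝ} (hc : 0 < c) (hR : 0 ≤ R₀) :
    ∃ g g₁ : ℝ → ℝ → ℝ, Continuous ↿g ∧ Continuous ↿g₁ ∧ ∀ l,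
      IsSol (potential n (l / c)) (g l) (g₁ l) ∧
      (∀ s, 0 ≤ l → R₀ < Real.exp s → l / c * Real.exp (2 * s) ≤ n ^ 2 → 0 < g l s ∧ 0 < g₁ l s) ∧
      ∃ (O : Set ℝ) (h : ℝ → ℝ), IsProfile n (l / c) O h ∧ Set.Ici (R₀ ^ 2) ⊆ O ∧
        (∀ s, Real.exp (n * s) * h (Real.exp (2 * s)) = g l s) ∧
        (∀ s, Real.exp (n * s) * flux n h (Real.exp (2 * s)) = g₁ l s) ∧
        (0 < R₀ → h (R₀ ^ 2) = 0) := by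
  have hpot : ∀ l s t, 0 ≤ l → l / c * Real.exp (2 * s) ≤ n ^ 2 → t ≤ s →
      0 ≤ potential n (l / c) t := by
    intro l s t hl h hts
    have : l / c * Real.exp (2 * t) ≤ l / c * Real.exp (2 * s) := by
      have := div_nonneg hl hc.le
      gcongr
    unfold potential
    linarith
  rcases hR.eq_or_lt with rfl | hR
  · refine ⟨fun l s => Real.exp (n * s) * bessel n (l / c / 4 * Real.exp (2 * s)),
      fun l s => Real.exp (n * s) * (n * bessel n (l / c / 4 * Real.exp (2 * s)) -
        2 * (l / c / 4 * Real.exp (2 * s)) * bessel (n + 1) (l / c / 4 * Real.exp (2 * s))),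
      ?_, ?_, fun l => ?_⟩
    · have := continuous_bessel n
      simp only [Function.HasUncurry.uncurry, id]
      fun_prop
    · have := continuous_bessel n
      have := continuous_bessel (n + 1)
      simp only [Function.HasUncurry.uncurry, id]
      fun_prop
    · obtain ⟨hp, hf⟩ := isProfile_bessel n (l / c)
      have hsol := isSol_of_isProfile hp
      simp only [hf] at hsol
      refine ⟨hsol, fun s hl _ hs => ?_, Set.univ, _, hp, Set.subset_univ _, fun s => rfl,
        fun s => by rw [hf], fun h => absurd h (lt_irrefl _)⟩
      have hx : Tendsto (fun t : ℝ => l / c / 4 * Real.exp (2 * t)) atBot (𝓝 0) := by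
        have : Tendsto (fun t : ℝ => Real.exp (2 * t)) atBot (𝓝 0) :=
          Real.tendsto_exp_atBot.comp (tendsto_id.const_mul_atBot two_pos)
        simpa using this.const_mul (l / c / 4)
      have hfac : (0 : ℝ) < 1 / (n.factorial : ℝ) := by
        have : (0 : ℝ) < (n.factorial : ℝ) := by exact_mod_cast Nat.factorial_pos n
        positivity
      have t1 : Tendsto (fun t : ℝ => bessel n (l / c / 4 * Real.exp (2 * t))) atBot
          (𝓝 (1 / (n.factorial : ℝ))) := by
        have := ((continuous_bessel n).tendsto 0).comp hx
        rwa [bessel_zero] at this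
      have t2 : Tendsto (fun t : ℝ => n * bessel n (l / c / 4 * Real.exp (2 * t)) -
          2 * (l / c / 4 * Real.exp (2 * t)) * bessel (n + 1) (l / c / 4 * Real.exp (2 * t))) atBot
          (𝓝 (n * (1 / (n.factorial : ℝ)))) := by
        have := ((continuous_bessel (n + 1)).tendsto 0).comp hx
        simpa using (t1.const_mul (n : ℝ)).sub ((hx.const_mul 2).mul this)
      have hn0 : (0 : ℝ) < n := by exact_mod_cast hn
      obtain ⟨t, ⟨ht1, ht2⟩, hts⟩ := (((t1.eventually (lt_mem_nhds hfac)).and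
        (t2.eventually (lt_mem_nhds (mul_pos hn0 hfac)))).and (eventually_lt_atBot s)).exists
      exact hsol.pos_of_nonneg (a := t) (b := s) (fun t ht => hpot l s t hl hs ht.2)
        (mul_pos (Real.exp_pos _) ht1).le (mul_pos (Real.exp_pos _) ht2) ⟨hts, le_rfl⟩
  · have hq : Continuous ↿(fun l s => potential n (l / c) s) := by
      simp only [Function.HasUncurry.uncurry, id, potential]
      fun_prop
    obtain ⟨g, g₁, hg, hg₁, hs⟩ := exists_isSol hq (continuous_const (y := (0 : ℝ)))
      (continuous_const (y := (1 : ℝ))) (Real.log R₀)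
    refine ⟨g, g₁, hg, hg₁, fun l => ⟨(hs l).2.2, fun s hl hRs h => ?_, Set.Ioi 0,
      toProfile n (g l), isProfile_toProfile (hs l).2.2, fun x hx => ?_, exp_mul_toProfile n (g l),
      flux_toProfile (hs l).2.2, fun _ => ?_⟩⟩
    · refine (hs l).2.2.pos_of_nonneg (a := Real.log R₀) (b := s)
        (fun t ht => hpot l s t hl h ht.2) (hs l).1.ge ?_ ⟨?_, le_rfl⟩
      · rw [(hs l).2.1]; exact one_pos
      · rwa [Real.log_lt_iff_lt_exp hR]
    · exact lt_of_lt_of_le (by positivity : (0 : ℝ) < R₀ ^ 2) hx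
    · rw [toProfile, Real.log_pow]
      simp [(hs l).1]

/-! ### Ground states concentrated at the interface -/

lemma RoundSetting.R₁_pos (D : RoundSetting) : 0 < D.R₁ := D.R₀_nonneg.trans_lt D.R₀_lt_R₁

lemma RoundSetting.R₂_pos (D : RoundSetting) : 0 < D.R₂ := D.R₁_pos.trans D.R₁_lt_R₂

/-- The profiles `hm`, `hp` define an eigenfunction `zⁿ h(|z|²)` of the transmission problem with
eigenvalue `lam`. -/
structure IsMode (D : RoundSetting) (n : ℕ) (lam : ℝ) (O : Set ℝ) (hm hp : ℝ → ℝ) : Prop where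
  profile_m : IsProfile n (lam / D.cm) O hm
  profile_p : IsProfile n (lam / D.cp) (Set.Ioi 0) hp
  subset : Set.Ici (D.R₀ ^ 2) ⊆ O
  val_eq : hm (D.R₁ ^ 2) = hp (D.R₁ ^ 2)
  flux_eq : D.cm * flux n hm (D.R₁ ^ 2) = D.cp * flux n hp (D.R₁ ^ 2)
  dirichlet_m : 0 < D.R₀ → hm (D.R₀ ^ 2) = 0
  dirichlet_p : hp (D.R₂ ^ 2) = 0

/-- A positive mode with eigenvalue at most `E n²`, together with the solutions `g`, `k` of the
equations in the variable `s = log r` that correspond to its profiles. -/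
structure GroundMode (D : RoundSetting) (E : ℝ) (n : ℕ) where
  lam : ℝ
  O : Set ℝ
  hm : ℝ → ℝ
  hp : ℝ → ℝ
  g : ℝ → ℝ
  g₁ : ℝ → ℝ
  k : ℝ → ℝ
  k₁ : ℝ → ℝ
  isMode : IsMode D n lam O hm hp
  lam_ge : D.cm * n ^ 2 / D.R₁ ^ 2 ≤ lam
  lam_le : lam ≤ E * n ^ 2
  sol_g : IsSol (potential n (lam / D.cm)) g g₁
  sol_k : IsSol (potential n (lam / D.cp)) k k₁
  exp_mul_hm : ∀ s, Real.exp (n * s) * hm (Real.exp (2 * s)) = g s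
  exp_mul_hp : ∀ s, Real.exp (n * s) * hp (Real.exp (2 * s)) = k s
  g_pos : ∀ s, D.R₀ < Real.exp s → Real.exp s ≤ D.R₁ → 0 < g s
  g₁_pos : ∀ s, D.R₀ < Real.exp s → lam / D.cm * Real.exp (2 * s) ≤ n ^ 2 → 0 < g₁ s
  k_pos : ∀ s, D.R₁ ≤ Real.exp s → Real.exp s < D.R₂ → 0 < k s

/-- Above the bottom `n² e^{-2 s₁}` of the inner potential by a fixed factor, solutions oscillate
near the interface once `n` is large. -/
lemma exists_nonpos_near_interface (s₁ : ℝ) {δ : ℝ} (hδ : 0 < δ) :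
    ∃ N : ℕ, ∀ n ≥ N, ∀ (κ : ℝ) (g g₁ : ℝ → ℝ), IsSol (potential n κ) g g₁ →
      n ^ 2 * Real.exp (δ - 2 * s₁) ≤ κ → ∃ s ∈ Set.Icc (s₁ - δ / 4) s₁, g s ≤ 0 := by
  have he : 0 < Real.exp (δ / 2) - 1 := by
    have := Real.add_one_lt_exp (x := δ / 2) (by positivity)
    linarith
  set μ : ℝ := Real.pi / (δ / 4) with hμ
  have hμ0 : 0 < μ := div_pos Real.pi_pos (by positivity)
  obtain ⟨N, hN⟩ := exists_nat_ge (μ ^ 2 / (Real.exp (δ / 2) - 1))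
  refine ⟨max N 1, fun n hn κ g g₁ hs hκ => ?_⟩
  have hnN : (N : ℝ) ≤ n := by exact_mod_cast (le_max_left _ _).trans hn
  have hn1 : (1 : ℝ) ≤ n := by exact_mod_cast (le_max_right _ _).trans hn
  have hμn : μ ^ 2 ≤ n ^ 2 * (Real.exp (δ / 2) - 1) := by
    have h1 : μ ^ 2 / (Real.exp (δ / 2) - 1) ≤ n ^ 2 := by nlinarith
    rwa [div_le_iff₀ he] at h1
  have hend : s₁ - δ / 4 + Real.pi / μ = s₁ := by
    rw [hμ]
    have := Real.pi_ne_zero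
    field_simp
    ring
  by_contra hcon
  push Not at hcon
  refine hs.not_pos_of_oscillating (a := s₁ - δ / 4) hμ0 (fun s hs => ?_) (by rwa [hend])
  have h2 : n ^ 2 * Real.exp (δ / 2) ≤ κ * Real.exp (2 * s) := by
    calc (n : ℝ) ^ 2 * Real.exp (δ / 2)
        ≤ n ^ 2 * Real.exp (δ - 2 * s₁ + 2 * s) := by
          gcongr
          linarith [hs.1]
      _ = n ^ 2 * Real.exp (δ - 2 * s₁) * Real.exp (2 * s) := by rw [Real.exp_add]; ring
      _ ≤ _ := by gcongr
  unfold potential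
  linarith

/-- An upper bound `E` for `lam / n²` with `cm / R₁² < E < cp / R₂²` makes the region outside the
interface classically forbidden. -/
theorem exists_groundMode (D : RoundSetting) (hc : D.cm / D.R₁ ^ 2 < D.cp / D.R₂ ^ 2) :
    ∃ E : ℝ, 0 < E ∧ E < D.cp / D.R₂ ^ 2 ∧
      ∃ N : ℕ, ∀ n ≥ N, 1 ≤ n → Nonempty (GroundMode D E n) := by
  have h1 := D.R₁_pos
  have h2 := D.R₂_pos
  have hcm := D.cm_pos
  have hcp := D.cp_pos
  set s₁ := Real.log D.R₁ with hs₁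
  set s₂ := Real.log D.R₂ with hs₂
  have e1 : Real.exp s₁ = D.R₁ := Real.exp_log h1
  have e2 : Real.exp s₂ = D.R₂ := Real.exp_log h2
  have e22 : Real.exp (2 * s₂) = D.R₂ ^ 2 := by rw [← e2, ← Real.exp_nat_mul]; simp
  have e12 : Real.exp (2 * s₁) = D.R₁ ^ 2 := by rw [← e1, ← Real.exp_nat_mul]; simp
  have h12 : s₁ < s₂ := Real.log_lt_log h1 D.R₁_lt_R₂
  obtain ⟨δ, ⟨hδE, hδR⟩, hδ⟩ : ∃ δ : ℝ, (Real.exp δ * (D.cm / D.R₁ ^ 2) < D.cp / D.R₂ ^ 2 ∧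
      D.R₀ < Real.exp (s₁ - δ / 2)) ∧ 0 < δ := by
    have t1 : Tendsto (fun δ : ℝ => Real.exp δ * (D.cm / D.R₁ ^ 2)) (𝓝[>] 0)
        (𝓝 (D.cm / D.R₁ ^ 2)) := by
      have : Continuous fun δ : ℝ => Real.exp δ * (D.cm / D.R₁ ^ 2) := by fun_prop
      simpa using (this.tendsto 0).mono_left nhdsWithin_le_nhds
    have t2 : Tendsto (fun δ : ℝ => Real.exp (s₁ - δ / 2)) (𝓝[>] 0) (𝓝 D.R₁) := by
      have : Continuous fun δ : ℝ => Real.exp (s₁ - δ / 2) := by fun_prop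
      simpa [e1] using (this.tendsto 0).mono_left nhdsWithin_le_nhds
    exact (((t1.eventually (gt_mem_nhds hc)).and (t2.eventually (lt_mem_nhds D.R₀_lt_R₁))).and
      self_mem_nhdsWithin).exists
  obtain ⟨N, hN⟩ := exists_nonpos_near_interface s₁ hδ
  refine ⟨Real.exp δ * (D.cm / D.R₁ ^ 2), by positivity, hδE, N, fun n hnN hn => ?_⟩
  have hn0 : (0 : ℝ) < n := by exact_mod_cast hn
  obtain ⟨g, g₁, hgc, hg₁c, hg⟩ := exists_inner_family hn hcm D.R₀_nonneg
  have hq : Continuous ↿(fun l s => potential n (l / D.cp) s) := by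
    simp only [Function.HasUncurry.uncurry, id, potential]
    fun_prop
  have hsl : Continuous fun l : ℝ => (l, s₁) := by fun_prop
  obtain ⟨k, k₁, hkc, -, hk⟩ := exists_isSol hq (A := fun l => g l s₁)
    (B := fun l => D.cm / D.cp * g₁ l s₁) (hgc.comp hsl)
    (continuous_const.mul (hg₁c.comp hsl)) s₁
  set la := D.cm * n ^ 2 / D.R₁ ^ 2 with hla
  set lb := Real.exp δ * (D.cm / D.R₁ ^ 2) * n ^ 2 with hlb
  have hla0 : 0 < la := by positivity
  have hab : la ≤ lb := by
    have : 1 ≤ Real.exp δ := Real.one_le_exp hδ.le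
    have h3 : lb = Real.exp δ * la := by rw [hlb, hla]; ring
    rw [h3]
    nlinarith
  have hqp : ∀ l, l ≤ lb → ∀ s ≤ s₂, 0 ≤ l → 0 ≤ potential n (l / D.cp) s := by
    intro l hl s hs hl0
    have h3 : l / D.cp * Real.exp (2 * s) ≤ lb / D.cp * D.R₂ ^ 2 := by
      rw [← e22]
      gcongr
    have h4 : lb / D.cp * D.R₂ ^ 2 ≤ n ^ 2 := by
      rw [lt_div_iff₀ (by positivity)] at hδE
      have : lb / D.cp * D.R₂ ^ 2 =
          (Real.exp δ * (D.cm / D.R₁ ^ 2) * D.R₂ ^ 2) / D.cp * n ^ 2 := by rw [hlb]; ring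
      rw [this]
      have h5 : (Real.exp δ * (D.cm / D.R₁ ^ 2) * D.R₂ ^ 2) / D.cp ≤ 1 := by
        rw [div_le_one hcp]; exact hδE.le
      nlinarith [sq_nonneg (n : ℝ)]
    unfold potential
    linarith
  have hpg : ∀ l, 0 ≤ l → ∀ s, D.R₀ < Real.exp s → l / D.cm * Real.exp (2 * s) ≤ n ^ 2 →
      0 < g l s ∧ 0 < g₁ l s := fun l hl s hs h => (hg l).2.1 s hl hs h
  have hR₀ : ∀ s, s₁ - δ / 2 ≤ s → D.R₀ < Real.exp s := fun s hs =>
    hδR.trans_le (Real.exp_le_exp.2 hs)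
  have hsc : ∀ l ≤ lb, ∀ s ≤ s₁ - δ / 2, 0 ≤ l → l / D.cm * Real.exp (2 * s) ≤ n ^ 2 := by
    intro l hl s hs hl0
    calc l / D.cm * Real.exp (2 * s) ≤ lb / D.cm * Real.exp (2 * (s₁ - δ / 2)) := by gcongr
      _ = n ^ 2 * (Real.exp δ * Real.exp (2 * (s₁ - δ / 2))) / D.R₁ ^ 2 := by
        rw [hlb]; field_simp
      _ = n ^ 2 := by
        rw [← Real.exp_add, show δ + 2 * (s₁ - δ / 2) = 2 * s₁ by ring, e12]
        field_simp
  have hga : ∀ s, D.R₀ < Real.exp s → s ≤ s₁ → 0 < g la s ∧ 0 < g₁ la s := by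
    intro s hs hs1
    refine hpg la hla0.le s hs ?_
    calc la / D.cm * Real.exp (2 * s) ≤ la / D.cm * Real.exp (2 * s₁) := by gcongr
      _ = n ^ 2 := by rw [e12, hla]; field_simp
  have hga1 := hga s₁ (hR₀ _ (by linarith)) le_rfl
  obtain ⟨l, hl, hgpos, hkpos, hk2⟩ := exists_eigenvalue (γ := D.cm / D.cp) (sc := s₁ - δ / 2)
    (fun l => continuous_potential n (l / D.cm)) (fun l => continuous_potential n (l / D.cp))
    hgc hkc (fun l => (hg l).1) (fun l => (hk l).2.2) (by linarith) h12 (by positivity)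
    (fun l => (hk l).1) (fun l => (hk l).2.1) hab
    (fun l hl => (hpg l (hla0.le.trans hl.1) _ (hR₀ _ le_rfl)
      (hsc l hl.2 _ le_rfl (hla0.le.trans hl.1))).1)
    ⟨fun s hs => (hga s (hR₀ s hs.1) hs.2).1, fun s hs => by
      rcases hs.1.eq_or_lt with rfl | hlt
      · rw [(hk la).1]; exact hga1.1
      · refine ((hk la).2.2.pos_of_nonneg (a := s₁) (b := s₂)
          (fun t ht => hqp la hab t ht.2 hla0.le) ?_ ?_ ⟨hlt, hs.2⟩).1
        · rw [(hk la).1]; exact hga1.1.le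
        · rw [(hk la).2.1]; exact mul_pos (by positivity) hga1.2⟩
    (by
      obtain ⟨s, hs, hs'⟩ := hN n hnN (lb / D.cm) (g lb) (g₁ lb) (hg lb).1 (by
        rw [Real.exp_sub, e12, hlb]
        apply le_of_eq
        field_simp)
      exact ⟨s, ⟨by linarith [hs.1], hs.2⟩, hs'⟩)
  have hl0 : 0 ≤ l := hla0.le.trans hl.1
  obtain ⟨O, hm, hprof, hO, hmg, hmf, hm0⟩ := (hg l).2.2
  have hsk := (hk l).2.2
  have hE1 := hmg s₁
  have hE2 := exp_mul_toProfile n (k l) s₁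
  have hF1 := hmf s₁
  have hF2 := flux_toProfile hsk s₁
  rw [e12] at hE1 hE2 hF1 hF2
  have hne : Real.exp (n * s₁) ≠ 0 := (Real.exp_pos _).ne'
  refine ⟨⟨l, O, hm, toProfile n (k l), g l, g₁ l, k l, k₁ l, ⟨hprof, isProfile_toProfile hsk, hO,
    ?_, ?_, hm0, ?_⟩, hl.1, hl.2, (hg l).1, hsk, hmg, exp_mul_toProfile n (k l), ?_, ?_, ?_⟩⟩
  · apply mul_left_cancel₀ hne
    rw [hE1, hE2, (hk l).1]
  · apply mul_left_cancel₀ hne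
    calc Real.exp (n * s₁) * (D.cm * flux n hm (D.R₁ ^ 2)) = D.cm * g₁ l s₁ := by rw [← hF1]; ring
      _ = D.cp * k₁ l s₁ := by rw [(hk l).2.1]; field_simp
      _ = _ := by rw [← hF2]; ring
  · have := exp_mul_toProfile n (k l) s₂
    rw [hk2, e22] at this
    exact (mul_eq_zero.1 this).resolve_left (Real.exp_pos _).ne'
  · intro s hs hs1
    rcases le_total s (s₁ - δ / 2) with h | h
    · exact (hpg l hl0 s hs (hsc l hl.2 s h hl0)).1
    · refine hgpos s ⟨h, ?_⟩
      rw [← e1] at hs1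
      exact Real.exp_le_exp.1 hs1
  · intro s hs h
    exact (hpg l hl0 s hs h).2
  · intro s hs hs2
    rw [← e1] at hs
    rw [← e2] at hs2
    exact hkpos s ⟨Real.exp_le_exp.1 hs, Real.exp_lt_exp.1 hs2⟩

namespace GroundMode

variable {D : RoundSetting} {E : ℝ} {n : ℕ}

lemma lam_pos (m : GroundMode D E n) (hn : 1 ≤ n) : 0 < m.lam := by
  have hn0 : (0 : ℝ) < n := by exact_mod_cast hn
  have := D.R₁_pos
  have := D.cm_pos
  exact lt_of_lt_of_le (by positivity) m.lam_ge

lemma pow_mul_hm (m : GroundMode D E n) {r : ℝ} (hr : 0 < r) :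
    r ^ n * m.hm (r ^ 2) = m.g (Real.log r) := by
  rw [← m.exp_mul_hm, Real.exp_nat_mul, Real.exp_log hr, two_mul, Real.exp_add, Real.exp_log hr, sq]

lemma pow_mul_hp (m : GroundMode D E n) {r : ℝ} (hr : 0 < r) :
    r ^ n * m.hp (r ^ 2) = m.k (Real.log r) := by
  rw [← m.exp_mul_hp, Real.exp_nat_mul, Real.exp_log hr, two_mul, Real.exp_add, Real.exp_log hr, sq]

/-- The positivity of the ground states forces `lam / n²` down to the bottom `cm / R₁²` of the
inner potential. -/
lemma lam_le_of_large (D : RoundSetting) (E : ℝ) {δ : ℝ} (hδ : 0 < δ)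
    (hR : D.R₀ < D.R₁ * Real.exp (-(δ / 4))) :
    ∃ N : ℕ, ∀ n ≥ N, ∀ m : GroundMode D E n,
      m.lam / D.cm ≤ n ^ 2 * Real.exp (δ - 2 * Real.log D.R₁) := by
  obtain ⟨N, hN⟩ := exists_nonpos_near_interface (Real.log D.R₁) hδ
  refine ⟨N, fun n hn m => ?_⟩
  by_contra hcon
  obtain ⟨s, hs, h0⟩ := hN n hn _ m.g m.g₁ m.sol_g (not_le.1 hcon).le
  refine absurd (m.g_pos s ?_ ?_) (not_lt.2 h0)
  · refine hR.trans_le ?_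
    rw [← Real.exp_log D.R₁_pos, ← Real.exp_add]
    exact Real.exp_le_exp.2 (by linarith [hs.1])
  · rw [← Real.le_log_iff_exp_le D.R₁_pos]
    exact hs.2

/-- Exponential decay of the ground states inside the interface. -/
lemma inner_decay (D : RoundSetting) (E : ℝ) {δ : ℝ} (hδ : 0 < δ)
    (hR : D.R₀ < D.R₁ * Real.exp (-(3 * δ))) :
    ∃ N : ℕ, ∀ n ≥ N, 1 ≤ n → ∀ m : GroundMode D E n,
      ∀ r ∈ Set.Icc D.R₀ (D.R₁ * Real.exp (-(3 * δ))),
      ∀ t ∈ Set.Icc (D.R₁ * Real.exp (-(2 * δ))) (D.R₁ * Real.exp (-δ)),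
        0 ≤ r ^ n * m.hm (r ^ 2) ∧
        r ^ n * m.hm (r ^ 2) * Real.exp (√(1 - Real.exp (-δ)) * δ * n) / 2 ≤
          t ^ n * m.hm (t ^ 2) := by
  have h1 := D.R₁_pos
  have hle : ∀ a b : ℝ, a ≤ b → D.R₁ * Real.exp (-b) ≤ D.R₁ * Real.exp (-a) := fun a b hab =>
    mul_le_mul_of_nonneg_left (Real.exp_le_exp.2 (neg_le_neg hab)) h1.le
  obtain ⟨N, hN⟩ := lam_le_of_large D E hδ (hR.trans_le (hle _ _ (by linarith)))
  refine ⟨N, fun n hn hn1 m r hr t ht => ?_⟩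
  have hn0 : (0 : ℝ) < n := by exact_mod_cast hn1
  have hlam := hN n hn m
  set s₁ := Real.log D.R₁ with hs₁
  have e1 : ∀ x, D.R₁ * Real.exp (-x) = Real.exp (s₁ - x) := fun x => by
    rw [sub_eq_add_neg, Real.exp_add, hs₁, Real.exp_log h1]
  have e0 : D.R₁ = Real.exp s₁ := (Real.exp_log h1).symm
  have ht0 : 0 < t := (mul_pos h1 (Real.exp_pos _)).trans_le ht.1
  simp only [e1] at hr ht hR
  have htl : Real.log t ∈ Set.Icc (s₁ - 2 * δ) (s₁ - δ) :=
    ⟨(Real.le_log_iff_exp_le ht0).2 ht.1, (Real.log_le_iff_le_exp ht0).2 ht.2⟩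
  have hpot : ∀ s ≤ s₁ - δ, m.lam / D.cm * Real.exp (2 * s) ≤ n ^ 2 * Real.exp (-δ) := by
    intro s hs
    calc m.lam / D.cm * Real.exp (2 * s)
        ≤ n ^ 2 * Real.exp (δ - 2 * s₁) * Real.exp (2 * s) := by gcongr
      _ = n ^ 2 * Real.exp (δ - 2 * s₁ + 2 * s) := by rw [Real.exp_add]; ring
      _ ≤ _ := by gcongr; linarith
  have hexpδ : Real.exp (-δ) < 1 := by simpa using hδ
  have hinc : ∀ s ≤ s₁ - δ, D.R₀ < Real.exp s → 0 < m.g₁ s := fun s hs hs0 =>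
    m.g₁_pos s hs0 ((hpot s hs).trans (by nlinarith [sq_nonneg (n : ℝ)]))
  have hgpos : ∀ s ≤ s₁, D.R₀ < Real.exp s → 0 < m.g s := fun s hs hs0 =>
    m.g_pos s hs0 (by rw [e0]; exact Real.exp_le_exp.2 hs)
  have hR' : ∀ s, s₁ - 3 * δ ≤ s → D.R₀ < Real.exp s := fun s hs =>
    hR.trans_le (Real.exp_le_exp.2 hs)
  have hmono : ∀ a b : ℝ, a ≤ b → b ≤ s₁ - δ → D.R₀ < Real.exp a → m.g a ≤ m.g b := by
    intro a b hab hb ha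
    exact monotoneOn_Icc_of_hasDerivAt_nonneg (fun s _ => (m.sol_g s).1)
      (fun s hs => (hinc s (hs.2.trans hb) (ha.trans_le (Real.exp_le_exp.2 hs.1))).le)
      ⟨le_rfl, hab⟩ ⟨hab, le_rfl⟩ hab
  have hgrow : m.g (s₁ - 3 * δ) * Real.exp (√(1 - Real.exp (-δ)) * δ * n) / 2 ≤
      m.g (Real.log t) := by
    have := m.sol_g.exp_growth (a := s₁ - 3 * δ) (b := s₁ - δ) (μ := n * √(1 - Real.exp (-δ)))
      (fun s hs => by
        rw [mul_pow, Real.sq_sqrt (by linarith)]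
        have := hpot s hs.2
        unfold potential
        linarith)
      (fun s hs => (hgpos s (by linarith [hs.2]) (hR' s hs.1)).le)
      (hinc _ (by linarith) (hR' _ le_rfl)).le (s := Real.log t) ⟨by linarith [htl.1], htl.2⟩
    refine le_trans ?_ this
    have hg0 := (hgpos (s₁ - 3 * δ) (by linarith) (hR' _ le_rfl)).le
    have : √(1 - Real.exp (-δ)) * δ * n ≤
        n * √(1 - Real.exp (-δ)) * (Real.log t - (s₁ - 3 * δ)) := by
      rw [mul_comm (n : ℝ), mul_right_comm]
      gcongr
      linarith [htl.1]
    gcongr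
  rw [m.pow_mul_hm ht0]
  have hgt : 0 < m.g (Real.log t) := hgpos _ (by linarith [htl.2]) (hR' _ (by linarith [htl.1]))
  rcases hr.1.eq_or_lt with rfl | hr0
  · -- at the inner circle, or at the centre, the mode vanishes
    have hz : D.R₀ ^ n * m.hm (D.R₀ ^ 2) = 0 := by
      rcases D.R₀_nonneg.eq_or_lt with h | h
      · rw [← h, zero_pow (by omega), zero_mul]
      · rw [m.isMode.dirichlet_m h, mul_zero]
    rw [hz]
    simpa using hgt.le
  · have hrp : 0 < r := D.R₀_nonneg.trans_lt hr0
    have hrl : Real.log r ≤ s₁ - 3 * δ := (Real.log_le_iff_le_exp hrp).2 hr.2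
    have her : D.R₀ < Real.exp (Real.log r) := by rwa [Real.exp_log hrp]
    rw [m.pow_mul_hm hrp]
    refine ⟨(hgpos _ (by linarith) her).le, le_trans ?_ hgrow⟩
    have := hmono _ _ hrl (by linarith) her
    gcongr

/-- Exponential decay of the ground states outside the interface. -/
lemma outer_decay (hE : E < D.cp / D.R₂ ^ 2) (hn1 : 1 ≤ n) (m : GroundMode D E n) {δ : ℝ}
    (hδ : 0 < δ) (hR : D.R₁ * Real.exp (2 * δ) < D.R₂)
    {r : ℝ} (hr : r ∈ Set.Icc (D.R₁ * Real.exp (2 * δ)) D.R₂)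
    {t : ℝ} (ht : t ∈ Set.Icc D.R₁ (D.R₁ * Real.exp δ)) :
    0 ≤ r ^ n * m.hp (r ^ 2) ∧
      r ^ n * m.hp (r ^ 2) * Real.exp (√(1 - E * D.R₂ ^ 2 / D.cp) * δ * n) / 2 ≤
        t ^ n * m.hp (t ^ 2) := by
  have h1 := D.R₁_pos
  have h2 := D.R₂_pos
  have hcp := D.cp_pos
  have hn0 : (0 : ℝ) < n := by exact_mod_cast hn1
  set s₁ := Real.log D.R₁ with hs₁
  set s₂ := Real.log D.R₂ with hs₂
  have e1 : ∀ x, D.R₁ * Real.exp x = Real.exp (s₁ + x) := fun x => by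
    rw [Real.exp_add, hs₁, Real.exp_log h1]
  have e0 : Real.exp s₁ = D.R₁ := Real.exp_log h1
  have e2 : Real.exp s₂ = D.R₂ := Real.exp_log h2
  have e22 : Real.exp (2 * s₂) = D.R₂ ^ 2 := by rw [← e2, ← Real.exp_nat_mul]; simp
  have ht0 : 0 < t := h1.trans_le ht.1
  have hr0 : 0 < r := (mul_pos h1 (Real.exp_pos _)).trans_le hr.1
  rw [e1] at hr ht hR
  have htl : Real.log t ∈ Set.Icc s₁ (s₁ + δ) :=
    ⟨Real.log_le_log h1 ht.1, (Real.log_le_iff_le_exp ht0).2 ht.2⟩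
  have hrl : Real.log r ∈ Set.Icc (s₁ + 2 * δ) s₂ :=
    ⟨(Real.le_log_iff_exp_le hr0).2 hr.1, Real.log_le_log hr0 hr.2⟩
  have hR' : s₁ + 2 * δ < s₂ := by rw [← e2] at hR; exact Real.exp_lt_exp.1 hR
  have hE1 : 0 ≤ 1 - E * D.R₂ ^ 2 / D.cp := by
    rw [lt_div_iff₀ (by positivity)] at hE
    rw [sub_nonneg, div_le_one hcp]
    exact hE.le
  have hpot : ∀ s ≤ s₂, n ^ 2 * (1 - E * D.R₂ ^ 2 / D.cp) ≤ potential n (m.lam / D.cp) s := by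
    intro s hs
    have : m.lam / D.cp * Real.exp (2 * s) ≤ E * n ^ 2 / D.cp * D.R₂ ^ 2 := by
      rw [← e22]
      have := m.lam_le
      have := (m.lam_pos hn1).le
      have := div_nonneg (this.trans m.lam_le) hcp.le
      gcongr
    unfold potential
    have e : (n : ℝ) ^ 2 * (1 - E * D.R₂ ^ 2 / D.cp) = n ^ 2 - E * n ^ 2 / D.cp * D.R₂ ^ 2 := by ring
    linarith
  have hk2 : m.k s₂ = 0 := by
    rw [← m.exp_mul_hp, e22, m.isMode.dirichlet_p, mul_zero]
  have hkpos : ∀ s, s₁ ≤ s → s < s₂ → 0 < m.k s := fun s hs hs' =>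
    m.k_pos s (by rw [← e0]; exact Real.exp_le_exp.2 hs) (by rw [← e2]; exact Real.exp_lt_exp.2 hs')
  have hk0 : ∀ s, s₁ ≤ s → s ≤ s₂ → 0 ≤ m.k s := fun s hs hs' => by
    rcases hs'.eq_or_lt with rfl | h
    · exact hk2.ge
    · exact (hkpos s hs h).le
  -- the reflected solution increases away from the outer circle
  have hsol := m.sol_k.comp_neg
  have hdec2 : m.k₁ s₂ ≤ 0 := by
    by_contra hpos
    have h' := eventually_lt_right_of_hasDerivAt_pos (hsol (-s₂)).1.neg
      (by simpa using not_le.1 hpos)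
    obtain ⟨x, hx, hx1, hx2⟩ := (h'.and
      (Ioo_mem_nhdsGT (show -s₂ < -s₁ by linarith))).exists
    have := hk0 (-x) (by linarith) (by linarith)
    simp only [Pi.neg_apply, neg_neg, hk2] at hx
    linarith
  have hdec : ∀ s, s₁ ≤ s → s ≤ s₂ → m.k₁ s ≤ 0 := by
    intro s hs hs'
    refine le_trans ?_ hdec2
    exact monotoneOn_Icc_of_hasDerivAt_nonneg (a := s₁) (b := s₂) (fun s _ => (m.sol_k s).2)
      (fun s hs => mul_nonneg (le_trans (by positivity) (hpot s hs.2)) (hk0 s hs.1 hs.2))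
      ⟨hs, hs'⟩ ⟨hs.trans hs', le_rfl⟩ hs'
  have hanti : m.k (Real.log r) ≤ m.k (s₁ + 2 * δ) := by
    have := monotoneOn_Icc_of_hasDerivAt_nonneg (a := -s₂) (b := -s₁) (fun s _ => (hsol s).1)
      (fun s hs => neg_nonneg.2 (hdec (-s) (by linarith [hs.2]) (by linarith [hs.1])))
      (show -Real.log r ∈ Set.Icc (-s₂) (-s₁) from ⟨by linarith [hrl.2], by linarith [hrl.1]⟩)
      (show -(s₁ + 2 * δ) ∈ Set.Icc (-s₂) (-s₁) from ⟨by linarith, by linarith⟩)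
      (by linarith [hrl.1])
    simpa using this
  have hgrow : m.k (s₁ + 2 * δ) * Real.exp (√(1 - E * D.R₂ ^ 2 / D.cp) * δ * n) / 2 ≤
      m.k (Real.log t) := by
    have := hsol.exp_growth (a := -(s₁ + 2 * δ)) (b := -s₁)
      (μ := n * √(1 - E * D.R₂ ^ 2 / D.cp))
      (fun s hs => by
        rw [mul_pow, Real.sq_sqrt hE1]
        exact hpot (-s) (by linarith [hs.1]))
      (fun s hs => hk0 (-s) (by linarith [hs.2]) (by linarith [hs.1]))
      (neg_nonneg.2 (hdec _ (by linarith) (by linarith))) (s := -Real.log t)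
      ⟨by linarith [htl.2], by linarith [htl.1]⟩
    simp only [neg_neg] at this
    refine le_trans ?_ this
    have hg0 := hk0 (s₁ + 2 * δ) (by linarith) hR'.le
    have : √(1 - E * D.R₂ ^ 2 / D.cp) * δ * n ≤
        n * √(1 - E * D.R₂ ^ 2 / D.cp) * (-Real.log t - -(s₁ + 2 * δ)) := by
      rw [mul_comm (n : ℝ), mul_right_comm]
      gcongr
      linarith [htl.2]
    gcongr
  rw [m.pow_mul_hp ht0, m.pow_mul_hp hr0]
  refine ⟨hk0 _ (by linarith [hrl.1]) hrl.2, le_trans ?_ hgrow⟩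
  gcongr

end GroundMode

/-! ### The modes as functions in the plane, and the wave equation -/

/-- The complex coordinate `x₀ + i x₁`. -/
def zc : Plane ≃ₗᵢ[ℝ] ℂ := Complex.orthonormalBasisOneI.repr.symm

lemma zc_e_zero : zc (e 0) = 1 := by
  simp [zc, e]

lemma zc_e_one : zc (e 1) = Complex.I := by
  simp [zc, e]

lemma zc_eq (x : Plane) : zc x = x 0 + x 1 * Complex.I := by
  have hx : x = x 0 • e 0 + x 1 • e 1 := by
    ext i
    fin_cases i <;> simp [e]
  calc zc x = zc (x 0 • e 0 + x 1 • e 1) := by rw [← hx]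
    _ = _ := by
      rw [map_add, map_smul, map_smul, zc_e_zero, zc_e_one]
      simp

lemma norm_sq_eq (x : Plane) : ‖x‖ ^ 2 = x 0 ^ 2 + x 1 ^ 2 := by
  rw [EuclideanSpace.norm_sq_eq]
  simp [Fin.sum_univ_two]

lemma inner_e (x : Plane) (i : Fin 2) : inner ℝ x (e i) = x i := by
  simp [e, EuclideanSpace.inner_single_right]

/-- The function `zⁿ h(|z|²)`. -/
def modeFun (n : ℕ) (h : ℝ → ℝ) (x : Plane) : ℂ := zc x ^ n * (h (‖x‖ ^ 2) : ℂ)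

lemma exists_hasFDerivAt_modeFun (n : ℕ) {h : ℝ → ℝ} {h' : ℝ} {x : Plane}
    (hd : HasDerivAt h h' (‖x‖ ^ 2)) :
    ∃ L : Plane →L[ℝ] ℂ, HasFDerivAt (modeFun n h) L x ∧ ∀ v, L v =
      n * zc x ^ (n - 1) * zc v * (h (‖x‖ ^ 2) : ℂ) +
        zc x ^ n * ((h' * (2 * inner ℝ x v) : ℝ) : ℂ) := by
  have h1 : HasFDerivAt (fun y : Plane => zc y ^ n) _ x :=
    (zc.toContinuousLinearEquiv.toContinuousLinearMap.hasFDerivAt (x := x)).pow n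
  have h2 : HasFDerivAt (fun y : Plane => ((h (‖y‖ ^ 2) : ℝ) : ℂ)) _ x :=
    (Complex.ofRealCLM.hasFDerivAt).comp x
      (hd.comp_hasFDerivAt x (hasStrictFDerivAt_norm_sq x).hasFDerivAt)
  refine ⟨_, h1.mul h2, fun v => ?_⟩
  simp
  ring

lemma differentiableAt_modeFun (n : ℕ) {h : ℝ → ℝ} {x : Plane}
    (hd : DifferentiableAt ℝ h (‖x‖ ^ 2)) : DifferentiableAt ℝ (modeFun n h) x :=
  let ⟨_, hL, _⟩ := exists_hasFDerivAt_modeFun n hd.hasDerivAt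
  hL.differentiableAt

lemma fderiv_modeFun_apply (n : ℕ) {h : ℝ → ℝ} {x : Plane} (hd : DifferentiableAt ℝ h (‖x‖ ^ 2))
    (v : Plane) : fderiv ℝ (modeFun n h) x v =
      n * zc x ^ (n - 1) * zc v * (h (‖x‖ ^ 2) : ℂ) +
        zc x ^ n * ((deriv h (‖x‖ ^ 2) * (2 * inner ℝ x v) : ℝ) : ℂ) := by
  obtain ⟨L, hL, hv⟩ := exists_hasFDerivAt_modeFun n hd.hasDerivAt
  rw [hL.fderiv, hv]

/-- The normal derivative of a mode on circles, up to the factor `|x|`. -/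
lemma fderiv_modeFun_radial (n : ℕ) {h : ℝ → ℝ} {x : Plane}
    (hd : DifferentiableAt ℝ h (‖x‖ ^ 2)) :
    fderiv ℝ (modeFun n h) x x = zc x ^ n * (flux n h (‖x‖ ^ 2) : ℂ) := by
  rw [fderiv_modeFun_apply n hd, real_inner_self_eq_norm_sq]
  rcases n with _ | n
  · simp [flux]
    ring
  · simp only [flux, Nat.add_sub_cancel]
    push_cast
    ring

/-- `∂ᵢ (zⁿ h(|z|²))`. -/
def modeGrad (n : ℕ) (h : ℝ → ℝ) (x : Plane) (i : Fin 2) : ℂ :=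
  n * zc (e i) * modeFun (n - 1) h x + 2 * (x i : ℂ) * modeFun n (deriv h) x

lemma fderiv_modeFun_e (n : ℕ) {h : ℝ → ℝ} {x : Plane} (hd : DifferentiableAt ℝ h (‖x‖ ^ 2))
    (i : Fin 2) : fderiv ℝ (modeFun n h) x (e i) = modeGrad n h x i := by
  rw [fderiv_modeFun_apply n hd, inner_e, modeGrad, modeFun, modeFun]
  push_cast
  ring

lemma fderiv_modeGrad_e (n : ℕ) {h : ℝ → ℝ} {x : Plane} (hd : DifferentiableAt ℝ h (‖x‖ ^ 2))
    (hd' : DifferentiableAt ℝ (deriv h) (‖x‖ ^ 2)) (i : Fin 2) :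
    DifferentiableAt ℝ (fun y => modeGrad n h y i) x ∧
    fderiv ℝ (fun y => modeGrad n h y i) x (e i) =
      n * zc (e i) * modeGrad (n - 1) h x i + 2 * modeFun n (deriv h) x +
        2 * (x i : ℂ) * modeGrad n (deriv h) x i := by
  have h1 := ((differentiableAt_modeFun (n - 1) hd).hasFDerivAt).const_mul ((n : ℂ) * zc (e i))
  have hx : HasFDerivAt (fun y : Plane => (y i : ℂ))
      (Complex.ofRealCLM.comp (EuclideanSpace.proj i)) x :=
    (Complex.ofRealCLM.comp (EuclideanSpace.proj i : Plane →L[ℝ] ℝ)).hasFDerivAt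
  have h2 := (hx.const_mul 2).mul (differentiableAt_modeFun n hd').hasFDerivAt
  have h3 : HasFDerivAt (fun y => modeGrad n h y i) _ x := h1.add h2
  refine ⟨h3.differentiableAt, ?_⟩
  rw [h3.fderiv]
  simp only [add_apply, smul_apply, smul_eq_mul, fderiv_modeFun_e _ hd,
    fderiv_modeFun_e _ hd', ContinuousLinearMap.comp_apply, Complex.ofRealCLM_apply]
  have : (EuclideanSpace.proj i : Plane →L[ℝ] ℝ) (e i) = 1 := by simp [e]
  rw [this]
  push_cast
  ring

/-- `Δ (zⁿ h(|z|²)) = 4 zⁿ (ρ h'' + (n + 1) h')` at `ρ = |z|²`. -/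
lemma sum_fderiv_modeGrad (n : ℕ) {h : ℝ → ℝ} {x : Plane} (hd : DifferentiableAt ℝ h (‖x‖ ^ 2))
    (hd' : DifferentiableAt ℝ (deriv h) (‖x‖ ^ 2)) :
    ∑ i : Fin 2, fderiv ℝ (fun y => modeGrad n h y i) x (e i) =
      4 * zc x ^ n * ((‖x‖ ^ 2 * deriv (deriv h) (‖x‖ ^ 2) +
        (n + 1) * deriv h (‖x‖ ^ 2) : ℝ) : ℂ) := by
  rw [Fin.sum_univ_two, (fderiv_modeGrad_e n hd hd' 0).2, (fderiv_modeGrad_e n hd hd' 1).2,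
    zc_e_zero, zc_e_one]
  simp only [modeGrad, modeFun, zc_e_zero, zc_e_one]
  have hz := zc_eq x
  have hI := Complex.I_sq
  have hr : ((‖x‖ ^ 2 : ℝ) : ℂ) = x 0 ^ 2 + x 1 ^ 2 := by rw [norm_sq_eq]; push_cast; ring
  set H := ((h (‖x‖ ^ 2) : ℝ) : ℂ)
  set H1 := ((deriv h (‖x‖ ^ 2) : ℝ) : ℂ) with hH1
  set H2 := ((deriv (deriv h) (‖x‖ ^ 2) : ℝ) : ℂ) with hH2
  rw [Complex.ofReal_add, Complex.ofReal_mul, Complex.ofReal_mul, hr, ← hH1, ← hH2]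
  push_cast
  rcases n with _ | n
  · simp
    ring
  · simp only [Nat.add_sub_cancel]
    push_cast
    rw [pow_succ (zc x) n]
    linear_combination (n * (n + 1) * zc x ^ (n - 1) * H) * hI -
      (4 * (n + 1) * zc x ^ n * H1) * hz

lemma divGrad_modeFun {c : Plane → ℝ} {c₀ : ℝ} {f : Plane → ℂ} {a : ℂ} {n : ℕ} {κ : ℝ} {O : Set ℝ}
    {h : ℝ → ℝ} (hp : IsProfile n κ O h) {x : Plane} (hx : ‖x‖ ^ 2 ∈ O)
    (hc : ∀ᶠ y in 𝓝 x, c y = c₀) (hf : ∀ᶠ y in 𝓝 x, f y = a * modeFun n h y) :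
    divGrad c f x = -(c₀ * κ : ℝ) * (a * modeFun n h x) := by
  have hO : ∀ᶠ y : Plane in 𝓝 x, ‖y‖ ^ 2 ∈ O :=
    (by fun_prop : Continuous fun y : Plane => ‖y‖ ^ 2).continuousAt.eventually
      (hp.1.mem_nhds hx)
  have hd := (hp.hasDerivAt hx).1.differentiableAt
  have hd' := (hp.hasDerivAt hx).2.differentiableAt
  have key : ∀ i : Fin 2, (fun y => (c y : ℂ) * fderiv ℝ f y (e i)) =ᶠ[𝓝 x]
      fun y => (c₀ * a : ℂ) * modeGrad n h y i := by
    intro i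
    filter_upwards [hc, hf.eventually_nhds, hO] with y hy1 hy2 hy3
    have hyd := (hp.hasDerivAt hy3).1.differentiableAt
    have : f =ᶠ[𝓝 y] fun y => a * modeFun n h y := hy2
    rw [hy1, this.fderiv_eq, fderiv_const_mul (differentiableAt_modeFun n hyd)]
    simp only [smul_apply, smul_eq_mul, fderiv_modeFun_e n hyd]
    ring
  have key2 : ∀ i : Fin 2, fderiv ℝ (fun y => (c y : ℂ) * fderiv ℝ f y (e i)) x (e i) =
      (c₀ * a : ℂ) * fderiv ℝ (fun y => modeGrad n h y i) x (e i) := by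
    intro i
    rw [(key i).fderiv_eq, fderiv_const_mul (fderiv_modeGrad_e n hd hd' i).1]
    rfl
  rw [divGrad, Finset.sum_congr rfl fun i _ => key2 i, ← Finset.mul_sum,
    sum_fderiv_modeGrad n hd hd', modeFun]
  have e := hp.2.2 _ hx
  have e' : ‖x‖ ^ 2 * deriv (deriv h) (‖x‖ ^ 2) + (n + 1) * deriv h (‖x‖ ^ 2) =
      -(κ / 4 * h (‖x‖ ^ 2)) := by linarith
  rw [e']
  push_cast
  ring

lemma contDiffOn_modeFun {n : ℕ} {h : ℝ → ℝ} {O : Set ℝ} (hh : ContDiffOn ℝ (⊤ : ℕ∞) h O) :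
    ContDiffOn ℝ (⊤ : ℕ∞) (modeFun n h) {x | ‖x‖ ^ 2 ∈ O} := by
  have h1 : ContDiff ℝ (⊤ : ℕ∞) fun x : Plane => zc x ^ n :=
    (zc.toContinuousLinearEquiv.toContinuousLinearMap.contDiff).pow n
  have h2 : ContDiffOn ℝ (⊤ : ℕ∞) (fun x : Plane => h (‖x‖ ^ 2)) {x | ‖x‖ ^ 2 ∈ O} :=
    hh.comp (contDiff_norm_sq ℝ).contDiffOn fun x hx => hx
  exact h1.contDiffOn.mul (Complex.ofRealCLM.contDiff.comp_contDiffOn h2)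

/-- The function equal to `zⁿ hm(|z|²)` inside the interface and to `zⁿ hp(|z|²)` outside. -/
def modeState (D : RoundSetting) (n : ℕ) (hm hp : ℝ → ℝ) (x : Plane) : ℂ :=
  if ‖x‖ < D.R₁ then modeFun n hm x else modeFun n hp x

namespace RoundSetting

variable (D : RoundSetting)

lemma mem_M {x : Plane} : x ∈ D.M ↔ D.R₀ ≤ ‖x‖ ∧ ‖x‖ ≤ D.R₂ := by
  simp [M, and_comm]

lemma mem_interior_M {x : Plane} (h0 : D.R₀ < ‖x‖) (h2 : ‖x‖ < D.R₂) : x ∈ interior D.M := by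
  have ho : IsOpen {x : Plane | D.R₀ < ‖x‖ ∧ ‖x‖ < D.R₂} :=
    (isOpen_lt continuous_const continuous_norm).inter (isOpen_lt continuous_norm continuous_const)
  exact interior_maximal (fun y hy => D.mem_M.2 ⟨hy.1.le, hy.2.le⟩) ho ⟨h0, h2⟩

lemma zero_mem_interior_M (h : D.R₀ = 0) : (0 : Plane) ∈ interior D.M := by
  refine interior_maximal (t := Metric.ball 0 D.R₂) (fun y hy => D.mem_M.2 ⟨?_, ?_⟩)
    Metric.isOpen_ball (Metric.mem_ball_self D.R₂_pos)
  · rw [h]; exact norm_nonneg y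
  · simpa using (Metric.mem_ball.1 hy).le

lemma mem_Ωm {x : Plane} (hx : x ∈ D.Ωm) : D.R₀ ≤ ‖x‖ ∧ ‖x‖ < D.R₁ :=
  ⟨(D.mem_M.1 (interior_subset hx.1)).1, by simpa using hx.2⟩

lemma mem_Ωp {x : Plane} (hx : x ∈ D.Ωp) : D.R₁ < ‖x‖ ∧ ‖x‖ ≤ D.R₂ :=
  ⟨by simpa using hx.2, (D.mem_M.1 (interior_subset hx.1)).2⟩

lemma mem_closure_Ωm {x : Plane} (hx : x ∈ closure D.Ωm) : D.R₀ ≤ ‖x‖ ∧ ‖x‖ ≤ D.R₁ := by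
  have hcl : IsClosed {x : Plane | D.R₀ ≤ ‖x‖ ∧ ‖x‖ ≤ D.R₁} :=
    (isClosed_le continuous_const continuous_norm).inter
      (isClosed_le continuous_norm continuous_const)
  exact hcl.closure_subset_iff.2 (fun y hy => ⟨(D.mem_Ωm hy).1, (D.mem_Ωm hy).2.le⟩) hx

lemma mem_closure_Ωp {x : Plane} (hx : x ∈ closure D.Ωp) : D.R₁ ≤ ‖x‖ ∧ ‖x‖ ≤ D.R₂ := by
  have hcl : IsClosed {x : Plane | D.R₁ ≤ ‖x‖ ∧ ‖x‖ ≤ D.R₂} :=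
    (isClosed_le continuous_const continuous_norm).inter
      (isClosed_le continuous_norm continuous_const)
  exact hcl.closure_subset_iff.2 (fun y hy => ⟨(D.mem_Ωp hy).1.le, (D.mem_Ωp hy).2⟩) hx

end RoundSetting

namespace IsMode

variable {D : RoundSetting} {n : ℕ} {lam : ℝ} {O : Set ℝ} {hm hp : ℝ → ℝ}

lemma sq_mem (H : IsMode D n lam O hm hp) {r : ℝ} (hr : D.R₀ ≤ r) : r ^ 2 ∈ O :=
  H.subset (by have := D.R₀_nonneg; exact Set.mem_Ici.2 (by gcongr))

/-- The standing wave of a mode solves the transmission problem. -/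
theorem isWaveSolution (H : IsMode D n lam O hm hp) (hlam : 0 ≤ lam) (T : ℝ) :
    D.IsWaveSolution T (fun t x => (Real.cos (√lam * t) : ℂ) * modeState D n hm hp x)
      (modeState D n hm hp) 0 := by
  have hcm := D.cm_pos.ne'
  have hcp := D.cp_pos.ne'
  have hsq : Continuous fun x : Plane => ‖x‖ ^ 2 := by fun_prop
  have hin : ∀ x : Plane, ‖x‖ < D.R₁ → ∀ᶠ y : Plane in 𝓝 x, ‖y‖ < D.R₁ := fun x hx =>
    (isOpen_lt continuous_norm continuous_const).mem_nhds hx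
  have hout : ∀ x : Plane, D.R₁ < ‖x‖ → ∀ᶠ y : Plane in 𝓝 x, ¬ ‖y‖ < D.R₁ := fun x hx => by
    filter_upwards [(isOpen_lt continuous_const continuous_norm).mem_nhds hx] with y hy
    exact not_lt.2 (le_of_lt hy)
  have hpos : ∀ x : Plane, D.R₁ ≤ ‖x‖ → ‖x‖ ^ 2 ∈ Set.Ioi (0 : ℝ) := fun x hx =>
    Set.mem_Ioi.2 (by have := D.R₁_pos.trans_le hx; positivity)
  have hct : ContDiff ℝ (⊤ : ℕ∞) fun p : ℝ × Plane => (Real.cos (√lam * p.1) : ℂ) :=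
    Complex.ofRealCLM.contDiff.comp (Real.contDiff_cos.comp (contDiff_const.mul contDiff_fst))
  have hcos : ∀ t : ℝ, HasDerivAt (fun s => Real.cos (√lam * s)) (-(√lam * Real.sin (√lam * t))) t := by
    intro t
    refine HasDerivAt.congr_deriv (((hasDerivAt_id t).const_mul (√lam)).cos) ?_
    simp [mul_comm]
  have hcosC : ∀ t : ℝ, HasDerivAt (fun s : ℝ => (Real.cos (√lam * s) : ℂ))
      ((-(√lam * Real.sin (√lam * t)) : ℝ) : ℂ) t := fun t => (hcos t).ofReal_comp
  have hsinC : ∀ t : ℝ, HasDerivAt (fun s : ℝ => ((-(√lam * Real.sin (√lam * s)) : ℝ) : ℂ))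
      ((-(lam * Real.cos (√lam * t)) : ℝ) : ℂ) t := by
    intro t
    refine HasDerivAt.ofReal_comp (HasDerivAt.congr_deriv
      ((((hasDerivAt_id t).const_mul (√lam)).sin.const_mul (√lam)).neg) ?_)
    simp only [id, mul_one]
    rw [show √lam * (Real.cos (√lam * t) * √lam) = √lam * √lam * Real.cos (√lam * t) by ring,
      Real.mul_self_sqrt hlam]
  have htime : ∀ (t : ℝ) (a : ℂ), iteratedDeriv 2 (fun s : ℝ => (Real.cos (√lam * s) : ℂ) * a) t =
      -(lam : ℂ) * ((Real.cos (√lam * t) : ℂ) * a) := by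
    intro t a
    rw [iteratedDeriv_succ, iteratedDeriv_one, funext fun s => ((hcosC s).mul_const a).deriv,
      ((hsinC t).mul_const a).deriv]
    push_cast
    ring
  refine ⟨fun t x => (Real.cos (√lam * t) : ℂ) * modeFun n hm x,
    fun t x => (Real.cos (√lam * t) : ℂ) * modeFun n hp x,
    ⟨Set.univ ×ˢ {x | ‖x‖ ^ 2 ∈ O}, isOpen_univ.prod (H.profile_m.1.preimage hsq), ?_, ?_⟩,
    ⟨Set.univ ×ˢ {x | ‖x‖ ^ 2 ∈ Set.Ioi 0}, isOpen_univ.prod (isOpen_Ioi.preimage hsq), ?_, ?_⟩,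
    ?_, ?_, ?_, ?_, ?_, ?_, ?_, ?_, ?_⟩
  · exact Set.prod_mono (Set.subset_univ _) fun x hx => H.sq_mem (D.mem_closure_Ωm hx).1
  · exact hct.contDiffOn.mul ((contDiffOn_modeFun H.profile_m.2.1).comp contDiffOn_snd
      fun p hp => hp.2)
  · exact Set.prod_mono (Set.subset_univ _) fun x hx => hpos x (D.mem_closure_Ωp hx).1
  · exact hct.contDiffOn.mul ((contDiffOn_modeFun H.profile_p.2.1).comp contDiffOn_snd
      fun p hp => hp.2)
  · intro t _ x hx
    simp only [modeState, if_pos (D.mem_Ωm hx).2]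
  · intro t _ x hx
    simp only [modeState, if_neg (not_lt.2 (D.mem_Ωp hx).1.le)]
  · rintro t - x (hx | hx)
    · have hx' := D.mem_Ωm hx
      rw [htime, divGrad_modeFun (a := (Real.cos (√lam * t) : ℂ)) (c₀ := D.cm) H.profile_m
        (H.sq_mem hx'.1)]
      · simp only [modeState, if_pos hx'.2, mul_div_cancel₀ _ hcm]
        push_cast
        ring
      · filter_upwards [hin x hx'.2] with y hy
        simp [RoundSetting.c, hy]
      · filter_upwards [hin x hx'.2] with y hy
        simp [modeState, hy]
    · have hx' := D.mem_Ωp hx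
      rw [htime, divGrad_modeFun (a := (Real.cos (√lam * t) : ℂ)) (c₀ := D.cp) H.profile_p
        (hpos x hx'.1.le)]
      · simp only [modeState, if_neg (not_lt.2 hx'.1.le), mul_div_cancel₀ _ hcp]
        push_cast
        ring
      · filter_upwards [hout x hx'.1] with y hy
        simp [RoundSetting.c, hy]
      · filter_upwards [hout x hx'.1] with y hy
        simp [modeState, hy]
  · intro t _ x hx
    have hx' : ‖x‖ = D.R₁ := by simpa [RoundSetting.S] using hx
    simp only [modeFun, hx', H.val_eq]
  · intro t _ x hx
    have hx' : ‖x‖ = D.R₁ := by simpa [RoundSetting.S] using hx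
    have hdm := (H.profile_m.hasDerivAt (H.sq_mem (r := ‖x‖)
      (hx'.symm ▸ D.R₀_lt_R₁.le))).1.differentiableAt
    have hdp := (H.profile_p.hasDerivAt (hpos x hx'.ge)).1.differentiableAt
    rw [fderiv_const_mul (differentiableAt_modeFun n hdm),
      fderiv_const_mul (differentiableAt_modeFun n hdp)]
    simp only [smul_apply, RoundSetting.ν, map_smul, fderiv_modeFun_radial n hdm,
      fderiv_modeFun_radial n hdp, hx', smul_eq_mul, Complex.real_smul]
    have := congrArg (fun y : ℝ => (y : ℂ)) H.flux_eq
    push_cast at this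
    linear_combination (Real.cos (√lam * t) : ℂ) * ((D.R₁⁻¹ : ℝ) : ℂ) * zc x ^ n * this
  · rintro t - x ⟨hxf, hxc⟩
    have hx' := D.mem_closure_Ωm hxc
    have hr : ‖x‖ = D.R₀ := by
      refine (hx'.1.eq_or_lt.resolve_right fun hlt => hxf.2 ?_).symm
      exact D.mem_interior_M hlt (hx'.2.trans_lt D.R₁_lt_R₂)
    have h0 : 0 < D.R₀ := by
      refine lt_of_le_of_ne D.R₀_nonneg fun h0 => hxf.2 ?_
      rw [← h0, norm_eq_zero] at hr
      rw [hr]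
      exact D.zero_mem_interior_M h0.symm
    simp [modeFun, hr, H.dirichlet_m h0]
  · rintro t - x ⟨hxf, hxc⟩
    have hx' := D.mem_closure_Ωp hxc
    have hr : ‖x‖ = D.R₂ := by
      refine hx'.2.eq_or_lt.resolve_right fun hlt => hxf.2 ?_
      exact D.mem_interior_M (D.R₀_lt_R₁.trans_le hx'.1) hlt
    simp [modeFun, hr, H.dirichlet_p]
  · intro x _
    simp
  · intro x _
    have := ((hcosC 0).mul_const (modeState D n hm hp x)).hasDerivWithinAt (s := Set.Icc 0 T)
    simpa using this

end IsMode

/-! ### Weak gradients of functions with a Lipschitz radial factor -/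

lemma integrable_smul_of_locallyIntegrableOn {F 𝕜 : Type*} [NormedAddCommGroup F] [RCLike 𝕜]
    [NormedSpace 𝕜 F] {Ω : Set Plane} {f : Plane → F} (hf : LocallyIntegrableOn f Ω)
    {φ : Plane → 𝕜} (hφ : Continuous φ) (hs : HasCompactSupport φ) (hΩ : tsupport φ ⊆ Ω) :
    Integrable (fun x => φ x • f x) := by
  have h1 : IntegrableOn (fun x => φ x • f x) (tsupport φ) :=
    (hf.integrableOn_compact_subset hΩ hs).continuousOn_smul hφ.continuousOn hs
  refine (integrableOn_iff_integrable_of_support_subset ?_).1 h1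
  intro x hx
  refine subset_tsupport φ fun h0 => hx ?_
  simp [h0]

/-- Weak gradients are unique almost everywhere. -/
lemma HasWeakGradient.ae_eq {Ω : Set Plane} (hΩ : IsOpen Ω) {u : Plane → ℂ}
    {g g' : Plane → EuclideanSpace ℂ (Fin 2)} (h : HasWeakGradient Ω u g)
    (h' : HasWeakGradient Ω u g') : g =ᵐ[volume.restrict Ω] g' := by
  have hcomp : ∀ {f : Plane → EuclideanSpace ℂ (Fin 2)}, LocallyIntegrableOn f Ω → ∀ i : Fin 2,
      LocallyIntegrableOn (fun x => f x i) Ω := by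
    intro f hf i x hx
    obtain ⟨s, hs, hi⟩ := hf x hx
    exact ⟨s, hs, (EuclideanSpace.proj i : EuclideanSpace ℂ (Fin 2) →L[ℂ] ℂ).integrable_comp hi⟩
  have key : ∀ i : Fin 2, ∀ᵐ x : Plane, x ∈ Ω → g x i - g' x i = 0 := by
    intro i
    refine hΩ.ae_eq_zero_of_integral_contDiff_smul_eq_zero
      (f := fun x => g x i - g' x i) ((hcomp h.2.1 i).sub (hcomp h'.2.1 i)) fun φ hφ hs hsub => ?_
    have hz : ∀ (f : Plane → ℂ) (x : Plane), x ∉ Ω → φ x • f x = 0 := fun f x hx => by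
      rw [image_eq_zero_of_notMem_tsupport fun hx' => hx (hsub hx'), zero_smul]
    have e := (h.2.2 φ ⟨hφ, hs, hsub⟩ i).symm.trans (h'.2.2 φ ⟨hφ, hs, hsub⟩ i)
    rw [setIntegral_eq_integral_of_forall_compl_eq_zero (hz _),
      setIntegral_eq_integral_of_forall_compl_eq_zero (hz _), neg_inj] at e
    simp_rw [smul_sub]
    rw [integral_sub (integrable_smul_of_locallyIntegrableOn (hcomp h.2.1 i) hφ.continuous hs hsub)
      (integrable_smul_of_locallyIntegrableOn (hcomp h'.2.1 i) hφ.continuous hs hsub), e, sub_self]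
  rw [Filter.EventuallyEq, ae_restrict_iff' hΩ.measurableSet]
  filter_upwards [key 0, key 1] with x h0 h1 hx
  ext i
  fin_cases i
  · exact sub_eq_zero.1 (h0 hx)
  · exact sub_eq_zero.1 (h1 hx)

lemma gradNorm_eq {Ω : Set Plane} (hΩ : IsOpen Ω) {u : Plane → ℂ}
    {g : Plane → EuclideanSpace ℂ (Fin 2)} (h : HasWeakGradient Ω u g) :
    gradNorm Ω u = l2Norm Ω g := by
  refine le_antisymm (iInf₂_le g h) (le_iInf₂ fun g' h' => ?_)
  exact (eLpNorm_congr_ae (h.ae_eq hΩ h')).le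

lemma integral_fderiv_mul_of_lipschitz {K : NNReal} {Ψ : Plane → ℝ} (hΨ : LipschitzWith K Ψ)
    {ψ : Plane → ℂ} (hψ : ContDiff ℝ (⊤ : ℕ∞) ψ) (hs : HasCompactSupport ψ) (v : Plane) :
    Integrable (fun x => fderiv ℝ ψ x v * (Ψ x : ℂ)) ∧
    Integrable (fun x => ψ x * ((lineDeriv ℝ Ψ x v : ℝ) : ℂ)) ∧
    ∫ x, fderiv ℝ ψ x v * (Ψ x : ℂ) = -∫ x, ψ x * ((lineDeriv ℝ Ψ x v : ℝ) : ℂ) := by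
  have hd : Differentiable ℝ ψ := hψ.differentiable (by simp)
  have hcd : Continuous fun x => fderiv ℝ ψ x v :=
    (hψ.continuous_fderiv (by simp)).clm_apply continuous_const
  have hsd : HasCompactSupport fun x => fderiv ℝ ψ x v :=
    (hs.fderiv (𝕜 := ℝ)).comp_left (g := fun L : Plane →L[ℝ] ℂ => L v) (by simp)
  have hI1 : Integrable (fun x => fderiv ℝ ψ x v * (Ψ x : ℂ)) := by
    refine Continuous.integrable_of_hasCompactSupport ?_ hsd.mul_right
    exact hcd.mul (Complex.continuous_ofReal.comp hΨ.continuous)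
  have hI2 : Integrable (fun x => ψ x * ((lineDeriv ℝ Ψ x v : ℝ) : ℂ)) := by
    have hloc : LocallyIntegrable (fun x => ((lineDeriv ℝ Ψ x v : ℝ) : ℂ)) (volume : Measure Plane) :=
      fun x => by
        obtain ⟨s, hs, hi⟩ := hΨ.locallyIntegrable_lineDeriv (μ := volume) v x
        exact ⟨s, hs, hi.ofReal⟩
    exact hloc.integrable_smul_left_of_hasCompactSupport hψ.continuous hs
  have real_case : ∀ p : ℂ →L[ℝ] ℝ, ∫ x, p (fderiv ℝ ψ x v) * Ψ x =
      -∫ x, p (ψ x) * lineDeriv ℝ Ψ x v := by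
    intro p
    have hp : ContDiff ℝ (⊤ : ℕ∞) fun x => p (ψ x) := p.contDiff.comp hψ
    have hps : HasCompactSupport fun x => p (ψ x) := hs.comp_left (map_zero p)
    obtain ⟨C, hC⟩ := hp.lipschitzWith_of_hasCompactSupport hps (by simp)
    have h1 := hΨ.integral_lineDeriv_mul_eq (μ := volume) hC hps v
    have h2 : ∀ x, lineDeriv ℝ (fun x => p (ψ x)) x (-v) = -p (fderiv ℝ ψ x v) := by
      intro x
      have : HasFDerivAt (fun x => p (ψ x)) (p.comp (fderiv ℝ ψ x)) x :=
        p.hasFDerivAt.comp x (hd x).hasFDerivAt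
      rw [(this.hasLineDerivAt (-v)).lineDeriv]
      simp
    simp_rw [h2, neg_mul] at h1
    rw [integral_neg] at h1
    simp_rw [mul_comm (p (ψ _))]
    linarith
  refine ⟨hI1, hI2, ?_⟩
  apply Complex.ext
  · have := real_case Complex.reCLM
    have e1 := Complex.reCLM.integral_comp_comm hI1
    have e2 := Complex.reCLM.integral_comp_comm hI2
    simp only [Complex.reCLM_apply, Complex.re_mul_ofReal] at e1 e2 this
    rw [Complex.neg_re, ← e1, ← e2, this]
  · have := real_case Complex.imCLM
    have e1 := Complex.imCLM.integral_comp_comm hI1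
    have e2 := Complex.imCLM.integral_comp_comm hI2
    simp only [Complex.imCLM_apply, Complex.im_mul_ofReal] at e1 e2 this
    rw [Complex.neg_im, ← e1, ← e2, this]

/-- The product of a smooth function and a Lipschitz function has the weak gradient that the
Leibniz rule gives almost everywhere. -/
lemma hasWeakGradient_of_lipschitz_mul {K : NNReal} {Ψ : Plane → ℝ} (hΨ : LipschitzWith K Ψ)
    {Z : Plane → ℂ} (hZ : ContDiff ℝ (⊤ : ℕ∞) Z) {Ω : Set Plane} (hΩ : IsOpen Ω) {u : Plane → ℂ}
    {g : Plane → EuclideanSpace ℂ (Fin 2)} (hu : LocallyIntegrableOn u Ω)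
    (hg : LocallyIntegrableOn g Ω)
    (hu_eq : ∀ᵐ x : Plane, x ∈ Ω → u x = Z x * (Ψ x : ℂ))
    (hg_eq : ∀ i, ∀ᵐ x : Plane, x ∈ Ω →
      g x i = fderiv ℝ Z x (e i) * (Ψ x : ℂ) + Z x * ((lineDeriv ℝ Ψ x (e i) : ℝ) : ℂ)) :
    HasWeakGradient Ω u g := by
  refine ⟨hu, hg, fun φ ⟨hφ, hs, hsub⟩ i => ?_⟩
  have hdφ : Differentiable ℝ φ := hφ.differentiable (by simp)
  have hdZ : Differentiable ℝ Z := hZ.differentiable (by simp)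
  have hψ : ContDiff ℝ (⊤ : ℕ∞) fun x => (φ x : ℂ) * Z x :=
    (Complex.ofRealCLM.contDiff.comp hφ).mul hZ
  have hψs : HasCompactSupport fun x => (φ x : ℂ) * Z x :=
    (hs.comp_left (g := fun r : ℝ => (r : ℂ)) (by simp)).mul_right
  obtain ⟨hI1, hI2, heq⟩ := integral_fderiv_mul_of_lipschitz hΨ hψ hψs (e i)
  have hderiv : ∀ x, fderiv ℝ (fun x => (φ x : ℂ) * Z x) x (e i) =
      (fderiv ℝ φ x (e i) : ℂ) * Z x + (φ x : ℂ) * fderiv ℝ Z x (e i) := by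
    intro x
    have h1 : HasFDerivAt (fun x => (φ x : ℂ)) _ x :=
      (Complex.ofRealCLM.hasFDerivAt).comp x (hdφ x).hasFDerivAt
    have h2 : HasFDerivAt (fun x => (φ x : ℂ) * Z x) _ x := h1.mul (hdZ x).hasFDerivAt
    rw [h2.fderiv]
    simp
    ring
  have hI3 : Integrable fun x => (φ x : ℂ) * fderiv ℝ Z x (e i) * (Ψ x : ℂ) := by
    refine Continuous.integrable_of_hasCompactSupport ?_
      ((hs.comp_left (g := fun r : ℝ => (r : ℂ)) (by simp)).mul_right).mul_right
    have := hΨ.continuous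
    have : Continuous fun x => fderiv ℝ Z x (e i) :=
      (hZ.continuous_fderiv (by simp)).clm_apply continuous_const
    have := hφ.continuous
    fun_prop
  have e1 : ∫ x in Ω, (fderiv ℝ φ x (e i)) • u x =
      ∫ x, (fderiv ℝ (fun x => (φ x : ℂ) * Z x) x (e i) * (Ψ x : ℂ) -
        (φ x : ℂ) * fderiv ℝ Z x (e i) * (Ψ x : ℂ)) := by
    refine Eq.trans ?_ (setIntegral_eq_integral_of_forall_compl_eq_zero (s := Ω) ?_)
    · refine setIntegral_congr_ae hΩ.measurableSet ?_
      filter_upwards [hu_eq] with x hx hxΩ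
      rw [hx hxΩ, hderiv, Complex.real_smul]
      ring
    · intro x hx
      have h0 : fderiv ℝ φ x = 0 := image_eq_zero_of_notMem_tsupport fun hx' =>
        hx (hsub (tsupport_fderiv_subset ℝ hx'))
      rw [hderiv, h0]
      simp
  have e2 : ∫ x in Ω, φ x • g x i =
      ∫ x, ((φ x : ℂ) * fderiv ℝ Z x (e i) * (Ψ x : ℂ) +
        (φ x : ℂ) * Z x * ((lineDeriv ℝ Ψ x (e i) : ℝ) : ℂ)) := by
    refine Eq.trans ?_ (setIntegral_eq_integral_of_forall_compl_eq_zero (s := Ω) ?_)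
    · refine setIntegral_congr_ae hΩ.measurableSet ?_
      filter_upwards [hg_eq i] with x hx hxΩ
      rw [hx hxΩ, Complex.real_smul]
      ring
    · intro x hx
      have h0 : φ x = 0 := image_eq_zero_of_notMem_tsupport fun hx' => hx (hsub hx')
      simp [h0]
  rw [e1, e2, integral_sub hI1 hI3, integral_add hI3 hI2, heq]
  ring

lemma lipschitzOnWith_Icc_union {f : ℝ → ℝ} {a b c : ℝ} {K : NNReal}
    (h1 : LipschitzOnWith K f (Set.Icc a b)) (h2 : LipschitzOnWith K f (Set.Icc b c)) :
    LipschitzOnWith K f (Set.Icc a c) := by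
  have key : ∀ x ∈ Set.Icc a c, ∀ y ∈ Set.Icc a c, x ≤ y → dist (f x) (f y) ≤ K * dist x y := by
    intro x hx y hy hxy
    rcases le_total y b with hyb | hyb
    · exact h1.dist_le_mul x ⟨hx.1, hxy.trans hyb⟩ y ⟨hy.1, hyb⟩
    rcases le_total b x with hxb | hxb
    · exact h2.dist_le_mul x ⟨hxb, hx.2⟩ y ⟨hyb, hy.2⟩
    · have e1 := h1.dist_le_mul x ⟨hx.1, hxb⟩ b ⟨hx.1.trans hxb, le_rfl⟩
      have e2 := h2.dist_le_mul b ⟨le_rfl, hyb.trans hy.2⟩ y ⟨hyb, hy.2⟩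
      have e3 : dist x y = dist x b + dist b y := by
        rw [Real.dist_eq, Real.dist_eq, Real.dist_eq, abs_of_nonpos (by linarith),
          abs_of_nonpos (by linarith), abs_of_nonpos (by linarith)]
        ring
      rw [e3, mul_add]
      exact (dist_triangle _ (f b) _).trans (add_le_add e1 e2)
  refine LipschitzOnWith.of_dist_le_mul fun x hx y hy => ?_
  rcases le_total x y with h | h
  · exact key x hx y hy h
  · rw [dist_comm, dist_comm x y]
    exact key y hy x hx h

lemma exists_lipschitzOnWith_comp_sq {n : ℕ} {κ : ℝ} {O : Set ℝ} {h : ℝ → ℝ}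
    (hp : IsProfile n κ O h) {a b : ℝ} (hab : ∀ r ∈ Set.Icc a b, r ^ 2 ∈ O) :
    ∃ K : NNReal, LipschitzOnWith K (fun r => h (r ^ 2)) (Set.Icc a b) := by
  have hd : ∀ r ∈ Set.Icc a b, HasDerivAt (fun r => h (r ^ 2)) (deriv h (r ^ 2) * (2 * r)) r := by
    intro r hr
    have h2 : HasDerivAt (fun r : ℝ => r ^ 2) (2 * r) r := by simpa using hasDerivAt_pow 2 r
    exact HasDerivAt.comp (h₂ := h) r (hp.hasDerivAt (hab r hr)).1 h2
  have hc : ContinuousOn (fun r => deriv h (r ^ 2) * (2 * r)) (Set.Icc a b) :=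
    (hp.contDiffOn_deriv.continuousOn.comp (by fun_prop) hab).mul (by fun_prop)
  obtain ⟨C, hC⟩ := isCompact_Icc.exists_bound_of_continuousOn hc
  refine ⟨C.toNNReal, (convex_Icc a b).lipschitzOnWith_of_nnnorm_hasDerivWithin_le
    (fun r hr => (hd r hr).hasDerivWithinAt) fun r hr => ?_⟩
  rw [← NNReal.coe_le_coe, coe_nnnorm]
  exact (hC r hr).trans (Real.le_coe_toNNReal C)

/-- The gradient of `modeState` off the interface. -/
def modeStateGrad (D : RoundSetting) (n : ℕ) (hm hp : ℝ → ℝ) (x : Plane) :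
    EuclideanSpace ℂ (Fin 2) :=
  WithLp.toLp 2 fun i => if ‖x‖ < D.R₁ then modeGrad n hm x i else modeGrad n hp x i

namespace IsMode

variable {D : RoundSetting} {n : ℕ} {lam : ℝ} {O : Set ℝ} {hm hp : ℝ → ℝ}

lemma continuousOn_modeFun_of_continuousOn {n : ℕ} {h : ℝ → ℝ} {O : Set ℝ} (hh : ContinuousOn h O) :
    ContinuousOn (modeFun n h) {x | ‖x‖ ^ 2 ∈ O} := by
  have h1 : Continuous fun x : Plane => zc x ^ n := zc.continuous.pow n
  have h2 : ContinuousOn (fun x : Plane => h (‖x‖ ^ 2)) {x | ‖x‖ ^ 2 ∈ O} :=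
    hh.comp (by fun_prop) fun x hx => hx
  exact h1.continuousOn.mul (Complex.continuous_ofReal.comp_continuousOn h2)

lemma continuousOn_modeGrad {n : ℕ} {κ : ℝ} {O : Set ℝ} {h : ℝ → ℝ} (hp : IsProfile n κ O h)
    (i : Fin 2) : ContinuousOn (fun x => modeGrad n h x i) {x : Plane | ‖x‖ ^ 2 ∈ O} := by
  have h1 := continuousOn_modeFun_of_continuousOn (n := n - 1) hp.2.1.continuousOn
  have h2 := continuousOn_modeFun_of_continuousOn (n := n) hp.contDiffOn_deriv.continuousOn
  have h3 : Continuous fun x : Plane => 2 * ((x i : ℝ) : ℂ) := by fun_prop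
  exact (continuousOn_const.mul h1).add (h3.continuousOn.mul h2)

lemma isCompact_closed_annulus (a b : ℝ) : IsCompact {x : Plane | a ≤ ‖x‖ ∧ ‖x‖ ≤ b} := by
  refine (isCompact_closedBall (0 : Plane) b).of_isClosed_subset ?_ fun x hx => by simpa using hx.2
  exact (isClosed_le continuous_const continuous_norm).inter
    (isClosed_le continuous_norm continuous_const)

lemma exists_bound_ite {f₁ f₂ : Plane → ℂ}
    (h1 : ContinuousOn f₁ {x | D.R₀ ≤ ‖x‖ ∧ ‖x‖ ≤ D.R₁})
    (h2 : ContinuousOn f₂ {x | D.R₁ ≤ ‖x‖ ∧ ‖x‖ ≤ D.R₂}) :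
    ∃ B, ∀ x ∈ D.M, ‖if ‖x‖ < D.R₁ then f₁ x else f₂ x‖ ≤ B := by
  obtain ⟨C1, hC1⟩ := (isCompact_closed_annulus _ _).exists_bound_of_continuousOn h1
  obtain ⟨C2, hC2⟩ := (isCompact_closed_annulus _ _).exists_bound_of_continuousOn h2
  refine ⟨max C1 C2, fun x hx => ?_⟩
  have hx' := D.mem_M.1 hx
  by_cases h : ‖x‖ < D.R₁
  · simp only [if_pos h]
    exact (hC1 x ⟨hx'.1, h.le⟩).trans (le_max_left _ _)
  · simp only [if_neg h]
    exact (hC2 x ⟨not_lt.1 h, hx'.2⟩).trans (le_max_right _ _)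

/-- A function that is continuous up to the interface from both sides is bounded and measurable. -/
lemma memLp_ite {f₁ f₂ : Plane → ℂ}
    (h1 : ContinuousOn f₁ {x | D.R₀ ≤ ‖x‖ ∧ ‖x‖ ≤ D.R₁})
    (h2 : ContinuousOn f₂ {x | D.R₁ ≤ ‖x‖ ∧ ‖x‖ ≤ D.R₂}) :
    MemLp (fun x => if ‖x‖ < D.R₁ then f₁ x else f₂ x) ⊤ (volume.restrict D.M) := by
  have hset : MeasurableSet {x : Plane | ‖x‖ < D.R₁} :=
    (isOpen_lt continuous_norm continuous_const).measurableSet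
  have hMm : MeasurableSet D.M := measurableSet_closedBall.diff measurableSet_ball
  obtain ⟨B, hB⟩ := exists_bound_ite h1 h2
  refine memLp_top_of_bound ?_ B ((ae_restrict_iff' hMm).2 (ae_of_all _ hB))
  have := AEStronglyMeasurable.piecewise (μ := volume.restrict D.M) (f := f₁) (g := f₂) hset ?_ ?_
  · exact this.congr (ae_of_all _ fun x => by simp [Set.piecewise])
  · rw [Measure.restrict_restrict hset]
    refine (h1.aestronglyMeasurable (isCompact_closed_annulus _ _).measurableSet).mono_measure
      (Measure.restrict_mono (fun x hx => ?_) le_rfl)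
    exact ⟨(D.mem_M.1 hx.2).1, le_of_lt hx.1⟩
  · rw [Measure.restrict_restrict hset.compl]
    refine (h2.aestronglyMeasurable (isCompact_closed_annulus _ _).measurableSet).mono_measure
      (Measure.restrict_mono (fun x hx => ?_) le_rfl)
    exact ⟨not_lt.1 hx.1, (D.mem_M.1 hx.2).2⟩

lemma sq_pos_of_le {x : Plane} (hx : D.R₁ ≤ ‖x‖) : ‖x‖ ^ 2 ∈ Set.Ioi (0 : ℝ) :=
  Set.mem_Ioi.2 (by have := D.R₁_pos.trans_le hx; positivity)

lemma isFiniteMeasure_restrict_M : IsFiniteMeasure (volume.restrict D.M) :=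
  ⟨by
    rw [Measure.restrict_apply_univ]
    exact (measure_mono Set.sdiff_subset).trans_lt
      (isCompact_closedBall (0 : Plane) D.R₂).measure_lt_top⟩

lemma exists_bound_modeState (H : IsMode D n lam O hm hp) :
    ∃ B, ∀ x ∈ D.M, ‖modeState D n hm hp x‖ ≤ B :=
  exists_bound_ite ((continuousOn_modeFun_of_continuousOn H.profile_m.2.1.continuousOn).mono
      fun _ hx => H.sq_mem hx.1)
    ((continuousOn_modeFun_of_continuousOn H.profile_p.2.1.continuousOn).mono
      fun _ hx => sq_pos_of_le hx.1)

lemma memLp_modeState (H : IsMode D n lam O hm hp) :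
    MemLp (modeState D n hm hp) ⊤ (volume.restrict D.M) :=
  memLp_ite ((continuousOn_modeFun_of_continuousOn H.profile_m.2.1.continuousOn).mono
      fun _ hx => H.sq_mem hx.1)
    ((continuousOn_modeFun_of_continuousOn H.profile_p.2.1.continuousOn).mono
      fun _ hx => sq_pos_of_le hx.1)

lemma memLp_modeStateGrad (H : IsMode D n lam O hm hp) :
    MemLp (modeStateGrad D n hm hp) ⊤ (volume.restrict D.M) :=
  MemLp.of_eval_piLp fun i => memLp_ite ((continuousOn_modeGrad H.profile_m i).mono
      fun _ hx => H.sq_mem hx.1)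
    ((continuousOn_modeGrad H.profile_p i).mono fun _ hx => sq_pos_of_le hx.1)

/-- Across the interface the mode is only Lipschitz, which is enough for its classical gradient to
be its weak gradient. -/
theorem hasWeakGradient (H : IsMode D n lam O hm hp) :
    HasWeakGradient (interior D.M) (modeState D n hm hp) (modeStateGrad D n hm hp) := by
  have := isFiniteMeasure_restrict_M (D := D)
  have h01 := D.R₀_lt_R₁
  have h12 := D.R₁_lt_R₂
  obtain ⟨K1, hK1⟩ := exists_lipschitzOnWith_comp_sq H.profile_m (a := D.R₀) (b := D.R₁)
    fun r hr => H.sq_mem hr.1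
  obtain ⟨K2, hK2⟩ := exists_lipschitzOnWith_comp_sq H.profile_p (a := D.R₁) (b := D.R₂)
    fun r hr => Set.mem_Ioi.2 (by have := D.R₁_pos.trans_le hr.1; positivity)
  set f : ℝ → ℝ := fun r => if r < D.R₁ then hm (r ^ 2) else hp (r ^ 2) with hf
  have hf1 : Set.EqOn f (fun r => hm (r ^ 2)) (Set.Icc D.R₀ D.R₁) := by
    intro r hr
    rcases hr.2.eq_or_lt with rfl | h
    · simp [hf, H.val_eq]
    · simp [hf, h]
  have hf2 : Set.EqOn f (fun r => hp (r ^ 2)) (Set.Icc D.R₁ D.R₂) := by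
    intro r hr
    simp [hf, not_lt.2 hr.1]
  have hfl : LipschitzOnWith (max K1 K2) f (Set.Icc D.R₀ D.R₂) := by
    refine lipschitzOnWith_Icc_union (b := D.R₁) ?_ ?_
    · exact fun x hx y hy => by
        rw [hf1 hx, hf1 hy]
        exact (hK1.weaken (le_max_left _ _)) hx hy
    · exact fun x hx y hy => by
        rw [hf2 hx, hf2 hy]
        exact (hK2.weaken (le_max_right _ _)) hx hy
  obtain ⟨F, hF, hFf⟩ := hfl.extend_real
  have hΨ : LipschitzWith (max K1 K2 * 1) fun x : Plane => F ‖x‖ := hF.comp lipschitzWith_one_norm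
  have hZ : ContDiff ℝ (⊤ : ℕ∞) fun x : Plane => zc x ^ n :=
    (zc.toContinuousLinearEquiv.toContinuousLinearMap.contDiff).pow n
  have hdZ : ∀ (x v : Plane), fderiv ℝ (fun x : Plane => zc x ^ n) x v =
      n * zc x ^ (n - 1) * zc v := by
    intro x v
    have h1 : HasFDerivAt (fun y : Plane => zc y ^ n) _ x :=
      (zc.toContinuousLinearEquiv.toContinuousLinearMap.hasFDerivAt (x := x)).pow n
    rw [h1.fderiv]
    simp
  have hΨm : ∀ x ∈ D.M, F ‖x‖ = f ‖x‖ := fun x hx => (hFf (D.mem_M.1 hx)).symm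
  have hline : ∀ {h : ℝ → ℝ} {x : Plane} (i : Fin 2), DifferentiableAt ℝ h (‖x‖ ^ 2) →
      (∀ᶠ y : Plane in 𝓝 x, F ‖y‖ = h (‖y‖ ^ 2)) →
      lineDeriv ℝ (fun x : Plane => F ‖x‖) x (e i) = deriv h (‖x‖ ^ 2) * (2 * x i) := by
    intro h x i hd heq
    have h2 : HasFDerivAt (fun y : Plane => h (‖y‖ ^ 2)) _ x :=
      hd.hasDerivAt.comp_hasFDerivAt x (hasStrictFDerivAt_norm_sq x).hasFDerivAt
    have h3 : HasFDerivAt (fun y : Plane => F ‖y‖) _ x := h2.congr_of_eventuallyEq heq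
    rw [(h3.hasLineDerivAt (e i)).lineDeriv]
    simp [inner_e]
  have hsub : interior D.M ⊆ D.M := interior_subset
  have hnull : ∀ᵐ x : Plane, ‖x‖ ≠ D.R₁ := by
    have := Measure.addHaar_sphere (volume : Measure Plane) 0 D.R₁
    rw [← compl_mem_ae_iff] at this
    filter_upwards [this] with x hx
    simpa using hx
  refine hasWeakGradient_of_lipschitz_mul hΨ hZ isOpen_interior ?_ ?_ ?_ ?_
  · have hi : IntegrableOn (modeState D n hm hp) D.M := H.memLp_modeState.integrable le_top
    exact hi.locallyIntegrableOn.mono_set hsub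
  · have hi : IntegrableOn (modeStateGrad D n hm hp) D.M := H.memLp_modeStateGrad.integrable le_top
    exact hi.locallyIntegrableOn.mono_set hsub
  · refine ae_of_all _ fun x hx => ?_
    rw [hΨm x (hsub hx)]
    simp only [modeState, modeFun, hf]
    split_ifs <;> rfl
  · intro i
    filter_upwards [hnull] with x hxS hx
    have hxM := D.mem_M.1 (hsub hx)
    rw [hdZ]
    rcases lt_or_gt_of_ne hxS with h | h
    · have hd := (H.profile_m.hasDerivAt (H.sq_mem hxM.1)).1.differentiableAt
      have hev : ∀ᶠ y : Plane in 𝓝 x, F ‖y‖ = hm (‖y‖ ^ 2) := by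
        filter_upwards [isOpen_interior.mem_nhds hx,
          (isOpen_lt continuous_norm continuous_const).mem_nhds h] with y hy hy'
        have hy'' : ‖y‖ < D.R₁ := hy'
        rw [hΨm y (hsub hy)]
        simp [hf, hy'']
      rw [hline i hd hev, hev.self_of_nhds]
      simp only [modeStateGrad, h, if_true, modeGrad, modeFun]
      push_cast
      ring
    · have hd := (H.profile_p.hasDerivAt (sq_pos_of_le h.le)).1.differentiableAt
      have hev : ∀ᶠ y : Plane in 𝓝 x, F ‖y‖ = hp (‖y‖ ^ 2) := by
        filter_upwards [isOpen_interior.mem_nhds hx,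
          (isOpen_lt continuous_const continuous_norm).mem_nhds h] with y hy hy'
        have hy'' : D.R₁ < ‖y‖ := hy'
        rw [hΨm y (hsub hy)]
        simp [hf, not_lt.2 hy''.le]
      rw [hline i hd hev, hev.self_of_nhds]
      simp only [modeStateGrad, not_lt.2 h.le, if_false, modeGrad, modeFun]
      push_cast
      ring

end IsMode

/-! ### Energy identity and norms of the modes -/

/-- Multiplying the radial equation by the solution and integrating: the derivative of
`r^{2n} h · flux` at `ρ = r²`. -/
lemma IsProfile.hasDerivAt_energy {k : ℕ} {κ : ℝ} {O : Set ℝ} {h : ℝ → ℝ}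
    (hp : IsProfile (k + 1) κ O h) {r : ℝ} (hr : r ^ 2 ∈ O) :
    HasDerivAt (fun r => r ^ (2 * k + 2) * (h (r ^ 2) * flux (k + 1) h (r ^ 2)))
      (r * (r ^ (2 * k) * (flux (k + 1) h (r ^ 2) ^ 2 + (k + 1) ^ 2 * h (r ^ 2) ^ 2)) -
        κ * (r * (r ^ (2 * k + 2) * h (r ^ 2) ^ 2))) r := by
  have h2 : HasDerivAt (fun r : ℝ => r ^ 2) (2 * r) r := by simpa using hasDerivAt_pow 2 r
  obtain ⟨hd, hd'⟩ := hp.hasDerivAt hr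
  have hc : HasDerivAt (fun r => h (r ^ 2)) _ r := HasDerivAt.comp (h₂ := h) r hd h2
  have hf : HasDerivAt (flux (k + 1) h) _ (r ^ 2) :=
    (hd.const_mul ((k + 1 : ℕ) : ℝ)).add (((hasDerivAt_id _).const_mul 2).mul hd')
  have hfc : HasDerivAt (fun r => flux (k + 1) h (r ^ 2)) _ r :=
    HasDerivAt.comp (h₂ := flux (k + 1) h) r hf h2
  refine HasDerivAt.congr_deriv ((hasDerivAt_pow (2 * k + 2) r).mul (hc.mul hfc)) ?_
  have e := hp.2.2 _ hr
  simp only [flux]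
  push_cast at e ⊢
  linear_combination (4 * r ^ (2 * k) * r ^ 3 * h (r ^ 2)) * e

/-- The square modulus of `zⁿ h(|z|²)` on the circle of radius `r`. -/
def radialSq (n : ℕ) (h : ℝ → ℝ) (r : ℝ) : ℝ := r ^ (2 * n) * h (r ^ 2) ^ 2

/-- The square modulus of the gradient of `zⁿ h(|z|²)` on the circle of radius `r`. -/
def radialGradSq (n : ℕ) (h : ℝ → ℝ) (r : ℝ) : ℝ :=
  r ^ (2 * (n - 1)) * (flux n h (r ^ 2) ^ 2 + n ^ 2 * h (r ^ 2) ^ 2)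

lemma norm_sq_modeFun (n : ℕ) (h : ℝ → ℝ) (x : Plane) :
    ‖modeFun n h x‖ ^ 2 = radialSq n h ‖x‖ := by
  rw [modeFun, radialSq, norm_mul, norm_pow, LinearIsometryEquiv.norm_map, Complex.norm_real,
    mul_pow, ← pow_mul, Real.norm_eq_abs, sq_abs, mul_comm n 2]

lemma sum_norm_sq_modeGrad {n : ℕ} (hn : 1 ≤ n) (h : ℝ → ℝ) (x : Plane) :
    ∑ i : Fin 2, ‖modeGrad n h x i‖ ^ 2 = radialGradSq n h ‖x‖ := by
  obtain ⟨k, rfl⟩ : ∃ k, n = k + 1 := ⟨n - 1, by omega⟩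
  have hfac : ∀ i, modeGrad (k + 1) h x i = zc x ^ k *
      ((k + 1) * zc (e i) * (h (‖x‖ ^ 2) : ℂ) + 2 * (x i : ℂ) * zc x * ((deriv h (‖x‖ ^ 2) : ℝ) : ℂ)) := by
    intro i
    simp only [modeGrad, modeFun, Nat.add_sub_cancel]
    push_cast
    ring
  have hre : (zc x).re = x 0 := by rw [zc_eq]; simp
  have him : (zc x).im = x 1 := by rw [zc_eq]; simp
  rw [Fin.sum_univ_two, hfac, hfac, zc_e_zero, zc_e_one]
  simp only [norm_mul, mul_pow, norm_pow, LinearIsometryEquiv.norm_map, ← Complex.normSq_eq_norm_sq,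
    radialGradSq, flux, Nat.add_sub_cancel]
  simp only [Complex.normSq_apply, Complex.add_re, Complex.add_im, Complex.mul_re, Complex.mul_im,
    Complex.ofReal_re, Complex.ofReal_im, Complex.one_re, Complex.one_im, Complex.I_re, Complex.I_im,
    Complex.natCast_re, Complex.natCast_im, Complex.re_ofNat, Complex.im_ofNat, hre, him]
  have e := norm_sq_eq x
  rw [pow_mul, pow_right_comm]
  set H := h (‖x‖ ^ 2)
  set H1 := deriv h (‖x‖ ^ 2)
  push_cast
  rw [e]
  ring

/-- Integration in polar coordinates over `𝓜`. -/
lemma setIntegral_M_radial (D : RoundSetting) (F : ℝ → ℝ) :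
    ∫ x in D.M, F ‖x‖ = 2 * volume.real (Metric.ball (0 : Plane) 1) * ∫ r in D.R₀..D.R₂, r * F r := by
  have hMm : MeasurableSet D.M := measurableSet_closedBall.diff measurableSet_ball
  have hnull : ∀ᵐ x : Plane, ‖x‖ ≠ D.R₀ := by
    have := Measure.addHaar_sphere (volume : Measure Plane) 0 D.R₀
    rw [← compl_mem_ae_iff] at this
    filter_upwards [this] with x hx
    simpa using hx
  have h1 : ∫ x in D.M, F ‖x‖ = ∫ x : Plane, (Set.Ioc D.R₀ D.R₂).indicator F ‖x‖ := by
    rw [← integral_indicator hMm]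
    refine integral_congr_ae ?_
    filter_upwards [hnull] with x hx
    by_cases hxM : x ∈ D.M
    · have := D.mem_M.1 hxM
      rw [Set.indicator_of_mem hxM, Set.indicator_of_mem]
      exact ⟨lt_of_le_of_ne this.1 (Ne.symm hx), this.2⟩
    · rw [Set.indicator_of_notMem hxM, Set.indicator_of_notMem]
      exact fun h => hxM (D.mem_M.2 ⟨h.1.le, h.2⟩)
  rw [h1, integral_fun_norm_addHaar, finrank_euclideanSpace_fin]
  have h2 : ∀ y : ℝ, y ^ (2 - 1) • (Set.Ioc D.R₀ D.R₂).indicator F y =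
      (Set.Ioc D.R₀ D.R₂).indicator (fun r => r * F r) y := by
    intro y
    by_cases hy : y ∈ Set.Ioc D.R₀ D.R₂ <;> simp [hy]
  simp_rw [h2]
  rw [setIntegral_indicator measurableSet_Ioc,
    Set.inter_eq_right.2 (fun r hr => Set.mem_Ioi.2 (D.R₀_nonneg.trans_lt hr.1)),
    intervalIntegral.integral_of_le (D.R₀_lt_R₁.trans D.R₁_lt_R₂).le, nsmul_eq_mul, smul_eq_mul]
  push_cast
  ring

lemma integral_ite_split {a b c : ℝ} (hab : a < b) (hbc : b < c) {f₁ f₂ : ℝ → ℝ}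
    (h1 : ContinuousOn f₁ (Set.Icc a b)) (h2 : ContinuousOn f₂ (Set.Icc b c)) :
    ∫ r in a..c, (if r < b then f₁ r else f₂ r) = (∫ r in a..b, f₁ r) + ∫ r in b..c, f₂ r := by
  have e1 : Set.EqOn (fun r => if r < b then f₁ r else f₂ r) f₁ (Set.Ioo a b) := fun r hr => by
    simp [hr.2]
  have e2 : Set.EqOn (fun r => if r < b then f₁ r else f₂ r) f₂ (Set.Ioo b c) := fun r hr => by
    simp [not_lt.2 hr.1.le]
  have i1 := (intervalIntegrable_iff_integrableOn_Ioo_of_le hab.le).1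
    (h1.intervalIntegrable_of_Icc (μ := volume) hab.le)
  have i2 := (intervalIntegrable_iff_integrableOn_Ioo_of_le hbc.le).1
    (h2.intervalIntegrable_of_Icc (μ := volume) hbc.le)
  rw [← intervalIntegral.integral_add_adjacent_intervals (b := b)
    ((intervalIntegrable_iff_integrableOn_Ioo_of_le hab.le).2
      (i1.congr_fun e1.symm measurableSet_Ioo))
    ((intervalIntegrable_iff_integrableOn_Ioo_of_le hbc.le).2
      (i2.congr_fun e2.symm measurableSet_Ioo))]
  simp only [intervalIntegral.integral_of_le hab.le, intervalIntegral.integral_of_le hbc.le,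
    integral_Ioc_eq_integral_Ioo]
  rw [setIntegral_congr_fun measurableSet_Ioo e1, setIntegral_congr_fun measurableSet_Ioo e2]

namespace IsMode

variable {D : RoundSetting} {n : ℕ} {lam : ℝ} {O : Set ℝ} {hm hp : ℝ → ℝ}

lemma norm_sq_modeState (D : RoundSetting) (n : ℕ) (hm hp : ℝ → ℝ) (x : Plane) :
    ‖modeState D n hm hp x‖ ^ 2 =
      (fun r => if r < D.R₁ then radialSq n hm r else radialSq n hp r) ‖x‖ := by
  simp only [modeState]
  split_ifs <;> exact norm_sq_modeFun _ _ _

lemma norm_sq_modeStateGrad (D : RoundSetting) (hn : 1 ≤ n) (hm hp : ℝ → ℝ) (x : Plane) :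
    ‖modeStateGrad D n hm hp x‖ ^ 2 =
      (fun r => if r < D.R₁ then radialGradSq n hm r else radialGradSq n hp r) ‖x‖ := by
  rw [EuclideanSpace.norm_sq_eq]
  simp only [modeStateGrad]
  split_ifs <;> exact sum_norm_sq_modeGrad hn _ _

lemma continuousOn_radialSq {κ : ℝ} {h : ℝ → ℝ} (hp : IsProfile n κ O h) {s : Set ℝ}
    (hs : ∀ r ∈ s, r ^ 2 ∈ O) : ContinuousOn (fun r => r * radialSq n h r) s := by
  have h1 : ContinuousOn (fun r : ℝ => h (r ^ 2)) s := hp.2.1.continuousOn.comp (by fun_prop) hs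
  exact continuousOn_id.mul ((continuousOn_id.pow _).mul (h1.pow 2))

lemma continuousOn_radialGradSq {κ : ℝ} {h : ℝ → ℝ} (hp : IsProfile n κ O h) {s : Set ℝ}
    (hs : ∀ r ∈ s, r ^ 2 ∈ O) : ContinuousOn (fun r => r * radialGradSq n h r) s := by
  have h1 : ContinuousOn (fun r : ℝ => h (r ^ 2)) s := hp.2.1.continuousOn.comp (by fun_prop) hs
  have h2 : ContinuousOn (fun r : ℝ => deriv h (r ^ 2)) s :=
    hp.contDiffOn_deriv.continuousOn.comp (by fun_prop) hs
  exact continuousOn_id.mul ((continuousOn_id.pow _).mul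
    (((continuousOn_const.mul h1).add ((continuousOn_const.mul (continuousOn_id.pow 2)).mul h2)).pow 2
      |>.add (continuousOn_const.mul (h1.pow 2))))

lemma integral_energy {κ : ℝ} {h : ℝ → ℝ} (hn : 1 ≤ n) (hp : IsProfile n κ O h) {a b : ℝ}
    (hab : a ≤ b) (hs : ∀ r ∈ Set.Icc a b, r ^ 2 ∈ O) :
    ∫ r in a..b, r * radialGradSq n h r = κ * (∫ r in a..b, r * radialSq n h r) +
      (b ^ (2 * n) * (h (b ^ 2) * flux n h (b ^ 2)) -
        a ^ (2 * n) * (h (a ^ 2) * flux n h (a ^ 2))) := by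
  obtain ⟨k, rfl⟩ : ∃ k, n = k + 1 := ⟨n - 1, by omega⟩
  have i1 := (continuousOn_radialGradSq hp hs).intervalIntegrable_of_Icc (μ := volume) hab
  have i2 := ((continuousOn_radialSq hp hs).intervalIntegrable_of_Icc (μ := volume) hab).const_mul κ
  have hd : ∀ r ∈ Set.uIcc a b, HasDerivAt
      (fun r => r ^ (2 * (k + 1)) * (h (r ^ 2) * flux (k + 1) h (r ^ 2)))
      (r * radialGradSq (k + 1) h r - κ * (r * radialSq (k + 1) h r)) r := by
    intro r hr
    rw [Set.uIcc_of_le hab] at hr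
    have := hp.hasDerivAt_energy (hs r hr)
    simpa [radialGradSq, radialSq, mul_add] using this
  have := intervalIntegral.integral_eq_sub_of_hasDerivAt hd (i1.sub i2)
  rw [intervalIntegral.integral_sub i1 i2, intervalIntegral.integral_const_mul] at this
  linarith

/-- Green's formula: the boundary terms cancel by the transmission and boundary conditions. -/
lemma min_mul_integral_grad_le (H : IsMode D n lam O hm hp) (hn : 1 ≤ n) :
    min D.cm D.cp * ∫ x in D.M, ‖modeStateGrad D n hm hp x‖ ^ 2 ≤
      lam * ∫ x in D.M, ‖modeState D n hm hp x‖ ^ 2 := by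
  have h01 := D.R₀_lt_R₁
  have h12 := D.R₁_lt_R₂
  have hcm := D.cm_pos
  have hcp := D.cp_pos
  have hsm : ∀ r ∈ Set.Icc D.R₀ D.R₁, r ^ 2 ∈ O := fun r hr => H.sq_mem hr.1
  have hsp : ∀ r ∈ Set.Icc D.R₁ D.R₂, r ^ 2 ∈ Set.Ioi (0 : ℝ) := fun r hr =>
    Set.mem_Ioi.2 (by have := D.R₁_pos.trans_le hr.1; positivity)
  simp_rw [norm_sq_modeState, norm_sq_modeStateGrad D hn]
  have eG := setIntegral_M_radial D
    fun r => if r < D.R₁ then radialGradSq n hm r else radialGradSq n hp r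
  have eU := setIntegral_M_radial D fun r => if r < D.R₁ then radialSq n hm r else radialSq n hp r
  simp only [mul_ite] at eG eU
  rw [eG, eU]
  rw [integral_ite_split h01 h12 (continuousOn_radialSq H.profile_m hsm)
      (continuousOn_radialSq H.profile_p hsp),
    integral_ite_split h01 h12 (continuousOn_radialGradSq H.profile_m hsm)
      (continuousOn_radialGradSq H.profile_p hsp)]
  have em := integral_energy hn H.profile_m h01.le hsm
  have ep := integral_energy hn H.profile_p h12.le hsp
  have hz0 : D.R₀ ^ (2 * n) * (hm (D.R₀ ^ 2) * flux n hm (D.R₀ ^ 2)) = 0 := by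
    rcases D.R₀_nonneg.eq_or_lt with h | h
    · rw [← h, zero_pow (by omega), zero_mul]
    · rw [H.dirichlet_m h, zero_mul, mul_zero]
  rw [hz0, sub_zero] at em
  rw [H.dirichlet_p, zero_mul, mul_zero, zero_sub, ← H.val_eq] at ep
  have nonneg : ∀ (h : ℝ → ℝ) (a b : ℝ), 0 ≤ a → a ≤ b → 0 ≤ ∫ r in a..b, r * radialGradSq n h r := by
    intro h a b ha hab
    refine intervalIntegral.integral_nonneg hab fun r hr => ?_
    have : 0 ≤ r := ha.trans hr.1
    unfold radialGradSq
    positivity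
  have nm := nonneg hm D.R₀ D.R₁ D.R₀_nonneg h01.le
  have np := nonneg hp D.R₁ D.R₂ D.R₁_pos.le h12.le
  set Gm := ∫ r in D.R₀..D.R₁, r * radialGradSq n hm r
  set Gp := ∫ r in D.R₁..D.R₂, r * radialGradSq n hp r
  set Um := ∫ r in D.R₀..D.R₁, r * radialSq n hm r
  set Up := ∫ r in D.R₁..D.R₂, r * radialSq n hp r
  have key : D.cm * Gm + D.cp * Gp = lam * (Um + Up) := by
    have e1 : D.cm * (lam / D.cm * Um) = lam * Um := by field_simp
    have e2 : D.cp * (lam / D.cp * Up) = lam * Up := by field_simp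
    rw [em, ep]
    linear_combination e1 + e2 + D.R₁ ^ (2 * n) * hm (D.R₁ ^ 2) * H.flux_eq
  have hmin : min D.cm D.cp * (Gm + Gp) ≤ lam * (Um + Up) := by
    rw [← key, mul_add]
    exact add_le_add (mul_le_mul_of_nonneg_right (min_le_left _ _) nm)
      (mul_le_mul_of_nonneg_right (min_le_right _ _) np)
  have hv : 0 ≤ 2 * volume.real (Metric.ball (0 : Plane) 1) := by positivity
  calc _ = 2 * volume.real (Metric.ball (0 : Plane) 1) * (min D.cm D.cp * (Gm + Gp)) := by ring
    _ ≤ 2 * volume.real (Metric.ball (0 : Plane) 1) * (lam * (Um + Up)) :=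
      mul_le_mul_of_nonneg_left hmin hv
    _ = _ := by ring

lemma integrable_norm_sq {F : Type*} [NormedAddCommGroup F] {f : Plane → F}
    (hf : MemLp f ⊤ (volume.restrict D.M)) : IntegrableOn (fun x => ‖f x‖ ^ 2) D.M := by
  have := isFiniteMeasure_restrict_M (D := D)
  exact (hf.mono_exponent (p := 2) le_top).integrable_norm_pow (by norm_num)

/-- The angular derivative alone bounds the gradient from below. -/
lemma mul_integral_le_integral_grad (H : IsMode D n lam O hm hp) (hn : 1 ≤ n) :
    n ^ 2 * ∫ x in D.M, ‖modeState D n hm hp x‖ ^ 2 ≤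
      D.R₂ ^ 2 * ∫ x in D.M, ‖modeStateGrad D n hm hp x‖ ^ 2 := by
  have hMm : MeasurableSet D.M := measurableSet_closedBall.diff measurableSet_ball
  rw [← integral_const_mul, ← integral_const_mul]
  refine setIntegral_mono_on ((integrable_norm_sq H.memLp_modeState).const_mul _)
    ((integrable_norm_sq H.memLp_modeStateGrad).const_mul _) hMm fun x hx => ?_
  have key : ∀ h : ℝ → ℝ, n ^ 2 * radialSq n h ‖x‖ ≤ D.R₂ ^ 2 * radialGradSq n h ‖x‖ := by
    intro h
    obtain ⟨k, rfl⟩ : ∃ k, n = k + 1 := ⟨n - 1, by omega⟩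
    have h2 : ‖x‖ ^ 2 ≤ D.R₂ ^ 2 := by
      have := (D.mem_M.1 hx).2
      gcongr
    simp only [radialSq, radialGradSq, Nat.add_sub_cancel]
    calc ((k + 1 : ℕ) : ℝ) ^ 2 * (‖x‖ ^ (2 * (k + 1)) * h (‖x‖ ^ 2) ^ 2)
        = ‖x‖ ^ 2 * (‖x‖ ^ (2 * k) * (((k + 1 : ℕ) : ℝ) ^ 2 * h (‖x‖ ^ 2) ^ 2)) := by ring
      _ ≤ D.R₂ ^ 2 * (‖x‖ ^ (2 * k) * (((k + 1 : ℕ) : ℝ) ^ 2 * h (‖x‖ ^ 2) ^ 2)) := by gcongr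
      _ ≤ _ := by
        gcongr
        nlinarith [sq_nonneg (flux (k + 1) h (‖x‖ ^ 2))]
  rw [norm_sq_modeState, norm_sq_modeStateGrad D hn]
  simp only
  split_ifs
  · exact key hm
  · exact key hp

end IsMode

lemma l2Norm_eq_sqrt {F : Type*} [NormedAddCommGroup F] {A : Set Plane} {f : Plane → F}
    (hf : MemLp f 2 (volume.restrict A)) :
    l2Norm A f = ENNReal.ofReal (√(∫ x in A, ‖f x‖ ^ 2)) := by
  rw [l2Norm, hf.eLpNorm_eq_integral_rpow_norm two_ne_zero ENNReal.ofNat_ne_top, Real.sqrt_eq_rpow]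
  simp

lemma pairNorm_zero_right (a : ℝ≥0∞) : pairNorm a 0 = a := by
  rw [pairNorm, zero_pow two_ne_zero, add_zero, ← ENNReal.rpow_natCast, ← ENNReal.rpow_mul]
  norm_num

lemma pairNorm_ofReal {a b : ℝ} (ha : 0 ≤ a) (hb : 0 ≤ b) :
    pairNorm (ENNReal.ofReal a) (ENNReal.ofReal b) = ENNReal.ofReal (√(a ^ 2 + b ^ 2)) := by
  rw [pairNorm, ← ENNReal.ofReal_pow ha, ← ENNReal.ofReal_pow hb,
    ← ENNReal.ofReal_add (by positivity) (by positivity),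
    ENNReal.ofReal_rpow_of_nonneg (by positivity) (by norm_num), Real.sqrt_eq_rpow]

lemma hMinusOneNorm_zero (Ω : Set Plane) : hMinusOneNorm Ω 0 = 0 := by
  simp [hMinusOneNorm]

lemma interior_M_ae_eq (D : RoundSetting) : interior D.M =ᵐ[volume] D.M := by
  have h0 := Measure.addHaar_sphere (volume : Measure Plane) 0 D.R₀
  have h2 := Measure.addHaar_sphere (volume : Measure Plane) 0 D.R₂
  rw [← compl_mem_ae_iff] at h0 h2
  filter_upwards [h0, h2] with x hx0 hx2
  refine propext ⟨fun h => interior_subset h, fun h => ?_⟩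
  have := D.mem_M.1 h
  exact D.mem_interior_M (lt_of_le_of_ne this.1 fun h => hx0 (by simp [h]))
    (lt_of_le_of_ne this.2 fun h => hx2 (by simp [h]))

namespace IsMode

variable {D : RoundSetting} {n : ℕ} {lam : ℝ} {O : Set ℝ} {hm hp : ℝ → ℝ}

/-- The norms of a normalized mode, and its frequency. -/
lemma norms_of_normalized (H : IsMode D n lam O hm hp)
    (h1 : ∫ x in D.M, ‖modeState D n hm hp x‖ ^ 2 = 1) :
    l2Norm D.M (modeState D n hm hp) = 1 ∧
    D.energyNorm (modeState D n hm hp) 0 =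
      ENNReal.ofReal (√(1 + ∫ x in D.M, ‖modeStateGrad D n hm hp x‖ ^ 2)) ∧
    D.freq (modeState D n hm hp) 0 =
      ENNReal.ofReal (√(1 + ∫ x in D.M, ‖modeStateGrad D n hm hp x‖ ^ 2)) := by
  have := isFiniteMeasure_restrict_M (D := D)
  have hr : volume.restrict (interior D.M) = volume.restrict D.M :=
    Measure.restrict_congr_set (interior_M_ae_eq D)
  have e1 : l2Norm D.M (modeState D n hm hp) = 1 := by
    rw [l2Norm_eq_sqrt (H.memLp_modeState.mono_exponent le_top), h1]
    simp
  have e1' : l2Norm (interior D.M) (modeState D n hm hp) = 1 := by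
    rw [l2Norm, hr]; exact e1
  have e2 : gradNorm (interior D.M) (modeState D n hm hp) =
      ENNReal.ofReal (√(∫ x in D.M, ‖modeStateGrad D n hm hp x‖ ^ 2)) := by
    rw [gradNorm_eq isOpen_interior H.hasWeakGradient, l2Norm, hr, ← l2Norm,
      l2Norm_eq_sqrt (H.memLp_modeStateGrad.mono_exponent le_top)]
  have hG : 0 ≤ ∫ x in D.M, ‖modeStateGrad D n hm hp x‖ ^ 2 :=
    integral_nonneg fun x => by positivity
  have e3 : l2Norm (interior D.M) (0 : Plane → ℂ) = 0 := by simp [l2Norm]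
  have e4 : D.energyNorm (modeState D n hm hp) 0 =
      ENNReal.ofReal (√(1 + ∫ x in D.M, ‖modeStateGrad D n hm hp x‖ ^ 2)) := by
    rw [RoundSetting.energyNorm, e3, pairNorm_zero_right, h1Norm, e1', e2, ← ENNReal.ofReal_one,
      pairNorm_ofReal zero_le_one (Real.sqrt_nonneg _), Real.sq_sqrt hG, one_pow]
  refine ⟨e1, e4, ?_⟩
  rw [RoundSetting.freq, e4, RoundSetting.weakNorm, hMinusOneNorm_zero, pairNorm_zero_right, e1',
    div_one]

/-- Multiples of modes are modes. -/
lemma const_mul (H : IsMode D n lam O hm hp) (a : ℝ) :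
    IsMode D n lam O (fun ρ => a * hm ρ) (fun ρ => a * hp ρ) := by
  have hd : ∀ h : ℝ → ℝ, deriv (fun ρ => a * h ρ) = fun ρ => a * deriv h ρ := fun h =>
    funext fun ρ => deriv_const_mul_field a
  have hf : ∀ (h : ℝ → ℝ) ρ, flux n (fun ρ => a * h ρ) ρ = a * flux n h ρ := fun h ρ => by
    rw [flux, hd, flux]; ring
  have hpr : ∀ {κ : ℝ} {O : Set ℝ} {h : ℝ → ℝ}, IsProfile n κ O h →
      IsProfile n κ O fun ρ => a * h ρ := by
    intro κ O h hp
    refine ⟨hp.1, contDiffOn_const.mul hp.2.1, fun ρ hρ => ?_⟩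
    rw [hd, hd]
    linear_combination a * hp.2.2 ρ hρ
  refine ⟨hpr H.profile_m, hpr H.profile_p, H.subset, by rw [H.val_eq], ?_, fun h => ?_, ?_⟩
  · rw [hf, hf]
    linear_combination a * H.flux_eq
  · rw [H.dirichlet_m h, mul_zero]
  · rw [H.dirichlet_p, mul_zero]

lemma modeState_const_mul (D : RoundSetting) (n : ℕ) (hm hp : ℝ → ℝ) (a : ℝ) (x : Plane) :
    modeState D n (fun ρ => a * hm ρ) (fun ρ => a * hp ρ) x = a * modeState D n hm hp x := by
  simp only [modeState, modeFun]
  split_ifs <;> push_cast <;> ring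

end IsMode

/-! ### Concentration of the normalized modes -/

lemma norm_smul_e_zero {r : ℝ} (hr : 0 ≤ r) : ‖r • e 0‖ = r := by
  rw [norm_smul, e, PiLp.norm_single]
  simp [abs_of_nonneg hr]

lemma measure_annulus_pos {a b : ℝ} (ha : 0 ≤ a) (hab : a < b) :
    0 < volume {x : Plane | a < ‖x‖ ∧ ‖x‖ < b} := by
  have ho : IsOpen {x : Plane | a < ‖x‖ ∧ ‖x‖ < b} :=
    (isOpen_lt continuous_const continuous_norm).inter (isOpen_lt continuous_norm continuous_const)
  refine ho.measure_pos _ ⟨((a + b) / 2) • e 0, ?_⟩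
  rw [Set.mem_ofPred_eq, norm_smul_e_zero (by linarith)]
  constructor <;> linarith

/-- The part of `𝓜` at distance at least `δ` from the interface. -/
def awaySet (D : RoundSetting) (δ : ℝ) : Set Plane :=
  {x | x ∈ D.M ∧ (‖x‖ ≤ D.R₁ - δ ∨ D.R₁ + δ ≤ ‖x‖)}

lemma measurableSet_awaySet (D : RoundSetting) (δ : ℝ) : MeasurableSet (awaySet D δ) :=
  (measurableSet_closedBall.diff measurableSet_ball).inter
    (((isClosed_le continuous_norm continuous_const).union
      (isClosed_le continuous_const continuous_norm)).measurableSet)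

lemma exists_subset_awaySet {D : RoundSetting} {ω : Set Plane} (hω : ω ⊆ D.M)
    (h : D.AwayFromInterface ω) : ∃ δ : ℝ, 0 < δ ∧ ω ⊆ awaySet D δ := by
  obtain ⟨δ, hδ, h⟩ := h
  refine ⟨δ, hδ, fun x hx => ⟨hω hx, ?_⟩⟩
  have hR := D.R₁_pos
  rcases eq_or_ne x 0 with rfl | hx0
  · have := h 0 (subset_closure hx) (D.R₁ • e 0)
      (by simp [RoundSetting.S, norm_smul_e_zero hR.le])
    rw [dist_zero_left, norm_smul_e_zero hR.le] at this
    left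
    rw [norm_zero]
    linarith
  · have hn : 0 < ‖x‖ := norm_pos_iff.2 hx0
    have hdist : dist x ((D.R₁ / ‖x‖) • x) = |‖x‖ - D.R₁| := by
      have : x - (D.R₁ / ‖x‖) • x = ((‖x‖ - D.R₁) / ‖x‖) • x := by
        rw [sub_div, div_self hn.ne', sub_smul, one_smul]
      rw [dist_eq_norm, this, norm_smul, Real.norm_eq_abs, abs_div, abs_of_pos hn]
      field_simp
    have := h x (subset_closure hx) ((D.R₁ / ‖x‖) • x) (by
      simp only [RoundSetting.S, mem_sphere_iff_norm, sub_zero, norm_smul, Real.norm_eq_abs, abs_div,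
        abs_of_pos hR, abs_of_pos hn]
      field_simp)
    rw [hdist, le_abs] at this
    rcases this with h | h
    · right; linarith
    · left; linarith

lemma IsMode.mul_measure_le {D : RoundSetting} {n : ℕ} {lam : ℝ} {O : Set ℝ} {hm hp : ℝ → ℝ}
    (H : IsMode D n lam O hm hp) (h1 : ∫ x in D.M, ‖modeState D n hm hp x‖ ^ 2 = 1)
    {A : Set Plane} (hA : MeasurableSet A) (hAM : A ⊆ D.M) {c : ℝ} (hc : 0 ≤ c)
    (h : ∀ x ∈ A, c ≤ ‖modeState D n hm hp x‖) : c ^ 2 * volume.real A ≤ 1 := by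
  have hi := IsMode.integrable_norm_sq H.memLp_modeState
  have hfin : volume A ≠ ⊤ := by
    refine ((measure_mono hAM).trans_lt ((measure_mono Set.sdiff_subset).trans_lt
      (isCompact_closedBall (0 : Plane) D.R₂).measure_lt_top)).ne
  calc c ^ 2 * volume.real A = ∫ _ in A, c ^ 2 := by simp [mul_comm]
    _ ≤ ∫ x in A, ‖modeState D n hm hp x‖ ^ 2 := by
      refine setIntegral_mono_on (integrableOn_const hfin) (hi.mono_set hAM) hA fun x hx => ?_
      have := h x hx
      gcongr
    _ ≤ ∫ x in D.M, ‖modeState D n hm hp x‖ ^ 2 :=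
      setIntegral_mono_set hi (ae_of_all _ fun x => by positivity) (hAM.eventuallyLE)
    _ = 1 := h1

namespace GroundMode

variable {D : RoundSetting} {E : ℝ} {n : ℕ}

lemma integral_norm_sq_pos (m : GroundMode D E n) :
    0 < ∫ x in D.M, ‖modeState D n m.hm m.hp x‖ ^ 2 := by
  have h12 := D.R₁_lt_R₂
  rw [setIntegral_pos_iff_support_of_nonneg_ae (ae_of_all _ fun x => by positivity)
    (IsMode.integrable_norm_sq m.isMode.memLp_modeState)]
  refine (measure_annulus_pos D.R₀_nonneg D.R₀_lt_R₁).trans_le (measure_mono ?_)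
  rintro x ⟨h0, h1⟩
  refine ⟨?_, D.mem_M.2 ⟨h0.le, by linarith⟩⟩
  have hr : 0 < ‖x‖ := D.R₀_nonneg.trans_lt h0
  have hg := m.g_pos (Real.log ‖x‖) (by rwa [Real.exp_log hr]) (by rw [Real.exp_log hr]; exact h1.le)
  rw [← m.pow_mul_hm hr] at hg
  have hz : zc x ≠ 0 := by
    rw [← norm_ne_zero_iff, LinearIsometryEquiv.norm_map]; exact hr.ne'
  have hh : m.hm (‖x‖ ^ 2) ≠ 0 := fun h => by simp [h] at hg
  have : modeState D n m.hm m.hp x ≠ 0 := by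
    simp only [modeState, if_pos h1, modeFun]
    exact mul_ne_zero (pow_ne_zero _ hz) (Complex.ofReal_ne_zero.2 hh)
  simpa [Function.mem_support] using this

lemma norm_modeFun (n : ℕ) (h : ℝ → ℝ) (x : Plane) :
    ‖modeFun n h x‖ = |‖x‖ ^ n * h (‖x‖ ^ 2)| := by
  rw [modeFun, norm_mul, norm_pow, LinearIsometryEquiv.norm_map, Complex.norm_real, abs_mul,
    abs_of_nonneg (by positivity : (0 : ℝ) ≤ ‖x‖ ^ n), Real.norm_eq_abs]

/-- Normalized ground states are exponentially small away from the interface, because they are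
exponentially larger on a fixed annulus closer to it. -/
lemma exists_uniform_decay (D : RoundSetting) {E : ℝ} (hE : E < D.cp / D.R₂ ^ 2) {δ₀ : ℝ}
    (hδ₀ : 0 < δ₀) :
    ∃ (C d : ℝ) (N : ℕ), 0 ≤ C ∧ 0 < d ∧ ∀ n ≥ N, 1 ≤ n → ∀ (m : GroundMode D E n) (a : ℝ), 0 < a →
      ∫ x in D.M, ‖modeState D n (fun ρ => a * m.hm ρ) (fun ρ => a * m.hp ρ) x‖ ^ 2 = 1 →
      ∀ x ∈ awaySet D δ₀, ‖modeState D n (fun ρ => a * m.hm ρ) (fun ρ => a * m.hp ρ) x‖ ≤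
        C * Real.exp (-(d * n)) := by
  have hR1 := D.R₁_pos
  have hR2 := D.R₂_pos
  have hcp := D.cp_pos
  obtain ⟨δ, ⟨⟨⟨h1, h2⟩, h3⟩, h4⟩, hδ⟩ : ∃ δ : ℝ, (((D.R₁ - δ₀ < D.R₁ * Real.exp (-(3 * δ)) ∧
      D.R₀ < D.R₁ * Real.exp (-(3 * δ))) ∧ D.R₁ * Real.exp (2 * δ) < D.R₁ + δ₀) ∧
      D.R₁ * Real.exp (2 * δ) < D.R₂) ∧ 0 < δ := by
    have t1 : Tendsto (fun δ : ℝ => D.R₁ * Real.exp (-(3 * δ))) (𝓝[>] 0) (𝓝 D.R₁) := by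
      have : Continuous fun δ : ℝ => D.R₁ * Real.exp (-(3 * δ)) := by fun_prop
      simpa using (this.tendsto 0).mono_left nhdsWithin_le_nhds
    have t2 : Tendsto (fun δ : ℝ => D.R₁ * Real.exp (2 * δ)) (𝓝[>] 0) (𝓝 D.R₁) := by
      have : Continuous fun δ : ℝ => D.R₁ * Real.exp (2 * δ) := by fun_prop
      simpa using (this.tendsto 0).mono_left nhdsWithin_le_nhds
    exact ((((t1.eventually (lt_mem_nhds (by linarith))).and
      (t1.eventually (lt_mem_nhds D.R₀_lt_R₁))).and
      (t2.eventually (gt_mem_nhds (by linarith)))).and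
      (t2.eventually (gt_mem_nhds D.R₁_lt_R₂)) |>.and self_mem_nhdsWithin).exists
  obtain ⟨N, hN⟩ := inner_decay D E hδ h2
  have hex : ∀ a b : ℝ, a < b → D.R₁ * Real.exp a < D.R₁ * Real.exp b := fun a b h =>
    mul_lt_mul_of_pos_left (Real.exp_lt_exp.2 h) hR1
  have hex0 : ∀ a : ℝ, 0 < a → D.R₁ < D.R₁ * Real.exp a := fun a h => by
    simpa using hex 0 a h
  have hex1 : ∀ a : ℝ, 0 < a → D.R₁ * Real.exp (-a) < D.R₁ := fun a h => by
    simpa using hex (-a) 0 (by linarith)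
  set Am : Set Plane := {x | D.R₁ * Real.exp (-(2 * δ)) < ‖x‖ ∧ ‖x‖ < D.R₁ * Real.exp (-δ)} with hAm
  set Ap : Set Plane := {x | D.R₁ < ‖x‖ ∧ ‖x‖ < D.R₁ * Real.exp δ} with hAp
  have hmeas : ∀ a b : ℝ, MeasurableSet {x : Plane | a < ‖x‖ ∧ ‖x‖ < b} := fun a b =>
    ((isOpen_lt continuous_const continuous_norm).inter
      (isOpen_lt continuous_norm continuous_const)).measurableSet
  have hAmM : Am ⊆ D.M := fun x hx => D.mem_M.2
    ⟨(h2.trans ((hex _ _ (by linarith)).trans hx.1)).le,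
      (hx.2.trans ((hex1 δ hδ).trans D.R₁_lt_R₂)).le⟩
  have hApM : Ap ⊆ D.M := fun x hx => D.mem_M.2
    ⟨(D.R₀_lt_R₁.trans hx.1).le, (hx.2.trans ((hex _ _ (by linarith)).trans h4)).le⟩
  have hreal : ∀ A : Set Plane, A ⊆ D.M → 0 < volume A → 0 < volume.real A := fun A hA h =>
    ENNReal.toReal_pos h.ne' ((measure_mono hA).trans_lt ((measure_mono Set.sdiff_subset).trans_lt
      (isCompact_closedBall (0 : Plane) D.R₂).measure_lt_top)).ne
  have hVm : 0 < volume.real Am := hreal _ hAmM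
    (measure_annulus_pos (by positivity) (hex _ _ (by linarith)))
  have hVp : 0 < volume.real Ap := hreal _ hApM (measure_annulus_pos hR1.le (hex0 δ hδ))
  have hE1 : 0 < 1 - E * D.R₂ ^ 2 / D.cp := by
    rw [lt_div_iff₀ (by positivity)] at hE
    rw [sub_pos, div_lt_one hcp]
    exact hE
  have hE2 : 0 < 1 - Real.exp (-δ) := by simpa using hδ
  set dm := √(1 - Real.exp (-δ)) * δ with hdm
  set dp := √(1 - E * D.R₂ ^ 2 / D.cp) * δ with hdp
  have hdm0 : 0 < dm := mul_pos (Real.sqrt_pos.2 hE2) hδ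
  have hdp0 : 0 < dp := mul_pos (Real.sqrt_pos.2 hE1) hδ
  have conv : ∀ {y V d k : ℝ}, 0 ≤ y → 0 < V → (y * Real.exp (d * k) / 2) ^ 2 * V ≤ 1 →
      y ≤ 2 / √V * Real.exp (-(d * k)) := by
    intro y V d k hy hV h
    have h5 : y * Real.exp (d * k) / 2 * √V ≤ 1 := by
      rw [← abs_of_nonneg (show 0 ≤ y * Real.exp (d * k) / 2 * √V by positivity)]
      rw [← sq_le_one_iff_abs_le_one, mul_pow, Real.sq_sqrt hV.le]
      exact h
    have hsV := Real.sqrt_pos.2 hV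
    rw [Real.exp_neg, ← div_eq_mul_inv, div_div, le_div_iff₀ (mul_pos hsV (Real.exp_pos _))]
    nlinarith
  refine ⟨max (2 / √(volume.real Am)) (2 / √(volume.real Ap)), min dm dp, N, ?_, lt_min hdm0 hdp0,
    fun n hn hn1 m a ha hnorm x hx => ?_⟩
  · exact le_max_of_le_left (by positivity)
  have H := m.isMode.const_mul a
  have hn0 : (0 : ℝ) ≤ n := Nat.cast_nonneg n
  have hM := D.mem_M.1 hx.1
  have hval : ∀ y : Plane, ‖modeState D n (fun ρ => a * m.hm ρ) (fun ρ => a * m.hp ρ) y‖ =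
      a * ‖modeState D n m.hm m.hp y‖ := fun y => by
    rw [IsMode.modeState_const_mul, norm_mul, Complex.norm_real, Real.norm_of_nonneg ha.le]
  rcases hx.2 with hxr | hxr
  · have hxI : ‖x‖ ∈ Set.Icc D.R₀ (D.R₁ * Real.exp (-(3 * δ))) := ⟨hM.1, hxr.trans h1.le⟩
    have hlt : ‖x‖ < D.R₁ := by linarith
    refine (conv (d := dm) (k := n) (norm_nonneg _) hVm
      (H.mul_measure_le hnorm (hmeas _ _) hAmM (by positivity) fun y hy => ?_)).trans ?_
    · obtain ⟨hp1, hp2⟩ := hN n hn hn1 m _ hxI ‖y‖ ⟨hy.1.le, hy.2.le⟩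
      have hylt : ‖y‖ < D.R₁ := hy.2.trans (hex1 δ hδ)
      rw [hval, hval]
      simp only [modeState, if_pos hlt, if_pos hylt, norm_modeFun]
      rw [abs_of_nonneg hp1, mul_assoc, mul_div_assoc]
      exact mul_le_mul_of_nonneg_left (hp2.trans (le_abs_self _)) ha.le
    · gcongr
      · exact le_max_left _ _
      · exact min_le_left _ _
  · have hxI : ‖x‖ ∈ Set.Icc (D.R₁ * Real.exp (2 * δ)) D.R₂ := ⟨h3.le.trans hxr, hM.2⟩
    have hge : ¬ ‖x‖ < D.R₁ := by linarith
    refine (conv (d := dp) (k := n) (norm_nonneg _) hVp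
      (H.mul_measure_le hnorm (hmeas _ _) hApM (by positivity) fun y hy => ?_)).trans ?_
    · obtain ⟨hp1, hp2⟩ := m.outer_decay hE hn1 hδ h4 hxI (t := ‖y‖) ⟨hy.1.le, hy.2.le⟩
      rw [hval, hval]
      simp only [modeState, if_neg hge, if_neg (not_lt.2 hy.1.le), norm_modeFun]
      rw [abs_of_nonneg hp1, mul_assoc, mul_div_assoc]
      exact mul_le_mul_of_nonneg_left (hp2.trans (le_abs_self _)) ha.le
    · gcongr
      · exact le_max_right _ _
      · exact min_le_right _ _

end GroundMode

/-- Pointwise bounds on a set control the norm over a space-time cylinder. -/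
lemma spaceTimeNorm_le {D : RoundSetting} {T B : ℝ} {ω W : Set Plane}
    (hW : MeasurableSet W) (hWM : W ⊆ D.M) (hω : ω ⊆ W) {w : ℝ → Plane → ℂ}
    (h : ∀ t, ∀ x ∈ W, ‖w t x‖ ≤ B) :
    spaceTimeNorm T ω w ≤
      ENNReal.ofReal (√(volume.real (Set.Ioo 0 T ×ˢ D.M)) * B) := by
  have hfin : volume (Set.Ioo 0 T ×ˢ D.M) ≠ ⊤ := by
    rw [Measure.volume_eq_prod, Measure.prod_prod]
    exact (ENNReal.mul_lt_top (by simp) ((measure_mono Set.sdiff_subset).trans_lt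
      (isCompact_closedBall (0 : Plane) D.R₂).measure_lt_top)).ne
  calc spaceTimeNorm T ω w
      ≤ eLpNorm (fun p : ℝ × Plane => w p.1 p.2) 2 (volume.restrict (Set.Ioo 0 T ×ˢ W)) :=
        eLpNorm_mono_measure _ (Measure.restrict_mono (Set.prod_mono le_rfl hω) le_rfl)
    _ ≤ volume.restrict (Set.Ioo 0 T ×ˢ W) Set.univ ^ (2 : ℝ≥0∞).toReal⁻¹ * ENNReal.ofReal B := by
        refine eLpNorm_le_of_ae_bound ?_
        refine (ae_restrict_iff' (measurableSet_Ioo.prod hW)).2 (ae_of_all _ fun p hp => ?_)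
        exact h p.1 p.2 hp.2
    _ ≤ volume (Set.Ioo 0 T ×ˢ D.M) ^ (2 : ℝ≥0∞).toReal⁻¹ * ENNReal.ofReal B := by
        rw [Measure.restrict_apply_univ]
        gcongr
    _ = _ := by
        rw [ENNReal.ofReal_mul (Real.sqrt_nonneg _), Real.sqrt_eq_rpow, Measure.real,
          ENNReal.toReal_rpow, ENNReal.ofReal_toReal (ENNReal.rpow_ne_top_of_nonneg (by norm_num) hfin)]
        simp

/-- Existence of the whispering-gallery waves. Since their initial velocity vanishes, the energy
norm of the data is the frequency. -/
theorem exists_whispering_gallery_waves (D : RoundSetting)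
    (hc : D.cm / D.R₁ ^ 2 < D.cp / D.R₂ ^ 2) :
    ∃ (lam : ℕ → ℝ) (u : ℕ → Plane → ℂ),
      (∀ n, 0 < lam n) ∧ Tendsto lam atTop atTop ∧
      (∀ n, ∀ T : ℝ,
        D.IsWaveSolution T (fun t x => (Real.cos (√(lam n) * t) : ℂ) * u n x) (u n) 0) ∧
      (∀ n, l2Norm D.M (u n) = 1) ∧
      (∀ n, D.freq (u n) 0 ≠ ⊤) ∧
      (∀ n, D.energyNorm (u n) 0 = D.freq (u n) 0) ∧
      Tendsto (fun n => (D.freq (u n) 0).toReal) atTop atTop ∧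
      ∀ T : ℝ, ∀ ω ⊆ D.M, D.AwayFromInterface ω → ∃ C d : ℝ, 0 < C ∧ 0 < d ∧ ∀ n,
        spaceTimeNorm T ω (fun t x => (Real.cos (√(lam n) * t) : ℂ) * u n x) ≤
          ENNReal.ofReal (C * Real.exp (-d * (D.freq (u n) 0).toReal)) := by
  have hR1 := D.R₁_pos
  have hR2 := D.R₂_pos
  have hcm := D.cm_pos
  have hcp := D.cp_pos
  obtain ⟨E, hE0, hE, N₀, hex⟩ := exists_groundMode D hc
  obtain ⟨ν, hν⟩ : ∃ ν : ℕ → ℕ, ∀ j, ν j = N₀ + 1 + j := ⟨_, fun _ => rfl⟩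
  have hν1 : ∀ j, 1 ≤ ν j := fun j => by have := hν j; omega
  have hν1' : ∀ j, (1 : ℝ) ≤ ν j := fun j => by exact_mod_cast hν1 j
  have hνt : Tendsto (fun j => (ν j : ℝ)) atTop atTop :=
    tendsto_natCast_atTop_atTop.comp (tendsto_atTop_mono (fun j => show j ≤ ν j by have := hν j; omega) tendsto_id)
  have m : ∀ j, GroundMode D E (ν j) := fun j => (hex (ν j) (by have := hν j; omega) (hν1 j)).some
  set I : ℕ → ℝ := fun j => ∫ x in D.M, ‖modeState D (ν j) (m j).hm (m j).hp x‖ ^ 2 with hI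
  have hI0 : ∀ j, 0 < I j := fun j => (m j).integral_norm_sq_pos
  set a : ℕ → ℝ := fun j => (√(I j))⁻¹ with ha
  have ha0 : ∀ j, 0 < a j := fun j => inv_pos.2 (Real.sqrt_pos.2 (hI0 j))
  set u : ℕ → Plane → ℂ := fun j =>
    modeState D (ν j) (fun ρ => a j * (m j).hm ρ) (fun ρ => a j * (m j).hp ρ) with hu
  have hmode := fun j => (m j).isMode.const_mul (a j)
  have hnorm : ∀ j, ∫ x in D.M, ‖u j x‖ ^ 2 = 1 := by
    intro j
    have : ∀ x, ‖u j x‖ ^ 2 = (a j) ^ 2 * ‖modeState D (ν j) (m j).hm (m j).hp x‖ ^ 2 := fun x => by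
      simp only [hu]
      rw [IsMode.modeState_const_mul, norm_mul, mul_pow, Complex.norm_real,
        Real.norm_of_nonneg (ha0 j).le]
    simp_rw [this]
    rw [integral_const_mul]
    change a j ^ 2 * I j = 1
    rw [ha, inv_pow, Real.sq_sqrt (hI0 j).le, inv_mul_cancel₀ (hI0 j).ne']
  have hnorms := fun j => (hmode j).norms_of_normalized (hnorm j)
  set Gr : ℕ → ℝ := fun j => ∫ x in D.M, ‖modeStateGrad D (ν j) (fun ρ => a j * (m j).hm ρ)
    (fun ρ => a j * (m j).hp ρ) x‖ ^ 2 with hGr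
  have hfreq : ∀ j, D.freq (u j) 0 = ENNReal.ofReal (√(1 + Gr j)) := fun j => (hnorms j).2.2
  have hfreqR : ∀ j, (D.freq (u j) 0).toReal = √(1 + Gr j) := fun j => by
    rw [hfreq, ENNReal.toReal_ofReal (Real.sqrt_nonneg _)]
  have hmin : 0 < min D.cm D.cp := lt_min hcm hcp
  have hupper : ∀ j, √(1 + Gr j) ≤ √(1 + E / min D.cm D.cp) * ν j := by
    intro j
    have h1 := (hmode j).min_mul_integral_grad_le (hν1 j)
    have h2 : min D.cm D.cp * Gr j ≤ E * ν j ^ 2 := by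
      have h3 : min D.cm D.cp * Gr j ≤ (m j).lam * 1 := by rw [← hnorm j]; exact h1
      linarith [(m j).lam_le]
    rw [← le_div_iff₀' hmin] at h2
    refine Real.sqrt_le_iff.2 ⟨by positivity, ?_⟩
    rw [mul_pow, Real.sq_sqrt (by positivity)]
    have := hν1' j
    calc 1 + Gr j ≤ (ν j : ℝ) ^ 2 + E * ν j ^ 2 / min D.cm D.cp := by nlinarith
      _ = _ := by ring
  have hlower : ∀ j, ν j / D.R₂ ≤ √(1 + Gr j) := by
    intro j
    have h1 := (hmode j).mul_integral_le_integral_grad (hν1 j)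
    have h2 : (ν j : ℝ) ^ 2 * 1 ≤ D.R₂ ^ 2 * Gr j := by rw [← hnorm j]; exact h1
    refine Real.le_sqrt_of_sq_le ?_
    rw [div_pow, div_le_iff₀ (by positivity)]
    nlinarith [sq_nonneg D.R₂]
  refine ⟨fun j => (m j).lam, u, fun j => (m j).lam_pos (hν1 j), ?_,
    fun j T => (hmode j).isWaveSolution ((m j).lam_pos (hν1 j)).le T, fun j => (hnorms j).1,
    fun j => by rw [hfreq]; exact ENNReal.ofReal_ne_top,
    fun j => (hnorms j).2.1.trans (hnorms j).2.2.symm, ?_, fun T ω hω hS => ?_⟩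
  · refine tendsto_atTop_mono (fun j => ?_)
      (hνt.const_mul_atTop (show 0 < D.cm / D.R₁ ^ 2 by positivity))
    refine le_trans ?_ (m j).lam_ge
    rw [div_mul_eq_mul_div]
    have := hν1' j
    gcongr
    nlinarith
  · simp_rw [hfreqR]
    exact tendsto_atTop_mono hlower (hνt.atTop_div_const hR2)
  · obtain ⟨δ, hδ, hsub⟩ := exists_subset_awaySet hω hS
    obtain ⟨C, d, N, hC, hd, hdec⟩ := GroundMode.exists_uniform_decay D hE hδ
    -- the finitely many modes not covered by the decay estimate are bounded
    have hbdd : ∀ j, ∃ B : ℝ, 0 ≤ B ∧ ∀ x ∈ D.M, ‖u j x‖ ≤ B := by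
      intro j
      obtain ⟨B, hB⟩ := (hmode j).exists_bound_modeState
      exact ⟨|B|, abs_nonneg B, fun x hx => (hB x hx).trans (le_abs_self B)⟩
    choose B hB0 hB using hbdd
    set C' : ℝ := C + ∑ j ∈ Finset.range N, B j * Real.exp (d * ν j) with hC'
    have hC'0 : 0 ≤ C' := add_nonneg hC
      (Finset.sum_nonneg fun j _ => mul_nonneg (hB0 j) (Real.exp_pos _).le)
    have hpt : ∀ j, ∀ x ∈ awaySet D δ, ‖u j x‖ ≤ C' * Real.exp (-(d * ν j)) := by
      intro j x hx
      rcases lt_or_ge j N with hj | hj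
      · have h1 : B j * Real.exp (d * ν j) ≤ C' := by
          have := Finset.single_le_sum (f := fun j => B j * Real.exp (d * ν j))
            (fun i _ => mul_nonneg (hB0 i) (Real.exp_pos _).le) (Finset.mem_range.2 hj)
          linarith
        calc ‖u j x‖ ≤ B j := hB j x hx.1
          _ = B j * Real.exp (d * ν j) * Real.exp (-(d * ν j)) := by
            rw [mul_assoc, ← Real.exp_add]; simp
          _ ≤ _ := by gcongr
      · refine (hdec (ν j) (by have := hν j; omega) (hν1 j) (m j) (a j) (ha0 j) (hnorm j) x hx).trans ?_
        have : C ≤ C' := le_add_of_nonneg_right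
          (Finset.sum_nonneg fun j _ => mul_nonneg (hB0 j) (Real.exp_pos _).le)
        gcongr
    set L := √(1 + E / min D.cm D.cp) with hL
    have hL0 : 0 < L := Real.sqrt_pos.2 (by positivity)
    set V := √(volume.real (Set.Ioo 0 T ×ˢ D.M)) with hV
    refine ⟨V * C' + 1, d / L, by positivity, div_pos hd hL0, fun j => ?_⟩
    refine (spaceTimeNorm_le (D := D) (B := C' * Real.exp (-(d * ν j)))
      (measurableSet_awaySet D δ) (fun x hx => hx.1) hsub fun t x hx => ?_).trans ?_
    · rw [norm_mul, Complex.norm_real]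
      calc _ ≤ 1 * ‖u j x‖ := by
            gcongr
            exact Real.abs_cos_le_one _
        _ ≤ _ := by rw [one_mul]; exact hpt j x hx
    · refine ENNReal.ofReal_le_ofReal ?_
      rw [hfreqR, ← mul_assoc]
      have h1 : -(d * ν j) ≤ -(d / L) * √(1 + Gr j) := by
        have : d / L * √(1 + Gr j) ≤ d * ν j := by
          rw [div_mul_eq_mul_div, div_le_iff₀ hL0, mul_assoc]
          refine mul_le_mul_of_nonneg_left ?_ hd.le
          rw [mul_comm]
          exact hupper j
        linarith
      gcongr
      linarith

end WhisperingGallery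

end

theorem theorem1p4 (D : WhisperingGallery.RoundSetting)
    (hc : D.cm / D.R₁ ^ 2 < D.cp / D.R₂ ^ 2) :
    -- existence of whispering-gallery waves
    (∃ (lam : ℕ → ℝ) (u : ℕ → WhisperingGallery.Plane → ℂ)
        (w : ℕ → ℝ → WhisperingGallery.Plane → ℂ),
      (∀ n, 0 < lam n) ∧ Tendsto lam atTop atTop ∧
      (∀ n t x, w n t x = (Real.cos (√(lam n) * t) : ℂ) * u n x) ∧
      (∀ n, ∀ T : ℝ, 0 < T → D.IsWaveSolution T (w n) (u n) 0) ∧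
      (∀ n, WhisperingGallery.l2Norm D.M (w n 0) = 1) ∧
      (∀ n, D.freq (u n) 0 ≠ ⊤) ∧
      Tendsto (fun n => (D.freq (u n) 0).toReal) atTop atTop ∧
      ∀ T : ℝ, 0 < T → ∀ ω ⊆ D.M, D.AwayFromInterface ω →
        ∃ C d : ℝ, 0 < C ∧ 0 < d ∧ ∀ n,
          WhisperingGallery.spaceTimeNorm T ω (w n) ≤
            ENNReal.ofReal (C * Real.exp (-d * (D.freq (u n) 0).toReal))) ∧
    -- optimality: no subexponential function of the frequency can replace the exponential in
    -- the quantitative unique continuation estimate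
    (∀ T : ℝ, 0 < T → ∀ ω ⊆ D.M, D.AwayFromInterface ω →
      ∀ G : ℝ → ℝ, (∀ ε : ℝ, 0 < ε → G =O[atTop] fun s => Real.exp (ε * s)) →
        ¬ ∀ (w : ℝ → WhisperingGallery.Plane → ℂ) (w₀ w₁ : WhisperingGallery.Plane → ℂ),
          D.IsWaveSolution T w w₀ w₁ → D.energyNorm w₀ w₁ ≠ 0 → D.energyNorm w₀ w₁ ≠ ⊤ →
            D.energyNorm w₀ w₁ ≤
              ENNReal.ofReal (G (D.freq w₀ w₁).toReal) *
                WhisperingGallery.spaceTimeNorm T ω w) := by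
  obtain ⟨lam, u, hlam, hlamt, hsol, hl2, hfin, hen, hft, hdec⟩ :=
    WhisperingGallery.exists_whispering_gallery_waves D hc
  refine ⟨⟨lam, u, fun n t x => (Real.cos (√(lam n) * t) : ℂ) * u n x, hlam, hlamt,
    fun _ _ _ => rfl, fun n T _ => hsol n T, fun n => ?_, hfin, hft, fun T _ => hdec T⟩, ?_⟩
  · simpa using hl2 n
  · intro T _ ω hω hS G hG hest
    obtain ⟨C, d, hC, hd, hb⟩ := hdec T ω hω hS
    obtain ⟨K, hK⟩ := (hG (d / 2) (by positivity)).bound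
    obtain ⟨n, ⟨hn1, hn2⟩, hn3⟩ := (((hft.eventually hK).and
      (hft.eventually (eventually_gt_atTop (|K| * C)))).and
      (hft.eventually (eventually_gt_atTop 0))).exists
    set Λ := (D.freq (u n) 0).toReal with hΛ
    have hfr : D.energyNorm (u n) 0 = ENNReal.ofReal Λ := by
      rw [hen, hΛ, ENNReal.ofReal_toReal (hfin n)]
    have h1 := hest _ _ _ (hsol n T) (by rw [hfr]; simpa using hn3)
      (by rw [hfr]; exact ENNReal.ofReal_ne_top)
    have h2 := h1.trans (mul_le_mul_right (hb n) _)
    rw [hfr, ← ENNReal.ofReal_mul' (by positivity), ENNReal.ofReal_le_ofReal_iff'] at h2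
    have h3 : Λ ≤ G Λ * (C * Real.exp (-d * Λ)) := h2.resolve_right (not_le.2 hn3)
    have hGK : G Λ ≤ |K| * Real.exp (d / 2 * Λ) := by
      rw [Real.norm_of_nonneg (Real.exp_pos _).le] at hn1
      exact (le_abs_self _).trans (hn1.trans (by gcongr; exact le_abs_self K))
    have h4 : G Λ * (C * Real.exp (-d * Λ)) ≤ |K| * C := by
      calc G Λ * (C * Real.exp (-d * Λ))
          ≤ |K| * Real.exp (d / 2 * Λ) * (C * Real.exp (-d * Λ)) := by gcongr
        _ = |K| * C * Real.exp (-(d / 2 * Λ)) := by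
          rw [show -(d / 2 * Λ) = d / 2 * Λ + -d * Λ by ring, Real.exp_add]; ring
        _ ≤ |K| * C * 1 := by
          gcongr
          rw [Real.exp_le_one_iff]
          have := mul_pos hd hn3
          linarith
        _ = _ := mul_one _
    linarith
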